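/- **Problem.** There are $K$ families; family $f$ has a setup time $s(f)\ge 0$. There are $n$ jobs; job $j$ has a weight $w(j)\ge 0$ and consists of finitely many (at least one) operations, each with a processing time $p(o)\ge 0$ and a family. A schedule is a permutation of all operations on one machine; before the first operation, and whenever an operation of family $f$ follows an operation of another family, a setup of length $s(f)$ is inserted. The completion time of an operation is the total length of the setups and operations up to and including it, the completion time $C_j$ of a job is the maximum over its operations, and $\sum_j w(j)C_j$ is to be minimized ($1|\mathrm{fmls},s_f,\mathrm{order}|\sum wC$). In the *one-time setup problem* a schedule is instead a permutation of all operations together with one setup operation of length $s(f)$ for each family $f$, such that each operation comes after the setup operation of its family; no further setups are needed, and completion times and cost are defined as before. In its *glued* form each job $j$ is a single operation of length $p(j)\ge 0$ and has to come after the setup operations of all families in a given nonempty set $F_j$ (for a job with several operations: $p(j)=\sum_{o\in j}p(o)$, and $F_j$ is the set of families of its operations). *Local search* (glued form). Weighted SPT order sorts the jobs by $p(j)/w(j)$ (infinite if $w(j)=0$), ties in favour of the lower index. Fix an order $\tau$ of the setup operations. The $b$-th block is the sequence of jobs between the $b$-th setup and the next one (or the end); jobs within a block are always in weighted SPT order.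 Initially all jobs are in the last block. A move of $j$ puts it into a block preceded by the setups of all $f\in F_j$; the move is greedy if it strictly decreases the cost and no other move of $j$ gives a lower cost. Process the jobs in weighted SPT order and apply to each one its leftmost greedy move (the one into the earliest block); a job without a greedy move stays where it is. The *local search algorithm* sorts the jobs, enumerates all $K!$ orders $\tau$, runs the local search for each and returns the cheapest schedule found. *Transform* (with pull factor $\sqrt2$). Given a glued one-time setup schedule, drop the setup operations, split the jobs into their operations and divide the resulting sequence into batches (maximal runs of operations of one family). Go through the batches in order; append to the current batch $B$, of family $f$, the next later operations of family $f$, one after the other (closest batches first), as long as $p(B)<\sqrt2\, s(f)$ still holds after the addition, where $p(B)$ is the total processing time of $B$; remove batches that become empty. Running times count the steps of explicit programs for these algorithms on a unit-cost machine with real arithmetic and comparisons. **Theorem.** 1. For every valid glued instance and every setup order $\tau$, the local search yields a feasible schedule with setup order $\tau$ whose cost is minimum among all feasible one-time setup schedules with setup order $\tau$. 2. For every glued instance, the local search algorithm returns an optimal one-time setup schedule, which is the one produced by the local search for some order $\tau$. There is an absolute constant $C$ such that its running time is at most $C\cdot n(\log n+K)\cdot K!$ for all $n\ge1$ and all $K$,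 and hence, with $C$ absolute, at most $C\cdot n\log n\cdot K!$ whenever $n\ge 2^K$; that is, it is $O(n\log n\cdot K!)$ for a fixed number $K$ of families as $n\to\infty$. For jobs with several operations, splitting the jobs of the schedule returned for the glued instance into their operations gives an optimal solution of the one-time setup problem. 3. Gluing the jobs, running the local search algorithm and then Transform returns, on every instance, a schedule for $1|\mathrm{fmls},s_f,\mathrm{order}|\sum wC$ of cost at most $(1+\sqrt2)$ times the minimum cost. With $N$ the total number of operations, its running time is at most $C\cdot(N+K+1)^d\cdot K!$ for absolute constants $C,d$; in particular it is polynomial for every constant $K$. -/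

import Mathlib

/-! ## Cost model

A unit-cost real RAM: programs are written in the monad `Timed`, which counts executed steps.
One step is charged for inspecting a list (on every call of a recursive function), for allocating a
list cell or record, for reading or writing a table entry, and for each arithmetic operation and
each comparison. Tables (functions on `Fin m`) are arrays, used linearly. -/

structure Timed (α : Type) where
  val : α
  steps : ℕ

namespace Timed

instance : Monad Timed where
  pure a := ⟨a, 0⟩
  bind x f := ⟨(f x.val).val, x.steps + (f x.val).steps⟩

/-- Execute one primitive operation with result `a`. -/
def op {α : Type} (a : α) : Timed α := ⟨a, 1⟩

/-- One step for inspecting the argument of a recursive function. -/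
def tick : Timed Unit := ⟨(), 1⟩

/-- Allocate the list of the indices `0, …, m - 1`, in `m + 1` steps. -/
def indices (m : ℕ) : Timed (List (Fin m)) := ⟨List.finRange m, m + 1⟩

/-- Allocate an array of length `m` filled with `a`, in `m + 1` steps. -/
def newTable {α : Type} (m : ℕ) (a : α) : Timed (Fin m → α) := ⟨fun _ => a, m + 1⟩

def append {α : Type} : List α → List α → Timed (List α)
  | [], m => do
      tick
      return m
  | a :: l, m => do
      tick
      let r ← append l m
      op (a :: r)

def length {α : Type} : List α → Timed ℕ
  | [] => do
      tick
      return 0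
  | _ :: l => do
      tick
      let m ← length l
      op (m + 1)

/-- Split a list after its first `m` entries. -/
def split {α : Type} : ℕ → List α → Timed (List α × List α)
  | 0, l => do
      tick
      return ([], l)
  | _ + 1, [] => do
      tick
      return ([], [])
  | m + 1, a :: l => do
      tick
      let r ← split m l
      let x ← op (a :: r.1)
      return (x, r.2)

def merge {α : Type} (le : α → α → Timed Bool) : List α → List α → Timed (List α)
  | [], m => do
      tick
      return m
  | a :: l, [] => do
      tick
      return a :: l
  | a :: l, b :: m => do
      tick
      let c ← le a b
      if c then
        let r ← merge le l (b :: m)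
        op (a :: r)
      else
        let r ← merge le (a :: l) m
        op (b :: r)
termination_by l m => l.length + m.length

/-- Merge sort of a list of length `m`. -/
def mergeSort {α : Type} (le : α → α → Timed Bool) (m : ℕ) (l : List α) : Timed (List α) :=
  if m ≤ 1 then do
    tick
    return l
  else do
    tick
    let h ← op (m / 2)
    let _ ← op (m - h)
    let r ← split h l
    let x ← mergeSort le (m / 2) r.1
    let y ← mergeSort le (m - m / 2) r.2
    merge le x y
termination_by m
decreasing_by all_goals omega

def mapCons {α : Type} (y : α) : List (List α) → Timed (List (List α))
  | [] => do
      tick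
      return []
  | l :: ls => do
      tick
      let h ← op (y :: l)
      let r ← mapCons y ls
      op (h :: r)

/-- All lists that arise from inserting `x` somewhere into the given list. -/
def insertions {α : Type} (x : α) : List α → Timed (List (List α))
  | [] => do
      tick
      let h ← op [x]
      op [h]
  | y :: ys => do
      tick
      let rs ← insertions x ys
      let r ← mapCons y rs
      let h ← op (x :: y :: ys)
      op (h :: r)

def insertionsAll {α : Type} (x : α) : List (List α) → Timed (List (List α))
  | [] => do
      tick
      return []
  | l :: ls => do
      tick
      let a ← insertions x l
      let b ← insertionsAll x ls
      append a b

/-- All permutations of a list. -/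
def permutations {α : Type} : List α → Timed (List (List α))
  | [] => do
      tick
      op [[]]
  | x :: xs => do
      tick
      let ps ← permutations xs
      insertionsAll x ps

end Timed

open Timed

/-! ## The problem with setups on every change of family -/

/-- `K` families with setup times, and `n` jobs; job `j` has a weight and `numOps j` operations,
each with a processing time and a family. -/
structure OrderInstance (K n : ℕ) where
  weight : Fin n → ℝ
  numOps : Fin n → ℕ
  time : (j : Fin n) → Fin (numOps j) → ℝ
  fam : (j : Fin n) → Fin (numOps j) → Fin K
  setup : Fin K → ℝ

namespace OrderInstance

variable {K n : ℕ}

structure Valid (I : OrderInstance K n) : Prop where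
  weight_nonneg : ∀ j, 0 ≤ I.weight j
  time_nonneg : ∀ j i, 0 ≤ I.time j i
  setup_nonneg : ∀ f, 0 ≤ I.setup f
  /-- a job consists of at least one operation -/
  numOps_pos : ∀ j, 0 < I.numOps j

/-- Operations: pairs of a job and an index of one of its operations. -/
abbrev Op (I : OrderInstance K n) : Type := Σ j : Fin n, Fin (I.numOps j)

/-- The total number of operations. -/
def totalOps (I : OrderInstance K n) : ℕ := ∑ j, I.numOps j

/-- A schedule is a permutation of all operations. -/
def IsSchedule (I : OrderInstance K n) (L : List I.Op) : Prop := L.Nodup ∧ ∀ o, o ∈ L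

/-- Time needed to process a sequence of operations, setups included, when the machine was last
used for family `prev` (`none` at the beginning of the schedule). -/
noncomputable def duration (I : OrderInstance K n) : Option (Fin K) → List I.Op → ℝ
  | _, [] => 0
  | prev, o :: L =>
      (if prev = some (I.fam o.1 o.2) then 0 else I.setup (I.fam o.1 o.2)) + I.time o.1 o.2
        + I.duration (some (I.fam o.1 o.2)) L

noncomputable def completion (I : OrderInstance K n) (L : List I.Op) (o : I.Op) : ℝ :=
  I.duration none (L.take (L.idxOf o + 1))

/-- Completion time of a job: the maximum over its (finitely many) operations. -/
noncomputable def jobCompletion (I : OrderInstance K n) (L : List I.Op) (j : Fin n) : ℝ :=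
  ⨆ i : Fin (I.numOps j), I.completion L ⟨j, i⟩

noncomputable def cost (I : OrderInstance K n) (L : List I.Op) : ℝ :=
  ∑ j, I.weight j * I.jobCompletion L j

/-! ## The one-time setup relaxation

`Sum.inl f` is the setup operation of family `f`, `Sum.inr o` an operation of a job. -/

def IsOneTimeSchedule (I : OrderInstance K n) (L : List (Fin K ⊕ I.Op)) : Prop :=
  L.Nodup ∧ (∀ x, x ∈ L) ∧
    ∀ o : I.Op, L.idxOf (Sum.inl (I.fam o.1 o.2)) < L.idxOf (Sum.inr o)

def oneTimeLength (I : OrderInstance K n) : Fin K ⊕ I.Op → ℝ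
  | Sum.inl f => I.setup f
  | Sum.inr o => I.time o.1 o.2

noncomputable def oneTimeCompletion (I : OrderInstance K n) (L : List (Fin K ⊕ I.Op))
    (o : I.Op) : ℝ :=
  ((L.take (L.idxOf (Sum.inr o) + 1)).map I.oneTimeLength).sum

noncomputable def oneTimeCost (I : OrderInstance K n) (L : List (Fin K ⊕ I.Op)) : ℝ :=
  ∑ j, I.weight j * ⨆ i : Fin (I.numOps j), I.oneTimeCompletion L ⟨j, i⟩

end OrderInstance

/-! ## The one-time setup problem with glued jobs -/

/-- Every job `j` is a single operation of length `p j` and weight `w j`, which has to be preceded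
by the setups of all families `f` with `need j f = true`. -/
structure GluedInstance (K n : ℕ) where
  p : Fin n → ℝ
  w : Fin n → ℝ
  need : Fin n → Fin K → Bool
  setup : Fin K → ℝ

namespace GluedInstance

variable {K n : ℕ}

structure Valid (G : GluedInstance K n) : Prop where
  p_nonneg : ∀ j, 0 ≤ G.p j
  w_nonneg : ∀ j, 0 ≤ G.w j
  setup_nonneg : ∀ f, 0 ≤ G.setup f
  /-- the (nonempty) set of operations of a job involves at least one family -/
  need_nonempty : ∀ j, ∃ f, G.need j f = true

def IsSchedule (G : GluedInstance K n) (L : List (Fin K ⊕ Fin n)) : Prop :=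
  L.Nodup ∧ (∀ x, x ∈ L) ∧
    ∀ j f, G.need j f = true → L.idxOf (Sum.inl f) < L.idxOf (Sum.inr j)

def length (G : GluedInstance K n) : Fin K ⊕ Fin n → ℝ
  | Sum.inl f => G.setup f
  | Sum.inr j => G.p j

def completion (G : GluedInstance K n) (L : List (Fin K ⊕ Fin n)) (j : Fin n) : ℝ :=
  ((L.take (L.idxOf (Sum.inr j) + 1)).map G.length).sum

def cost (G : GluedInstance K n) (L : List (Fin K ⊕ Fin n)) : ℝ :=
  ∑ j, G.w j * G.completion L j

/-- The order in which a schedule performs the setups. -/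
def setupOrder (L : List (Fin K ⊕ Fin n)) : List (Fin K) := L.filterMap Sum.getLeft?

/-- The ratio `p j / w j`, which is infinite for jobs of weight zero. -/
noncomputable def ratio (G : GluedInstance K n) (j : Fin n) : WithTop ℝ :=
  if G.w j = 0 then ⊤ else ((G.p j / G.w j : ℝ) : WithTop ℝ)

/-- Weighted SPT order: by increasing ratio, ties in favour of the lower index. -/
def wsptLE (G : GluedInstance K n) (i k : Fin n) : Prop :=
  G.ratio i < G.ratio k ∨ (G.ratio i = G.ratio k ∧ i ≤ k)

open Classical in
/-- All jobs in weighted SPT order. -/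
noncomputable def wsptJobs (G : GluedInstance K n) : List (Fin n) :=
  (List.finRange n).insertionSort G.wsptLE

/-! ### Local search for a fixed setup order

The setup order is a permutation `τ`: the setup in position `b` is that of family `τ b`, and block
`b` is the sequence of jobs following it, up to the next setup. A schedule whose blocks are in
weighted SPT order is given by the function `β` that sends each job to its block. -/

noncomputable def blockSchedule (G : GluedInstance K n) (τ : Equiv.Perm (Fin K)) (β : Fin n → ℕ) :
    List (Fin K ⊕ Fin n) :=
  (List.finRange K).flatMap fun b =>
    Sum.inl (τ b) :: (G.wsptJobs.filter fun j => β j = (b : ℕ)).map Sum.inr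

/-- Initially all jobs follow all setups. -/
def initialBlocks (K n : ℕ) : Fin n → ℕ := fun _ => K - 1

/-- Job `j` may be moved to block `b`: all setups needed by `j` precede that block. -/
def IsMove (G : GluedInstance K n) (τ : Equiv.Perm (Fin K)) (j : Fin n) (b : ℕ) : Prop :=
  b < K ∧ ∀ f, G.need j f = true → (τ.symm f : ℕ) ≤ b

/-- A greedy move improves the cost, and no other move of `j` improves it more. -/
def IsGreedyMove (G : GluedInstance K n) (τ : Equiv.Perm (Fin K)) (β : Fin n → ℕ) (j : Fin n)
    (b : ℕ) : Prop :=
  G.IsMove τ j b ∧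
  G.cost (G.blockSchedule τ (Function.update β j b)) < G.cost (G.blockSchedule τ β) ∧
  ∀ b', G.IsMove τ j b' →
    G.cost (G.blockSchedule τ (Function.update β j b)) ≤
      G.cost (G.blockSchedule τ (Function.update β j b'))

open Classical in
/-- Apply the leftmost greedy move of `j`; if `j` has no greedy move, it stays where it is. -/
noncomputable def greedyStep (G : GluedInstance K n) (τ : Equiv.Perm (Fin K)) (β : Fin n → ℕ)
    (j : Fin n) : Fin n → ℕ :=
  if h : ∃ b, G.IsGreedyMove τ β j b then Function.update β j (Nat.find h) else β

/-- One leftmost greedy move for each job, in weighted SPT order. -/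
noncomputable def localSearch (G : GluedInstance K n) (τ : Equiv.Perm (Fin K)) : Fin n → ℕ :=
  G.wsptJobs.foldl (G.greedyStep τ) (initialBlocks K n)

/-! ### The local search algorithm as a program -/

noncomputable def ratioT (G : GluedInstance K n) (j : Fin n) : Timed (WithTop ℝ) := do
  let w ← op (G.w j)
  let z ← op (decide (w = 0))
  if z then
    op ⊤
  else
    let p ← op (G.p j)
    op ((p / w : ℝ) : WithTop ℝ)

noncomputable def wsptLET (G : GluedInstance K n) (i k : Fin n) : Timed Bool := do
  let x ← G.ratioT i
  let y ← G.ratioT k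
  let c ← op (decide (x < y))
  if c then
    return true
  else
    let e ← op (decide (x = y))
    if e then op (decide (i ≤ k)) else return false

/-- A block: the family of the setup that opens it, the jobs moved to it so far (latest first), the
total processing time including the setup, and the total weight. -/
structure Block (K n : ℕ) where
  fam : Fin K
  jobs : List (Fin n)
  time : ℝ
  weight : ℝ

/-- Create the empty blocks for a setup order; the last block becomes the head of the list. -/
def openBlocks (G : GluedInstance K n) : List (Fin K) → List (Block K n) →
    Timed (List (Block K n))
  | [], acc => do
      tick
      return acc
  | f :: τ, acc => do
      tick
      let s ← op (G.setup f)
      let B ← op (⟨f, [], s, 0⟩ : Block K n)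
      let acc' ← op (B :: acc)
      G.openBlocks τ acc'

/-- Scan the blocks from the last one to the first one into which `j` may be moved. Here `P` and
`W` are the total processing time and weight of the blocks scanned so far, `delta ≤ 0` is the best
change of the cost found so far, attained by the block at position `best` from the end. -/
noncomputable def scan (G : GluedInstance K n) (j : Fin n) :
    List (Block K n) → ℝ → ℝ → ℝ → ℕ → ℕ → Timed ℕ
  | [], _, _, _, _, best => do
      tick
      return best
  | B :: R, P, W, delta, pos, best => do
      tick
      let pj ← op (G.p j)
      let wj ← op (G.w j)
      let x ← op (pj * W)
      let y ← op (wj * P)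
      let d ← op (x - y)
      let c₁ ← op (decide (d < 0))
      let c₂ ← op (decide (d ≤ delta))
      let c ← op (c₁ && c₂)
      let delta' ← op (if c then d else delta)
      let best' ← op (if c then pos else best)
      let atEnd ← op (G.need j B.fam)
      if atEnd then
        return best'
      else
        let P' ← op (P + B.time)
        let W' ← op (W + B.weight)
        let pos' ← op (pos + 1)
        G.scan j R P' W' delta' pos' best'

/-- Put `j` at the end of the block at the given position from the end. -/
noncomputable def insertJob (G : GluedInstance K n) (j : Fin n) :
    ℕ → List (Block K n) → Timed (List (Block K n))
  | _, [] => do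
      tick
      return []
  | 0, B :: R => do
      tick
      let pj ← op (G.p j)
      let wj ← op (G.w j)
      let js ← op (j :: B.jobs)
      let t ← op (B.time + pj)
      let w ← op (B.weight + wj)
      let B' ← op (⟨B.fam, js, t, w⟩ : Block K n)
      op (B' :: R)
  | m + 1, B :: R => do
      tick
      let R' ← G.insertJob j m R
      op (B :: R')

/-- The leftmost greedy moves of the jobs in the given list, one after the other. -/
noncomputable def moveJobs (G : GluedInstance K n) :
    List (Fin n) → List (Block K n) → Timed (List (Block K n))
  | [], R => do
      tick
      return R
  | j :: js, R => do
      tick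
      let b ← G.scan j R 0 0 0 0 0
      let R' ← G.insertJob j b R
      G.moveJobs js R'

def emitJobs : List (Fin n) → List (Fin K ⊕ Fin n) → Timed (List (Fin K ⊕ Fin n))
  | [], acc => do
      tick
      return acc
  | j :: js, acc => do
      tick
      let acc' ← op (Sum.inr j :: acc)
      emitJobs js acc'

/-- Write out the schedule given by the blocks, from its end to its beginning. -/
def emitBlocks : List (Block K n) → List (Fin K ⊕ Fin n) → Timed (List (Fin K ⊕ Fin n))
  | [], acc => do
      tick
      return acc
  | B :: R, acc => do
      tick
      let acc₁ ← emitJobs B.jobs acc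
      let acc₂ ← op (Sum.inl B.fam :: acc₁)
      emitBlocks R acc₂

/-- Local search for one setup order, given the jobs in weighted SPT order. -/
noncomputable def localSearchT (G : GluedInstance K n) (order : List (Fin n))
    (τ : List (Fin K)) : Timed (List (Fin K ⊕ Fin n)) := do
  let R ← G.openBlocks τ []
  let R' ← G.moveJobs order R
  emitBlocks R' []

/-- The cost of a schedule; `t` is the current time, `c` the cost accumulated so far. -/
noncomputable def costT (G : GluedInstance K n) : List (Fin K ⊕ Fin n) → ℝ → ℝ → Timed ℝ
  | [], _, c => do
      tick
      return c
  | Sum.inl f :: L, t, c => do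
      tick
      let s ← op (G.setup f)
      let t' ← op (t + s)
      G.costT L t' c
  | Sum.inr j :: L, t, c => do
      tick
      let pj ← op (G.p j)
      let wj ← op (G.w j)
      let t' ← op (t + pj)
      let x ← op (wj * t')
      let c' ← op (c + x)
      G.costT L t' c'

/-- Run the local search for each of the given setup orders and keep the best schedule. -/
noncomputable def searchOrders (G : GluedInstance K n) (order : List (Fin n)) :
    List (List (Fin K)) → Option (ℝ × List (Fin K ⊕ Fin n)) →
      Timed (Option (ℝ × List (Fin K ⊕ Fin n)))
  | [], best => do
      tick
      return best
  | τ :: rest, best => do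
      tick
      let σ ← G.localSearchT order τ
      let c ← G.costT σ 0 0
      match best with
      | none => do
          let b ← op (some (c, σ))
          G.searchOrders order rest b
      | some (c', σ') => do
          let better ← op (decide (c < c'))
          let b ← op (if better then some (c, σ) else some (c', σ'))
          G.searchOrders order rest b

/-- The local search algorithm: sort the jobs, enumerate all setup orders, return the best
schedule found. -/
noncomputable def solve (G : GluedInstance K n) : Timed (List (Fin K ⊕ Fin n)) := do
  let js ← indices n
  let order ← mergeSort G.wsptLET n js
  let fs ← indices K
  let orders ← permutations fs
  let best ← G.searchOrders order orders none
  match best with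
  | none => return []
  | some (_, σ) => op σ

end GluedInstance

/-! ## Gluing, Transform, and the approximation algorithm -/

namespace OrderInstance

variable {K n : ℕ}

/-- Glue all operations of each job together. -/
def glue (I : OrderInstance K n) : GluedInstance K n where
  p j := ∑ i, I.time j i
  w := I.weight
  need j f := decide (∃ i, I.fam j i = f)
  setup := I.setup

/-- Replace every glued job of a schedule by its operations. -/
def unglue (I : OrderInstance K n) (σ : List (Fin K ⊕ Fin n)) : List (Fin K ⊕ I.Op) :=
  σ.flatMap fun
    | Sum.inl f => [Sum.inl f]
    | Sum.inr j => (List.finRange (I.numOps j)).map fun i => Sum.inr ⟨j, i⟩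

/-- Total time and set of families of the listed operations of job `j`. -/
noncomputable def glueJobT (I : OrderInstance K n) (j : Fin n) :
    List (Fin (I.numOps j)) → ℝ → (Fin K → Bool) → Timed (ℝ × (Fin K → Bool))
  | [], t, row => do
      tick
      return (t, row)
  | i :: is, t, row => do
      tick
      let x ← op (I.time j i)
      let t' ← op (t + x)
      let f ← op (I.fam j i)
      let row' ← op (Function.update row f true)
      I.glueJobT j is t' row'

noncomputable def glueJobsT (I : OrderInstance K n) :
    List (Fin n) → (Fin n → ℝ) → (Fin n → Fin K → Bool) → Timed (GluedInstance K n)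
  | [], p, need => do
      tick
      op ⟨p, I.weight, need, I.setup⟩
  | j :: js, p, need => do
      tick
      let is ← indices (I.numOps j)
      let row ← newTable K false
      let r ← I.glueJobT j is 0 row
      let p' ← op (Function.update p j r.1)
      let need' ← op (Function.update need j r.2)
      I.glueJobsT js p' need'

/-- The program that computes the glued instance. -/
noncomputable def glueT (I : OrderInstance K n) : Timed (GluedInstance K n) := do
  let js ← indices n
  let p ← newTable n (0 : ℝ)
  let emptyRow ← newTable K false
  let need ← newTable n emptyRow
  I.glueJobsT js p need

def tagOps (I : OrderInstance K n) (j : Fin n) : List (Fin (I.numOps j)) → Timed (List I.Op)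
  | [] => do
      tick
      return []
  | i :: is => do
      tick
      let r ← I.tagOps j is
      let o ← op (⟨j, i⟩ : I.Op)
      op (o :: r)

/-- Drop the setup operations and split the glued jobs into their operations. -/
def splitJobs (I : OrderInstance K n) : List (Fin K ⊕ Fin n) → Timed (List I.Op)
  | [] => do
      tick
      return []
  | Sum.inl _ :: σ => do
      tick
      I.splitJobs σ
  | Sum.inr j :: σ => do
      tick
      let is ← indices (I.numOps j)
      let a ← I.tagOps j is
      let r ← I.splitJobs σ
      append a r

/-- A batch: consecutive operations of the same family. -/
structure Batch (I : OrderInstance K n) where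
  fam : Fin K
  ops : List I.Op

/-- Divide a sequence of operations into its maximal batches. -/
def toBatches (I : OrderInstance K n) : List I.Op → Timed (List I.Batch)
  | [] => do
      tick
      return []
  | o :: L => do
      tick
      let f ← op (I.fam o.1 o.2)
      let bs ← I.toBatches L
      match bs with
      | [] => do
          let B ← op (⟨f, [o]⟩ : I.Batch)
          op [B]
      | B :: R => do
          let same ← op (decide (B.fam = f))
          if same then
            let x ← op (o :: B.ops)
            let B' ← op (⟨f, x⟩ : I.Batch)
            op (B' :: R)
          else
            let x ← op [o]
            let B' ← op (⟨f, x⟩ : I.Batch)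
            op (B' :: B :: R)

noncomputable def totalTime (I : OrderInstance K n) : List I.Op → Timed ℝ
  | [] => do
      tick
      return 0
  | o :: L => do
      tick
      let r ← I.totalTime L
      let x ← op (I.time o.1 o.2)
      op (x + r)

/-- Take operations from the front of a list as long as the running total stays below `limit`;
returns the operations taken, the new total, and the operations left. -/
noncomputable def pullOps (I : OrderInstance K n) (limit : ℝ) :
    List I.Op → ℝ → Timed (List I.Op × ℝ × List I.Op)
  | [], total => do
      tick
      return ([], total, [])
  | o :: L, total => do
      tick
      let x ← op (I.time o.1 o.2)
      let total' ← op (total + x)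
      let c ← op (decide (total' < limit))
      if c then
        let r ← I.pullOps limit L total'
        let a ← op (o :: r.1)
        return (a, r.2.1, r.2.2)
      else
        return ([], total, o :: L)

/-- Take operations of family `f` from the given batches, closest batch first, until the next such
operation would bring the running total to `limit` or more; batches that become empty are removed.
Returns the operations taken and the batches left. -/
noncomputable def pullBatches (I : OrderInstance K n) (f : Fin K) (limit : ℝ) :
    List I.Batch → ℝ → Timed (List I.Op × List I.Batch)
  | [], _ => do
      tick
      return ([], [])
  | B :: R, total => do
      tick
      let same ← op (decide (B.fam = f))
      if same then
        let q ← I.pullOps limit B.ops total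
        match q.2.2 with
        | [] => do
            let r ← I.pullBatches f limit R q.2.1
            let a ← append q.1 r.1
            return (a, r.2)
        | o :: L => do
            let B' ← op (⟨f, o :: L⟩ : I.Batch)
            let R' ← op (B' :: R)
            return (q.1, R')
      else
        let r ← I.pullBatches f limit R total
        let R' ← op (B :: r.2)
        return (r.1, R')

/-- Fill up the batches one after the other and concatenate them; the first argument bounds the
number of batches. -/
noncomputable def fillBatches (I : OrderInstance K n) (α : ℝ) :
    ℕ → List I.Batch → Timed (List I.Op)
  | 0, _ => do
      tick
      return []
  | _ + 1, [] => do
      tick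
      return []
  | m + 1, B :: R => do
      tick
      let s ← op (I.setup B.fam)
      let limit ← op (α * s)
      let total ← I.totalTime B.ops
      let r ← I.pullBatches B.fam limit R total
      let rest ← I.fillBatches α m r.2
      let a ← append r.1 rest
      append B.ops a

/-- The algorithm Transform with pull factor `α`. -/
noncomputable def transform (I : OrderInstance K n) (α : ℝ) (σ : List (Fin K ⊕ Fin n)) :
    Timed (List I.Op) := do
  let L ← I.splitJobs σ
  let bs ← I.toBatches L
  let m ← Timed.length bs
  I.fillBatches α m bs

/-- The approximation algorithm: glue the jobs, solve the one-time setup relaxation by local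
search, and apply Transform with pull factor `√2`. -/
noncomputable def approximate (I : OrderInstance K n) : Timed (List I.Op) := do
  let G ← I.glueT
  let σ ← G.solve
  I.transform (Real.sqrt 2) σ

end OrderInstance

/-! ## Positions in lists -/

/-! Fixed setup order. The cost of a schedule splits into terms of single jobs (own length and
preceding setups) and one term for each pair i, k with i earlier in weighted SPT order: w_k p_i if i
runs first, w_i p_k otherwise (`cost_eq`). The former is never larger (`w_mul_p_le_of_wsptLE`), so
sorting each block does no harm (`blockCost_le_cost`), and a schedule is just an assignment of jobs
to blocks. Moving k from block c to a later block d changes its cost relative to a fixed set of jobs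
by w_k P - W p_k, where P and W do not depend on k. Hence a move to the right that does not hurt j
does not hurt any job after j in SPT order (`relCost_le_of_wsptLE`). This drives `exchange`: a
feasible assignment γ that agrees with the local search so far can be made to agree on the next job
j as well, at no extra cost, by putting j into its best block b and taking along to b the later jobs
that γ has between its block for j and b. While the unprocessed jobs wait in the last block, a
greedy move of j minimizes exactly the cost of j relative to the processed jobs
(`blockCost_update_sub`), as `exchange` demands. Induction over the jobs gives
`foldl_greedyStep_optimal`.

Program. The scan goes through the blocks from the last one to the left and keeps the time P and
weight W passed so far; p_j W - w_j P is the cost change of a move to the current block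
(`tail_sub_eq`), so a job costs O(K) steps. `scan_val` is the loop invariant. Every schedule has
some setup order, so enumerating all orders gives the optimum.

Lower bound. From a schedule of the original problem, keep the first setup of each family and
postpone each job to its last operation. The result is a glued one-time schedule of no larger cost
(`glue_cost_le_cost`).

Transform with pull factor α. Fix an operation o and a family f with setup time s. If operations of
f remain before o after a batch has been filled up, then the batch together with the next such
operation has length at least α s, which pays for the setup of the batch; an operation is used at
most twice in such payments. Only for the last batch of f before o is the setup not paid, and only
there can operations from behind o be pulled ahead, of total length at most α s. So the completion
time of o exceeds the processing time before o by at most (1 + α) s for each family that occurs plus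
2/α times that processing time (`famBound_step`, `duration_fillBatches_le`). For α = √2 both the
setups and the processing time carry the factor 1 + √2. -/

instance Sum.instLawfulBEq {α β : Type*} [BEq α] [BEq β] [LawfulBEq α] [LawfulBEq β] :
    LawfulBEq (α ⊕ β) where
  rfl {x} := by
    rcases x with a | b
    · exact beq_self_eq_true a
    · exact beq_self_eq_true b
  eq_of_beq {x y} h := by
    rcases x with a | b <;> rcases y with c | d
    · exact congrArg Sum.inl (eq_of_beq (show (a == c) = true from h))
    · exact absurd (show false = true from h) (by decide)
    · exact absurd (show false = true from h) (by decide)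
    · exact congrArg Sum.inr (eq_of_beq (show (b == d) = true from h))

namespace List

theorem mem_take_iff_idxOf_lt' {α : Type*} [BEq α] [LawfulBEq α] {L : List α} {x : α}
    (hx : x ∈ L) (m : ℕ) : x ∈ L.take m ↔ L.idxOf x < m := by
  induction L generalizing m with
  | nil => simp at hx
  | cons a L ih =>
    cases m with
    | zero => simp
    | succ m =>
      rw [take_succ_cons, idxOf_cons]
      by_cases h : a = x
      · simp [h]
      · have hx' : x ∈ L := by simpa [Ne.symm h] using hx
        have ha : (a == x) = false := by simpa using h
        simp [Ne.symm h, ih hx', ha]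

theorem sum_map_take_idxOf {α M : Type*} [Fintype α] [BEq α] [LawfulBEq α] [AddCommMonoid M]
    {L : List α} (hn : L.Nodup) (hc : ∀ x, x ∈ L) (f : α → M) (x : α) :
    ((L.take (L.idxOf x + 1)).map f).sum
      = ∑ y, if L.idxOf y ≤ L.idxOf x then f y else 0 := by
  classical
  rw [← List.sum_toFinset f (hn.sublist (take_sublist _ _)), ← Finset.sum_filter]
  refine Finset.sum_congr ?_ fun _ _ => rfl
  ext y
  simp [mem_take_iff_idxOf_lt' (hc y)]

theorem rel_of_idxOf_lt {α : Type*} [BEq α] [LawfulBEq α] {R : α → α → Prop} {L : List α}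
    (hR : L.Pairwise R) {x y : α} (hy : y ∈ L) (h : L.idxOf x < L.idxOf y) : R x y := by
  have hyl := idxOf_lt_length_of_mem hy
  have := (pairwise_iff_getElem.1 hR) _ _ (h.trans hyl) hyl h
  simpa using this

theorem idxOf_lt_iff_rel {α : Type*} [BEq α] [LawfulBEq α] {R : α → α → Prop} {L : List α}
    (hR : L.Pairwise R) (hasymm : ∀ x y, R x y → ¬ R y x) {x y : α} (hx : x ∈ L) (hy : y ∈ L) :
    L.idxOf x < L.idxOf y ↔ R x y := by
  refine ⟨rel_of_idxOf_lt hR hy, fun h => ?_⟩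
  rcases lt_trichotomy (L.idxOf x) (L.idxOf y) with h' | h' | h'
  · exact h'
  · rw [idxOf_inj hx] at h'
    subst h'
    exact absurd h (hasymm _ _ h)
  · exact absurd h (hasymm _ _ (rel_of_idxOf_lt hR hx h'))

/-- Sort the whole type by the key. Glued schedules are later built from schedules of operations by
prescribing such keys. -/
theorem exists_idxOf_lt_iff_key {α : Type*} [Fintype α] [BEq α] [LawfulBEq α] (κ : α → ℕ)
    (hκ : Function.Injective κ) :
    ∃ L : List α, L.Nodup ∧ (∀ x, x ∈ L) ∧ ∀ x y, L.idxOf x < L.idxOf y ↔ κ x < κ y := by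
  classical
  let r : α → α → Prop := fun x y => κ x ≤ κ y
  have : Std.Total r := ⟨fun x y => le_total (κ x) (κ y)⟩
  have : IsTrans α r := ⟨fun x y z h h' => le_trans (α := ℕ) h h'⟩
  let L := (Finset.univ : Finset α).toList.insertionSort r
  have hp : L.Perm (Finset.univ : Finset α).toList := perm_insertionSort r _
  have hn : L.Nodup := hp.nodup_iff.2 (Finset.nodup_toList _)
  have hc : ∀ x, x ∈ L := fun x => hp.mem_iff.2 (by simp)
  have hs : L.Pairwise r := pairwise_insertionSort r _
  have hs' : L.Pairwise fun x y => κ x < κ y :=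
    (hs.and hn).imp fun {a b} h => lt_of_le_of_ne (show κ a ≤ κ b from h.1) fun he => h.2 (hκ he)
  exact ⟨L, hn, hc, fun x y =>
    idxOf_lt_iff_rel hs' (fun _ _ h h' => lt_asymm h h') (hc x) (hc y)⟩

end List

/-! ## Weighted SPT order -/

namespace GluedInstance

variable {K n : ℕ}

theorem wsptLE_total (G : GluedInstance K n) (i k : Fin n) : G.wsptLE i k ∨ G.wsptLE k i := by
  unfold wsptLE
  rcases lt_trichotomy (G.ratio i) (G.ratio k) with h | h | h
  · exact Or.inl (Or.inl h)
  · rcases le_total i k with h' | h'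
    · exact Or.inl (Or.inr ⟨h, h'⟩)
    · exact Or.inr (Or.inr ⟨h.symm, h'⟩)
  · exact Or.inr (Or.inl h)

theorem wsptLE_trans (G : GluedInstance K n) {i j k : Fin n} (h : G.wsptLE i j)
    (h' : G.wsptLE j k) : G.wsptLE i k := by
  unfold wsptLE at *
  rcases h with h | ⟨h, hi⟩ <;> rcases h' with h' | ⟨h', hi'⟩
  · exact Or.inl (h.trans h')
  · exact Or.inl (h' ▸ h)
  · exact Or.inl (h ▸ h')
  · exact Or.inr ⟨h.trans h', hi.trans hi'⟩

theorem wsptLE_antisymm (G : GluedInstance K n) {i k : Fin n} (h : G.wsptLE i k)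
    (h' : G.wsptLE k i) : i = k := by
  unfold wsptLE at *
  rcases h with h | ⟨h, hi⟩ <;> rcases h' with h' | ⟨h', hi'⟩
  · exact absurd h (lt_asymm h')
  · exact absurd h' h.ne'
  · exact absurd h h'.ne'
  · exact le_antisymm hi hi'

theorem ratio_le_of_wsptLE {G : GluedInstance K n} {i k : Fin n} (h : G.wsptLE i k) :
    G.ratio i ≤ G.ratio k :=
  h.elim le_of_lt fun h => h.1.le

theorem w_eq_zero_of_wsptLE {G : GluedInstance K n} {i k : Fin n} (h : G.wsptLE i k)
    (hi : G.w i = 0) : G.w k = 0 := by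
  have h' := ratio_le_of_wsptLE h
  unfold ratio at h'
  by_contra hk
  simp [hi, hk] at h'

/-- The cross-multiplied form of the comparison of ratios. It survives infinite ratios: a job of
weight zero is only followed by jobs of weight zero. -/
theorem w_mul_p_le_of_wsptLE {G : GluedInstance K n} (hG : G.Valid) {i k : Fin n}
    (h : G.wsptLE i k) : G.w k * G.p i ≤ G.w i * G.p k := by
  by_cases hk : G.w k = 0
  · rw [hk, zero_mul]
    exact mul_nonneg (hG.w_nonneg i) (hG.p_nonneg k)
  have hi : G.w i ≠ 0 := fun hi => hk (w_eq_zero_of_wsptLE h hi)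
  have h' := ratio_le_of_wsptLE h
  unfold ratio at h'
  rw [if_neg hi, if_neg hk, WithTop.coe_le_coe, div_le_div_iff₀
    (lt_of_le_of_ne (hG.w_nonneg i) (Ne.symm hi)) (lt_of_le_of_ne (hG.w_nonneg k) (Ne.symm hk))]
    at h'
  linarith

theorem wsptJobs_perm (G : GluedInstance K n) : G.wsptJobs.Perm (List.finRange n) := by
  classical
  exact List.perm_insertionSort _ _

theorem nodup_wsptJobs (G : GluedInstance K n) : G.wsptJobs.Nodup :=
  G.wsptJobs_perm.nodup_iff.2 (List.nodup_finRange n)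

theorem mem_wsptJobs (G : GluedInstance K n) (j : Fin n) : j ∈ G.wsptJobs :=
  G.wsptJobs_perm.mem_iff.2 (List.mem_finRange j)

theorem pairwise_wsptJobs (G : GluedInstance K n) : G.wsptJobs.Pairwise G.wsptLE := by
  have : Std.Total G.wsptLE := ⟨G.wsptLE_total⟩
  have : IsTrans (Fin n) G.wsptLE := ⟨fun _ _ _ => G.wsptLE_trans⟩
  classical
  exact List.pairwise_insertionSort _ _

/-- The position of a job in weighted SPT order. -/
noncomputable def rank (G : GluedInstance K n) (j : Fin n) : ℕ := G.wsptJobs.idxOf j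

theorem rank_injective (G : GluedInstance K n) : Function.Injective G.rank := fun i _ h =>
  (List.idxOf_inj (G.mem_wsptJobs i)).1 h

theorem wsptLE_of_rank_lt {G : GluedInstance K n} {i k : Fin n} (h : G.rank i < G.rank k) :
    G.wsptLE i k :=
  List.rel_of_idxOf_lt G.pairwise_wsptJobs (G.mem_wsptJobs k) h

/-- When the fold reaches j, the jobs of smaller rank are the ones already processed. This lets the
proofs speak of ranks instead of prefixes. -/
theorem rank_lt_iff {G : GluedInstance K n} {pre suf : List (Fin n)} {j : Fin n}
    (h : G.wsptJobs = pre ++ j :: suf) (i : Fin n) : G.rank i < G.rank j ↔ i ∈ pre := by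
  have hn := G.nodup_wsptJobs
  rw [h] at hn
  have hj : j ∉ pre := fun hj =>
    (List.nodup_append.1 hn).2.2 j hj j (List.mem_cons_self) rfl
  unfold rank
  rw [h, List.idxOf_append_of_notMem hj, List.idxOf_cons_self]
  by_cases hi : i ∈ pre
  · simpa [List.idxOf_append_of_mem hi, hi] using List.idxOf_lt_length_of_mem hi
  · simp [List.idxOf_append_of_notMem hi, hi]

theorem lt_rank_iff {G : GluedInstance K n} {pre suf : List (Fin n)} {j : Fin n}
    (h : G.wsptJobs = pre ++ j :: suf) (k : Fin n) : G.rank j < G.rank k ↔ k ∈ suf := by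
  have hn := G.nodup_wsptJobs
  have hk := G.mem_wsptJobs k
  rw [h] at hn hk
  rw [← not_le, le_iff_lt_or_eq, rank_lt_iff h, G.rank_injective.eq_iff]
  have hd := (List.nodup_append.1 hn).2.2
  have hj := (List.nodup_cons.1 (List.nodup_append.1 hn).2.1).1
  constructor
  · intro h'
    rw [not_or] at h'
    simpa [h'.1, h'.2] using hk
  · rintro hs (hp | rfl)
    · exact hd k hp k (List.mem_cons_of_mem _ hs) rfl
    · exact hj hs

/-! ## The cost of a schedule as a sum over pairs -/

theorem completion_eq {G : GluedInstance K n} {L : List (Fin K ⊕ Fin n)} (hn : L.Nodup)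
    (hc : ∀ x, x ∈ L) (j : Fin n) :
    G.completion L j
      = (∑ f, if L.idxOf (Sum.inl f) < L.idxOf (Sum.inr j) then G.setup f else 0)
        + ∑ i, if L.idxOf (Sum.inr i) ≤ L.idxOf (Sum.inr j) then G.p i else 0 := by
  unfold completion
  rw [List.sum_map_take_idxOf hn hc, Fintype.sum_sum_type]
  congr 1
  refine Finset.sum_congr rfl fun f _ => ?_
  have : L.idxOf (Sum.inl f) ≠ L.idxOf (Sum.inr j) := fun h => by
    simpa using (List.idxOf_inj (hc _)).1 h
  simp [length, le_iff_lt_or_eq, this]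

/-- Each unordered pair is collected once, at its member that is later in SPT order. -/
theorem sum_sum_eq_sum_sum_rank (G : GluedInstance K n) (g : Fin n → Fin n → ℝ)
    (hg : ∀ i, g i i = 0) :
    ∑ k, ∑ i, g i k = ∑ k, ∑ i, if G.rank i < G.rank k then g i k + g k i else 0 := by
  have h1 : ∀ k i, g i k = (if G.rank i < G.rank k then g i k else 0)
      + if G.rank k < G.rank i then g i k else 0 := by
    intro k i
    rcases lt_trichotomy (G.rank i) (G.rank k) with h | h | h
    · simp [h, h.not_gt]
    · have := G.rank_injective h
      subst this
      simp [hg]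
    · simp [h, h.not_gt]
  calc ∑ k, ∑ i, g i k
      = (∑ k, ∑ i, if G.rank i < G.rank k then g i k else 0)
        + ∑ k, ∑ i, if G.rank k < G.rank i then g i k else 0 := by
        simp_rw [← Finset.sum_add_distrib, ← h1]
    _ = (∑ k, ∑ i, if G.rank i < G.rank k then g i k else 0)
        + ∑ k, ∑ i, if G.rank i < G.rank k then g k i else 0 := by
        congr 1
        exact Finset.sum_comm
    _ = _ := by
        simp_rw [← Finset.sum_add_distrib]
        refine Finset.sum_congr rfl fun k _ => Finset.sum_congr rfl fun i _ => ?_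
        split_ifs <;> simp

/-- Of two jobs, the one that runs first delays the other by its length. Charging this delay to the
job of larger rank gives a sum in which only the relative order of each pair and the setups before
each job matter. -/
theorem cost_eq {G : GluedInstance K n} {L : List (Fin K ⊕ Fin n)} (hn : L.Nodup)
    (hc : ∀ x, x ∈ L) :
    G.cost L = ∑ k, (G.w k * (G.p k +
        ∑ f, if L.idxOf (Sum.inl f) < L.idxOf (Sum.inr k) then G.setup f else 0)
      + ∑ i, if G.rank i < G.rank k then
          (if L.idxOf (Sum.inr i) < L.idxOf (Sum.inr k) then G.w k * G.p i else G.w i * G.p k)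
        else 0) := by
  have hinj : ∀ i k : Fin n, L.idxOf (Sum.inr i) = L.idxOf (Sum.inr k) ↔ i = k := fun i k => by
    simp [List.idxOf_inj (hc _)]
  have h1 : ∀ k, ∑ i, (if L.idxOf (Sum.inr i) ≤ L.idxOf (Sum.inr k) then G.p i else 0)
      = G.p k + ∑ i, if L.idxOf (Sum.inr i) < L.idxOf (Sum.inr k) then G.p i else 0 := by
    intro k
    have : G.p k = ∑ i, if i = k then G.p i else 0 := by simp
    rw [this, ← Finset.sum_add_distrib]
    refine Finset.sum_congr rfl fun i _ => ?_
    rcases eq_or_ne i k with rfl | h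
    · simp
    · simp [le_iff_lt_or_eq, hinj, h]
  have h2 := G.sum_sum_eq_sum_sum_rank
    (fun i k => if L.idxOf (Sum.inr i) < L.idxOf (Sum.inr k) then G.w k * G.p i else 0)
    (fun i => by simp)
  unfold cost
  simp_rw [completion_eq hn hc, h1, mul_add, ← add_assoc, Finset.sum_add_distrib]
  rw [add_comm (∑ x, G.w x * ∑ f, _)]
  congr 1
  simp_rw [Finset.mul_sum, mul_ite, mul_zero]
  rw [h2]
  refine Finset.sum_congr rfl fun k _ => Finset.sum_congr rfl fun i _ => ?_
  by_cases hr : G.rank i < G.rank k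
  · have hne : L.idxOf (Sum.inr i) ≠ L.idxOf (Sum.inr k) := fun h => by
      rw [(hinj i k).1 h] at hr
      exact lt_irrefl _ hr
    rcases hne.lt_or_gt with h | h
    · simp [hr, h, h.not_gt]
    · simp [hr, h, h.not_gt]
  · simp [hr]

end GluedInstance

namespace GluedInstance

variable {K n : ℕ}

/-! ## Block schedules -/

/-- The order of a schedule given by blocks. -/
def BlockLT (G : GluedInstance K n) (τ : Equiv.Perm (Fin K)) (β : Fin n → ℕ) :
    Fin K ⊕ Fin n → Fin K ⊕ Fin n → Prop
  | Sum.inl f, Sum.inl g => τ.symm f < τ.symm g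
  | Sum.inl f, Sum.inr k => (τ.symm f : ℕ) ≤ β k
  | Sum.inr i, Sum.inl g => β i < τ.symm g
  | Sum.inr i, Sum.inr k => β i < β k ∨ β i = β k ∧ G.rank i < G.rank k

theorem BlockLT.asymm {G : GluedInstance K n} {τ : Equiv.Perm (Fin K)} {β : Fin n → ℕ}
    (x y : Fin K ⊕ Fin n) (h : G.BlockLT τ β x y) : ¬ G.BlockLT τ β y x := by
  rcases x with f | i <;> rcases y with g | k <;> simp only [BlockLT] at * <;> omega

theorem pairwise_blockSchedule (G : GluedInstance K n) (τ : Equiv.Perm (Fin K))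
    (β : Fin n → ℕ) : (G.blockSchedule τ β).Pairwise (G.BlockLT τ β) := by
  unfold blockSchedule
  rw [List.pairwise_flatMap]
  constructor
  · intro b _
    rw [List.pairwise_cons]
    constructor
    · intro x hx
      obtain ⟨j, hj, rfl⟩ := List.mem_map.1 hx
      have : β j = b := by simpa using (List.mem_filter.1 hj).2
      simp [BlockLT, this]
    · rw [List.pairwise_map]
      have hr : G.wsptJobs.Pairwise fun i k => G.rank i < G.rank k := by
        rw [List.pairwise_iff_getElem]
        intro i k hi hk h
        unfold rank
        rwa [G.nodup_wsptJobs.idxOf_getElem, G.nodup_wsptJobs.idxOf_getElem]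
      refine List.Pairwise.imp_of_mem ?_ (hr.filter _)
      intro i k hi hk h
      have hi' : β i = b := by simpa using (List.mem_filter.1 hi).2
      have hk' : β k = b := by simpa using (List.mem_filter.1 hk).2
      exact Or.inr ⟨hi'.trans hk'.symm, h⟩
  · refine (List.pairwise_lt_finRange K).imp ?_
    intro b c hbc x hx y hy
    have key : ∀ (d : Fin K) (z : Fin K ⊕ Fin n),
        z ∈ (Sum.inl (τ d) :: (G.wsptJobs.filter fun j => β j = (d : ℕ)).map Sum.inr
          : List (Fin K ⊕ Fin n)) → z = Sum.inl (τ d) ∨ ∃ j, β j = d ∧ z = Sum.inr j := by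
      intro d z hz
      rcases List.mem_cons.1 hz with h | h
      · exact Or.inl h
      · obtain ⟨j, hj, rfl⟩ := List.mem_map.1 h
        exact Or.inr ⟨j, by simpa using (List.mem_filter.1 hj).2, rfl⟩
    have hbc' : (b : ℕ) < c := hbc
    rcases key b x hx with rfl | ⟨i, hi, rfl⟩ <;> rcases key c y hy with rfl | ⟨k, hk, rfl⟩
    · simpa [BlockLT] using hbc
    · simp only [BlockLT, Equiv.symm_apply_apply]; omega
    · simp only [BlockLT, Equiv.symm_apply_apply]; omega
    · exact Or.inl (by omega)

theorem mem_blockSchedule (G : GluedInstance K n) (τ : Equiv.Perm (Fin K)) {β : Fin n → ℕ}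
    (hβ : ∀ j, β j < K) (x : Fin K ⊕ Fin n) : x ∈ G.blockSchedule τ β := by
  unfold blockSchedule
  rw [List.mem_flatMap]
  rcases x with f | j
  · exact ⟨τ.symm f, List.mem_finRange _, by simp⟩
  · exact ⟨⟨β j, hβ j⟩, List.mem_finRange _, by simp [G.mem_wsptJobs]⟩

theorem nodup_blockSchedule (G : GluedInstance K n) (τ : Equiv.Perm (Fin K)) (β : Fin n → ℕ) :
    (G.blockSchedule τ β).Nodup :=
  (G.pairwise_blockSchedule τ β).imp fun {x y} h he => by
    subst he
    exact BlockLT.asymm _ _ h h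

theorem idxOf_blockSchedule_lt_iff (G : GluedInstance K n) (τ : Equiv.Perm (Fin K))
    {β : Fin n → ℕ} (hβ : ∀ j, β j < K) (x y : Fin K ⊕ Fin n) :
    (G.blockSchedule τ β).idxOf x < (G.blockSchedule τ β).idxOf y ↔ G.BlockLT τ β x y :=
  List.idxOf_lt_iff_rel (G.pairwise_blockSchedule τ β) BlockLT.asymm
    (G.mem_blockSchedule τ hβ x) (G.mem_blockSchedule τ hβ y)

theorem isSchedule_blockSchedule {G : GluedInstance K n} {τ : Equiv.Perm (Fin K)}
    {β : Fin n → ℕ} (hβ : ∀ j, G.IsMove τ j (β j)) : G.IsSchedule (G.blockSchedule τ β) :=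
  ⟨G.nodup_blockSchedule τ β, G.mem_blockSchedule τ fun j => (hβ j).1, fun j f hf =>
    (G.idxOf_blockSchedule_lt_iff τ (fun j => (hβ j).1) _ _).2 ((hβ j).2 f hf)⟩

theorem setupOrder_blockSchedule (G : GluedInstance K n) (τ : Equiv.Perm (Fin K))
    (β : Fin n → ℕ) : setupOrder (G.blockSchedule τ β) = List.ofFn τ := by
  have h : ∀ l : List (Fin n),
      (l.map (Sum.inr : Fin n → Fin K ⊕ Fin n)).filterMap Sum.getLeft? = [] := by
    intro l
    induction l <;> simp_all
  unfold setupOrder blockSchedule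
  rw [List.filterMap_flatMap, List.ofFn_eq_map, ← List.flatMap_singleton' ((List.finRange K).map τ),
    List.flatMap_map]
  refine List.flatMap_congr fun b _ => ?_
  simp [h]

/-! ## The cost in terms of blocks -/

/-- Total length of the setups up to block `c`. -/
def setupTime (G : GluedInstance K n) (τ : Equiv.Perm (Fin K)) (c : ℕ) : ℝ :=
  ∑ f, if (τ.symm f : ℕ) ≤ c then G.setup f else 0

/-- The cost of job `k` in block `c` with respect to the setups and to the jobs in `S`. -/
noncomputable def relCost (G : GluedInstance K n) (τ : Equiv.Perm (Fin K)) (β : Fin n → ℕ)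
    (S : Fin n → Prop) [DecidablePred S] (k : Fin n) (c : ℕ) : ℝ :=
  G.w k * G.setupTime τ c +
    ∑ i, if S i then (if β i ≤ c then G.w k * G.p i else G.w i * G.p k) else 0

/-- With sorted blocks, the job of smaller rank runs first exactly if its block is not the later
one, so the pair terms depend on the blocks alone. -/
noncomputable def blockCost (G : GluedInstance K n) (τ : Equiv.Perm (Fin K)) (β : Fin n → ℕ) : ℝ :=
  ∑ k, (G.w k * G.p k + G.relCost τ β (fun i => G.rank i < G.rank k) k (β k))

theorem cost_blockSchedule (G : GluedInstance K n) (τ : Equiv.Perm (Fin K)) {β : Fin n → ℕ}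
    (hβ : ∀ j, β j < K) : G.cost (G.blockSchedule τ β) = G.blockCost τ β := by
  rw [cost_eq (G.nodup_blockSchedule τ β) (G.mem_blockSchedule τ hβ)]
  have hf : ∀ f k, (G.blockSchedule τ β).idxOf (Sum.inl f) < (G.blockSchedule τ β).idxOf (Sum.inr k)
      ↔ (τ.symm f : ℕ) ≤ β k := fun f k => G.idxOf_blockSchedule_lt_iff τ hβ _ _
  have hj : ∀ i k, (G.blockSchedule τ β).idxOf (Sum.inr i) < (G.blockSchedule τ β).idxOf (Sum.inr k)
      ↔ (β i < β k ∨ β i = β k ∧ G.rank i < G.rank k) :=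
    fun i k => G.idxOf_blockSchedule_lt_iff τ hβ _ _
  unfold blockCost relCost setupTime
  refine Finset.sum_congr rfl fun k _ => ?_
  rw [mul_add, add_assoc]
  simp_rw [hf, hj]
  congr 2
  refine Finset.sum_congr rfl fun i _ => ?_
  by_cases h : G.rank i < G.rank k
  · simp [h, ← le_iff_lt_or_eq]
  · simp [h]

/-- The setups before a job form an initial segment of the setup order, nonempty because the job
needs some family. The block is the last position in it. -/
theorem exists_blocks {G : GluedInstance K n} (hG : G.Valid) {τ : Equiv.Perm (Fin K)}
    {L : List (Fin K ⊕ Fin n)} (hL : G.IsSchedule L) (hτ : setupOrder L = List.ofFn τ) :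
    ∃ β : Fin n → ℕ, ∀ j, β j < K ∧
      ∀ f, L.idxOf (Sum.inl f) < L.idxOf (Sum.inr j) ↔ (τ.symm f : ℕ) ≤ β j := by
  have hmono : ∀ b c : Fin K, b < c → L.idxOf (Sum.inl (τ b)) < L.idxOf (Sum.inl (τ c)) := by
    have hL' : L.Pairwise fun x y => L.idxOf x < L.idxOf y := by
      rw [List.pairwise_iff_getElem]
      intro i k hi hk h
      rwa [hL.1.idxOf_getElem, hL.1.idxOf_getElem]
    have h : (List.ofFn τ).Pairwise fun f g => L.idxOf (Sum.inl f) < L.idxOf (Sum.inl g) := by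
      rw [← hτ]
      unfold setupOrder
      rw [List.pairwise_filterMap]
      refine hL'.imp ?_
      rintro (f | i) (g | k) h <;> simp_all
    intro b c hbc
    have := (List.pairwise_iff_getElem.1 h) b c (by simp) (by simp) hbc
    simpa using this
  choose f₀ hf₀ using hG.need_nonempty
  have hmax : ∀ j, ∃ b : Fin K, ∀ c : Fin K,
      L.idxOf (Sum.inl (τ c)) < L.idxOf (Sum.inr j) ↔ c ≤ b := by
    intro j
    obtain ⟨b, hb, hb'⟩ := Finset.exists_max_image
      (Finset.univ.filter fun c => L.idxOf (Sum.inl (τ c)) < L.idxOf (Sum.inr j)) id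
      ⟨τ.symm (f₀ j), by simpa using hL.2.2 j _ (hf₀ j)⟩
    refine ⟨b, fun c => ⟨fun hc => hb' c (by simpa using hc), fun hc => ?_⟩⟩
    have hb'' : L.idxOf (Sum.inl (τ b)) < L.idxOf (Sum.inr j) := by simpa using hb
    rcases hc.lt_or_eq with h | rfl
    · exact (hmono c b h).trans hb''
    · exact hb''
  choose β hβ using hmax
  refine ⟨fun j => β j, fun j => ⟨(β j).2, fun f => ?_⟩⟩
  have := hβ j (τ.symm f)
  rw [Equiv.apply_symm_apply] at this
  rw [this, Fin.le_def]

/-- The setup terms agree. If i runs before k, then the block of i is not later, and both sides pay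
w_k p_i; if not, the given schedule pays w_i p_k, the larger of the two possible values. -/
theorem blockCost_le_cost {G : GluedInstance K n} (hG : G.Valid) {τ : Equiv.Perm (Fin K)}
    {L : List (Fin K ⊕ Fin n)} (hL : G.IsSchedule L) {β : Fin n → ℕ}
    (hβ : ∀ j, β j < K ∧
      ∀ f, L.idxOf (Sum.inl f) < L.idxOf (Sum.inr j) ↔ (τ.symm f : ℕ) ≤ β j) :
    G.blockCost τ β ≤ G.cost L := by
  rw [cost_eq hL.1 hL.2.1]
  unfold blockCost relCost setupTime
  refine Finset.sum_le_sum fun k _ => ?_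
  rw [mul_add, add_assoc]
  simp_rw [fun j f => (hβ j).2 f]
  gcongr with i _
  by_cases h : G.rank i < G.rank k
  · have hw := w_mul_p_le_of_wsptLE hG (wsptLE_of_rank_lt h)
    simp only [h, if_true]
    by_cases hik : L.idxOf (Sum.inr i) < L.idxOf (Sum.inr k)
    · have : β i ≤ β k := by
        have h' := ((hβ i).2 (τ ⟨β i, (hβ i).1⟩)).2 (by simp)
        simpa using ((hβ k).2 (τ ⟨β i, (hβ i).1⟩)).1 (h'.trans hik)
      simp [this, hik]
    · rw [if_neg hik]
      split_ifs
      · exact hw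
      · exact le_rfl
  · simp [h]

/-! ## Optimality of greedy moves -/

/-- Only the setups and jobs strictly after block c and up to block d change sides. Their total time
and weight do not involve k, so k enters only through its weight and length. -/
theorem relCost_sub (G : GluedInstance K n) (τ : Equiv.Perm (Fin K)) (β : Fin n → ℕ)
    (S : Fin n → Prop) [DecidablePred S] (k : Fin n) {c d : ℕ} (h : c ≤ d) :
    G.relCost τ β S k d - G.relCost τ β S k c
      = G.w k * (G.setupTime τ d - G.setupTime τ c
          + ∑ i, if S i ∧ c < β i ∧ β i ≤ d then G.p i else 0)
        - (∑ i, if S i ∧ c < β i ∧ β i ≤ d then G.w i else 0) * G.p k := by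
  unfold relCost
  rw [add_sub_add_comm, ← Finset.sum_sub_distrib, mul_add, add_sub_assoc, mul_sub, Finset.mul_sum,
    Finset.sum_mul, ← Finset.sum_sub_distrib]
  congr 1
  refine Finset.sum_congr rfl fun i _ => ?_
  by_cases hS : S i
  · rcases lt_or_ge c (β i) with h1 | h1
    · by_cases h2 : β i ≤ d
      · simp [hS, h1, h2, h1.not_ge]
      · simp [hS, h1, h2, h1.not_ge]
    · simp [hS, h1, h1.trans h, h1.not_gt]
  · simp [hS]

/-- Going right pays off if w P ≤ W p, and this condition is inherited by jobs with a larger ratio p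
/ w. -/
theorem relCost_le_of_wsptLE {G : GluedInstance K n} (hG : G.Valid) {τ : Equiv.Perm (Fin K)}
    {β : Fin n → ℕ} {S : Fin n → Prop} [DecidablePred S] {j k : Fin n} (hjk : G.wsptLE j k)
    {c d : ℕ} (h : c ≤ d) (hj : G.relCost τ β S j d ≤ G.relCost τ β S j c) :
    G.relCost τ β S k d ≤ G.relCost τ β S k c := by
  have h1 := G.relCost_sub τ β S j h
  have h2 := G.relCost_sub τ β S k h
  set P := G.setupTime τ d - G.setupTime τ c
    + ∑ i, if S i ∧ c < β i ∧ β i ≤ d then G.p i else 0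
  have hW : 0 ≤ ∑ i, if S i ∧ c < β i ∧ β i ≤ d then G.w i else 0 :=
    Finset.sum_nonneg fun i _ => by
      split_ifs
      · exact hG.w_nonneg i
      · exact le_rfl
  set W := ∑ i, if S i ∧ c < β i ∧ β i ≤ d then G.w i else 0
  have h3 : G.w j * P ≤ W * G.p j := by linarith
  suffices G.w k * P ≤ W * G.p k by linarith
  have hpk := hG.p_nonneg k
  have hwk := hG.w_nonneg k
  rcases (hG.w_nonneg j).eq_or_lt with h0 | h0
  · rw [w_eq_zero_of_wsptLE hjk h0.symm, zero_mul]
    positivity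
  · have h4 := w_mul_p_le_of_wsptLE hG hjk
    -- After multiplication by w_j > 0: w_j w_k P ≤ w_k W p_j ≤ W w_j p_k.
    refine le_of_mul_le_mul_left ?_ h0
    nlinarith [mul_le_mul_of_nonneg_left h3 hwk, mul_le_mul_of_nonneg_left h4 hW]

/-- The cost relative to the jobs before j does not increase: for j by minimality, for the jobs
taken along because going right is at least as good for them as for j. Among j and the later jobs,
every pair in SPT order stays in SPT order. -/
theorem exchange {G : GluedInstance K n} (hG : G.Valid) {τ : Equiv.Perm (Fin K)}
    {β γ : Fin n → ℕ} {j : Fin n} {b : ℕ} (hb : G.IsMove τ j b)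
    (hmin : ∀ c, G.IsMove τ j c → G.relCost τ β (fun i => G.rank i < G.rank j) j b
      ≤ G.relCost τ β (fun i => G.rank i < G.rank j) j c)
    (hγ : ∀ k, G.IsMove τ k (γ k)) (hγβ : ∀ k, G.rank k < G.rank j → γ k = β k) :
    ∃ γ' : Fin n → ℕ, (∀ k, G.IsMove τ k (γ' k)) ∧ (∀ k, G.rank k < G.rank j → γ' k = β k) ∧
      γ' j = b ∧ G.blockCost τ γ' ≤ G.blockCost τ γ := by
  classical
  -- If b is to the left of the old block of j, the inner condition is void and j moves alone.
  -- Otherwise the later jobs from the old block of j up to just before b join it; moving right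
  -- keeps them feasible.
  let γ' : Fin n → ℕ := fun k =>
    if k = j then b else if G.rank j < G.rank k ∧ γ j ≤ γ k ∧ γ k < b then b else γ k
  have hj : γ' j = b := if_pos rfl
  have hlt : ∀ k, G.rank k < G.rank j → γ' k = γ k := by
    intro k hk
    have : k ≠ j := fun h => by simp [h] at hk
    simp [γ', this, hk.not_gt]
  have hgt : ∀ k, k ≠ j → γ' k = γ k ∨ (G.rank j < G.rank k ∧ γ j ≤ γ k ∧ γ k < b ∧ γ' k = b) := by
    intro k hk
    by_cases h : G.rank j < G.rank k ∧ γ j ≤ γ k ∧ γ k < b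
    · exact Or.inr ⟨h.1, h.2.1, h.2.2, by simp [γ', hk, h]⟩
    · exact Or.inl (by simp only [γ', if_neg hk, if_neg h])
  refine ⟨γ', fun k => ?_, fun k hk => (hlt k hk).trans (hγβ k hk), hj, ?_⟩
  · by_cases hk : k = j
    · subst hk
      rwa [hj]
    · rcases hgt k hk with h | h
      · rw [h]
        exact hγ k
      · rw [h.2.2.2]
        exact ⟨hb.1, fun f hf => ((hγ k).2 f hf).trans h.2.2.1.le⟩
  -- The new assignment preserves weak block order from a job to one of larger rank, so no pair
  -- switches to its expensive value.
  have hmon : ∀ i k, G.rank j ≤ G.rank i → G.rank i < G.rank k → γ i ≤ γ k → γ' i ≤ γ' k := by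
    intro i k hi hik h
    have hk : k ≠ j := fun h => by
      subst h
      omega
    have hjk : G.rank j < G.rank k := by omega
    have hk' : γ' k = if γ j ≤ γ k ∧ γ k < b then b else γ k := by simp [γ', hk, hjk]
    by_cases hij : i = j
    · subst hij
      rw [hj, hk']
      split_ifs <;> omega
    · have hjr : G.rank j < G.rank i := lt_of_le_of_ne hi fun h => hij (G.rank_injective h.symm)
      have hi' : γ' i = if γ j ≤ γ i ∧ γ i < b then b else γ i := by simp [γ', hij, hjr]
      rw [hi', hk']
      split_ifs <;> omega
  have hself : ∀ k, G.rank j ≤ G.rank k →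
      G.relCost τ β (fun i => G.rank i < G.rank j) k (γ' k)
        ≤ G.relCost τ β (fun i => G.rank i < G.rank j) k (γ k) := by
    intro k hk
    by_cases hkj : k = j
    · subst hkj
      rw [hj]
      exact hmin _ (hγ _)
    · rcases hgt k hkj with h | h
      · rw [h]
      -- The old block of k is not before that of j under γ, hence admissible for j. So minimality
      -- compares it with b for j, and the comparison carries over to k.
      · rw [h.2.2.2]
        exact relCost_le_of_wsptLE hG (wsptLE_of_rank_lt h.1) h.2.2.1.le
          (hmin _ ⟨h.2.2.1.trans hb.1, fun f hf => ((hγ j).2 f hf).trans h.2.1⟩)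
  -- The jobs before j have the same blocks in both assignments, so their share is computed with β;
  -- the rest are pairs among j and later jobs.
  have hsplit : ∀ (δ : Fin n → ℕ) k, (∀ i, G.rank i < G.rank j → δ i = β i) →
      G.rank j ≤ G.rank k →
      G.relCost τ δ (fun i => G.rank i < G.rank k) k (δ k)
        = G.relCost τ β (fun i => G.rank i < G.rank j) k (δ k)
          + ∑ i, if G.rank j ≤ G.rank i ∧ G.rank i < G.rank k then
              (if δ i ≤ δ k then G.w k * G.p i else G.w i * G.p k) else 0 := by
    intro δ k hδ hk
    unfold relCost
    rw [add_assoc, ← Finset.sum_add_distrib]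
    congr 1
    refine Finset.sum_congr rfl fun i _ => ?_
    by_cases hi : G.rank i < G.rank j
    · simp [hi, hi.trans_le hk, hi.not_ge, hδ i hi]
    · simp [hi, not_lt.1 hi]
  unfold blockCost
  refine Finset.sum_le_sum fun k _ => add_le_add_right ?_ _
  rcases lt_or_ge (G.rank k) (G.rank j) with hk | hk
  · rw [hlt k hk]
    unfold relCost
    refine le_of_eq (congrArg _ (Finset.sum_congr rfl fun i _ => ?_))
    by_cases hi : G.rank i < G.rank k
    · simp [hi, hlt i (hi.trans hk)]
    · simp [hi]
  · rw [hsplit γ' k (fun i hi => (hlt i hi).trans (hγβ i hi)) hk, hsplit γ k hγβ hk]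
    refine add_le_add (hself k hk) (Finset.sum_le_sum fun i _ => ?_)
    by_cases hi : G.rank j ≤ G.rank i ∧ G.rank i < G.rank k
    · simp only [hi, and_self, if_true]
      have hw := w_mul_p_le_of_wsptLE hG (wsptLE_of_rank_lt hi.2)
      by_cases h : γ i ≤ γ k
      · rw [if_pos h, if_pos (hmon i k hi.1 hi.2 h)]
      · rw [if_neg h]
        split_ifs
        · exact hw
        · exact le_rfl
    · simp [hi]

end GluedInstance

namespace GluedInstance

variable {K n : ℕ}

/-! ## Greedy moves -/

/-- Every later job sits in the last block, so j precedes it wherever j is put; only the term of j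
itself changes. -/
theorem blockCost_update_sub (G : GluedInstance K n) (τ : Equiv.Perm (Fin K)) {β : Fin n → ℕ}
    {j : Fin n} (hβ : ∀ k, G.rank j < G.rank k → β k = K - 1) {c d : ℕ} (hc : c < K)
    (hd : d < K) :
    G.blockCost τ (Function.update β j c) - G.blockCost τ (Function.update β j d)
      = G.relCost τ β (fun i => G.rank i < G.rank j) j c
        - G.relCost τ β (fun i => G.rank i < G.rank j) j d := by
  have hself : ∀ e, G.relCost τ (Function.update β j e) (fun i => G.rank i < G.rank j) j e
      = G.relCost τ β (fun i => G.rank i < G.rank j) j e := by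
    intro e
    unfold relCost
    refine congrArg _ (Finset.sum_congr rfl fun i _ => ?_)
    by_cases hi : G.rank i < G.rank j
    · have : i ≠ j := fun h => by simp [h] at hi
      simp [this]
    · simp [hi]
  have hother : ∀ k, k ≠ j → ∀ e, e < K →
      G.relCost τ (Function.update β j e) (fun i => G.rank i < G.rank k) k (β k)
      = G.w k * G.setupTime τ (β k) + ∑ i, if G.rank i < G.rank k then
          (if i = j ∨ β i ≤ β k then G.w k * G.p i else G.w i * G.p k) else 0 := by
    intro k hk e he
    unfold relCost
    refine congrArg _ (Finset.sum_congr rfl fun i _ => ?_)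
    by_cases hi : G.rank i < G.rank k
    · by_cases hij : i = j
      · subst hij
        have : e ≤ β k := by rw [hβ k hi]; omega
        simp [hi, this]
      · simp [hi, hij]
    · simp [hi]
  unfold blockCost
  rw [← Finset.sum_sub_distrib, Finset.sum_eq_single_of_mem j (Finset.mem_univ j)]
  · simp only [Function.update_self]
    rw [hself, hself]
    ring
  · intro k _ hk
    simp only [Function.update_of_ne hk]
    rw [hother k hk c hc, hother k hk d hd, sub_self]

/-- `b` is the leftmost best block for `j`, or the last block if no other block is better. -/
def IsBestBlock (G : GluedInstance K n) (τ : Equiv.Perm (Fin K)) (β : Fin n → ℕ) (j : Fin n)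
    (b : ℕ) : Prop :=
  G.IsMove τ j b ∧
  (∀ c, G.IsMove τ j c → G.relCost τ β (fun i => G.rank i < G.rank j) j b
    ≤ G.relCost τ β (fun i => G.rank i < G.rank j) j c) ∧
  (b = K - 1 ∨
    G.relCost τ β (fun i => G.rank i < G.rank j) j b
      < G.relCost τ β (fun i => G.rank i < G.rank j) j (K - 1) ∧
    ∀ c, G.IsMove τ j c → c < b → G.relCost τ β (fun i => G.rank i < G.rank j) j b
      < G.relCost τ β (fun i => G.rank i < G.rank j) j c)

theorem isMove_last {G : GluedInstance K n} (hG : G.Valid) (τ : Equiv.Perm (Fin K)) (j : Fin n) :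
    G.IsMove τ j (K - 1) := by
  obtain ⟨f, _⟩ := hG.need_nonempty j
  have := f.2
  exact ⟨by omega, fun g _ => by have := (τ.symm g).2; omega⟩

/-- Before its step j is in the last block, so a move is an improvement exactly if it beats that
block. If the last block is itself optimal there is no greedy move, even when other blocks tie with
it. -/
theorem greedyStep_eq {G : GluedInstance K n} (hG : G.Valid) {τ : Equiv.Perm (Fin K)}
    {β : Fin n → ℕ} (hβK : ∀ k, β k < K) {j : Fin n}
    (hβ : ∀ k, G.rank j ≤ G.rank k → β k = K - 1) {b : ℕ} (hb : G.IsBestBlock τ β j b) :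
    G.greedyStep τ β j = Function.update β j b := by
  have hβ' : ∀ k, G.rank j < G.rank k → β k = K - 1 := fun k hk => hβ k hk.le
  have hself : Function.update β j (K - 1) = β := by
    rw [← hβ j le_rfl, Function.update_eq_self]
  have hK : K - 1 < K := (isMove_last hG τ j).1
  have hupd : ∀ c, c < K → ∀ k, Function.update β j c k < K := by
    intro c hc k
    by_cases hk : k = j
    · subst hk
      simpa using hc
    · simpa [hk] using hβK k
  have hlt : ∀ c d, c < K → d < K →
      (G.cost (G.blockSchedule τ (Function.update β j c))
        < G.cost (G.blockSchedule τ (Function.update β j d)) ↔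
      G.relCost τ β (fun i => G.rank i < G.rank j) j c
        < G.relCost τ β (fun i => G.rank i < G.rank j) j d) := by
    intro c d hc hd
    rw [G.cost_blockSchedule τ (hupd c hc), G.cost_blockSchedule τ (hupd d hd), ← sub_neg,
      G.blockCost_update_sub τ hβ' hc hd, sub_neg]
  have hgreedy : ∀ c, G.IsGreedyMove τ β j c ↔ G.IsMove τ j c ∧
      G.relCost τ β (fun i => G.rank i < G.rank j) j c
        < G.relCost τ β (fun i => G.rank i < G.rank j) j (K - 1) ∧
      ∀ d, G.IsMove τ j d → G.relCost τ β (fun i => G.rank i < G.rank j) j c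
        ≤ G.relCost τ β (fun i => G.rank i < G.rank j) j d := by
    intro c
    unfold IsGreedyMove
    refine and_congr_right fun hc => and_congr ?_ (forall_congr' fun d => ?_)
    · rw [← hlt c (K - 1) hc.1 hK, hself]
    · refine forall_congr' fun hd => ?_
      rw [← not_lt, hlt d c hd.1 hc.1, not_lt]
  obtain ⟨hb1, hb2, hb3⟩ := hb
  unfold greedyStep
  split_ifs with h
  · congr 1
    classical
    rw [Nat.find_eq_iff]
    have hlast : G.relCost τ β (fun i => G.rank i < G.rank j) j b
        < G.relCost τ β (fun i => G.rank i < G.rank j) j (K - 1) := by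
      obtain ⟨c, hc⟩ := h
      rw [hgreedy] at hc
      exact (hb2 c hc.1).trans_lt hc.2.1
    refine ⟨(hgreedy b).2 ⟨hb1, hlast, hb2⟩, fun c hc hc' => ?_⟩
    rw [hgreedy] at hc'
    rcases hb3 with rfl | hb3
    · exact lt_irrefl _ hlast
    · exact absurd (hc'.2.2 b hb1) (not_le.2 (hb3.2 c hc'.1 hc))
  · rcases hb3 with rfl | hb3
    · exact hself.symm
    · exact absurd ⟨b, (hgreedy b).2 ⟨hb1, hb3.1, hb2⟩⟩ h

theorem exists_isBestBlock {G : GluedInstance K n} (hG : G.Valid) (τ : Equiv.Perm (Fin K))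
    (β : Fin n → ℕ) (j : Fin n) : ∃ b, G.IsBestBlock τ β j b := by
  classical
  let r := G.relCost τ β (fun i => G.rank i < G.rank j) j
  have hlast := isMove_last hG τ j
  obtain ⟨a, ha, ha'⟩ := Finset.exists_min_image ((Finset.range K).filter (G.IsMove τ j)) r
    ⟨K - 1, Finset.mem_filter.2 ⟨Finset.mem_range.2 hlast.1, hlast⟩⟩
  have hmin : ∀ c, G.IsMove τ j c → r a ≤ r c := fun c hc =>
    ha' c (Finset.mem_filter.2 ⟨Finset.mem_range.2 hc.1, hc⟩)
  rcases (hmin _ hlast).eq_or_lt with h | h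
  · exact ⟨K - 1, hlast, fun c hc => h.symm.le.trans (hmin c hc), Or.inl rfl⟩
  · have hex : ∃ b, G.IsMove τ j b ∧ r b ≤ r a := ⟨a, (Finset.mem_filter.1 ha).2, le_rfl⟩
    obtain ⟨hb, hb'⟩ := Nat.find_spec hex
    refine ⟨Nat.find hex, hb, fun c hc => hb'.trans (hmin c hc),
      Or.inr ⟨hb'.trans_lt h, fun c hc hcb => ?_⟩⟩
    have := Nat.find_min hex hcb
    exact hb'.trans_lt (not_le.1 fun h => this ⟨hc, h⟩)

/-! ## Optimality of the local search -/

/-- The first part of the jobs has been moved and the others are still in the last block. -/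
structure SearchState (G : GluedInstance K n) (τ : Equiv.Perm (Fin K)) (suf : List (Fin n))
    (β : Fin n → ℕ) : Prop where
  isMove : ∀ k, G.IsMove τ k (β k)
  last : ∀ k ∈ suf, β k = K - 1

theorem searchState_initial {G : GluedInstance K n} (hG : G.Valid) (τ : Equiv.Perm (Fin K)) :
    G.SearchState τ G.wsptJobs (initialBlocks K n) :=
  ⟨fun k => isMove_last hG τ k, fun _ _ => rfl⟩

theorem SearchState.last_of_rank_le {G : GluedInstance K n} {τ : Equiv.Perm (Fin K)}
    {pre suf : List (Fin n)} {j : Fin n} {β : Fin n → ℕ} (h : G.SearchState τ (j :: suf) β)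
    (hl : G.wsptJobs = pre ++ j :: suf) (k : Fin n) (hk : G.rank j ≤ G.rank k) : β k = K - 1 := by
  rcases hk.lt_or_eq with hk | hk
  · exact h.last k (List.mem_cons_of_mem _ ((lt_rank_iff hl k).1 hk))
  · exact h.last k (by rw [G.rank_injective hk]; exact List.mem_cons_self)

theorem SearchState.update {G : GluedInstance K n} {τ : Equiv.Perm (Fin K)}
    {pre suf : List (Fin n)} {j : Fin n} {β : Fin n → ℕ} (h : G.SearchState τ (j :: suf) β)
    (hl : G.wsptJobs = pre ++ j :: suf) {b : ℕ} (hb : G.IsMove τ j b) :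
    G.SearchState τ suf (Function.update β j b) := by
  constructor
  · intro k
    by_cases hk : k = j
    · subst hk
      simpa using hb
    · simpa [hk] using h.isMove k
  · intro k hk
    have hkj : k ≠ j := fun e => by
      subst e
      exact lt_irrefl _ ((lt_rank_iff hl k).2 hk)
    simpa [hkj] using h.last k (List.mem_cons_of_mem _ hk)

/-- The competitor γ is changed along with the search: it agrees with β on the processed jobs, and
`exchange` makes it agree on the next one without raising its cost. When no jobs are left, the two
coincide. -/
theorem foldl_greedyStep_optimal {G : GluedInstance K n} (hG : G.Valid) {τ : Equiv.Perm (Fin K)}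
    (suf : List (Fin n)) : ∀ (pre : List (Fin n)) (β γ : Fin n → ℕ), G.wsptJobs = pre ++ suf →
      G.SearchState τ suf β → (∀ k, G.IsMove τ k (γ k)) → (∀ k ∈ pre, γ k = β k) →
      G.SearchState τ [] (suf.foldl (G.greedyStep τ) β) ∧
        G.blockCost τ (suf.foldl (G.greedyStep τ) β) ≤ G.blockCost τ γ := by
  induction suf with
  | nil =>
    intro pre β γ hl hβ hγ hγβ
    have : γ = β := funext fun k => hγβ k (by simpa [hl] using G.mem_wsptJobs k)
    exact ⟨hβ, this ▸ le_rfl⟩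
  | cons j suf ih =>
    intro pre β γ hl hβ hγ hγβ
    obtain ⟨b, hb⟩ := exists_isBestBlock hG τ β j
    have hstep := greedyStep_eq hG (fun k => (hβ.isMove k).1) (hβ.last_of_rank_le hl) hb
    obtain ⟨γ', h1, h2, h3, h4⟩ := exchange hG hb.1 hb.2.1 hγ
      fun k hk => hγβ k ((rank_lt_iff hl k).1 hk)
    rw [List.foldl_cons, hstep]
    obtain ⟨h5, h6⟩ := ih (pre ++ [j]) _ γ' (by simp [hl]) (hβ.update hl hb.1) h1 (by
      intro k hk
      by_cases hkj : k = j
      · subst hkj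
        simp [h3]
      · have hk' : k ∈ pre := by simpa [hkj] using hk
        rw [h2 k ((rank_lt_iff hl k).2 hk'), Function.update_of_ne hkj])
    exact ⟨h5, h6.trans h4⟩

theorem localSearch_isMove {G : GluedInstance K n} (hG : G.Valid) (τ : Equiv.Perm (Fin K))
    (j : Fin n) : G.IsMove τ j (G.localSearch τ j) :=
  (foldl_greedyStep_optimal hG G.wsptJobs [] (initialBlocks K n) _ rfl (searchState_initial hG τ)
    (fun k => isMove_last hG τ k) (by simp)).1.isMove j

theorem localSearch_optimal {G : GluedInstance K n} (hG : G.Valid) (τ : Equiv.Perm (Fin K))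
    {L : List (Fin K ⊕ Fin n)} (hL : G.IsSchedule L) (hτ : setupOrder L = List.ofFn τ) :
    G.cost (G.blockSchedule τ (G.localSearch τ)) ≤ G.cost L := by
  obtain ⟨γ, hγ⟩ := exists_blocks hG hL hτ
  rw [G.cost_blockSchedule τ fun j => (localSearch_isMove hG τ j).1]
  refine le_trans ?_ (blockCost_le_cost hG hL hγ)
  exact (foldl_greedyStep_optimal hG G.wsptJobs [] (initialBlocks K n) γ rfl
    (searchState_initial hG τ) (fun k => ⟨(hγ k).1, fun f hf => ((hγ k).2 f).1 (hL.2.2 k f hf)⟩)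
    (by simp)).2

end GluedInstance

/-! ## Values of the timed programs -/

namespace Timed

@[simp] theorem pure_val {α : Type} (a : α) : (pure a : Timed α).val = a := rfl
@[simp] theorem pure_steps {α : Type} (a : α) : (pure a : Timed α).steps = 0 := rfl
@[simp] theorem bind_val {α β : Type} (x : Timed α) (f : α → Timed β) :
    (x >>= f).val = (f x.val).val := rfl
@[simp] theorem bind_steps {α β : Type} (x : Timed α) (f : α → Timed β) :
    (x >>= f).steps = x.steps + (f x.val).steps := rfl
@[simp] theorem op_val {α : Type} (a : α) : (op a).val = a := rfl
@[simp] theorem op_steps {α : Type} (a : α) : (op a).steps = 1 := rfl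
@[simp] theorem tick_steps : tick.steps = 1 := rfl
@[simp] theorem indices_val (m : ℕ) : (indices m).val = List.finRange m := rfl
@[simp] theorem indices_steps (m : ℕ) : (indices m).steps = m + 1 := rfl
@[simp] theorem newTable_val {α : Type} (m : ℕ) (a : α) : (newTable m a).val = fun _ => a := rfl
@[simp] theorem newTable_steps {α : Type} (m : ℕ) (a : α) : (newTable m a).steps = m + 1 := rfl

@[simp] theorem append_val {α : Type} (l m : List α) : (append l m).val = l ++ m := by
  induction l with
  | nil => simp [append]
  | cons a l ih => simp [append, ih]

@[simp] theorem append_steps {α : Type} (l m : List α) :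
    (append l m).steps = 2 * l.length + 1 := by
  induction l with
  | nil => simp [append]
  | cons a l ih => simp [append, ih]; ring

@[simp] theorem length_val {α : Type} (l : List α) : (length l).val = l.length := by
  induction l with
  | nil => simp [length]
  | cons a l ih => simp [length, ih]

@[simp] theorem length_steps {α : Type} (l : List α) :
    (length l).steps = 2 * l.length + 1 := by
  induction l with
  | nil => simp [length]
  | cons a l ih => simp [length, ih]; ring

theorem split_val {α : Type} (m : ℕ) (l : List α) :
    (split m l).val = (l.take m, l.drop m) := by
  induction m generalizing l with
  | zero => simp [split]
  | succ m ih =>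
    cases l with
    | nil => simp [split]
    | cons a l => simp [split, ih]

theorem split_steps_le {α : Type} (m : ℕ) (l : List α) : (split m l).steps ≤ 2 * m + 1 := by
  induction m generalizing l with
  | zero => simp [split]
  | succ m ih =>
    cases l with
    | nil => simp [split]
    | cons a l =>
      have := ih l
      simp [split]
      omega

/-! ### Merge sort -/

theorem merge_val_perm {α : Type} (le : α → α → Timed Bool) (l m : List α) :
    (merge le l m).val.Perm (l ++ m) := by
  induction l, m using merge.induct with
  | case1 m => simp [merge]
  | case2 a l => simp [merge]
  | case3 a l b m ih₁ ih₂ =>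
    rw [merge]
    by_cases h : (le a b).val
    · simpa [h] using ih₁
    · simp only [bind_val, h, Bool.false_eq_true, if_false, op_val]
      exact (ih₂.cons b).trans List.perm_middle.symm

theorem merge_val_pairwise {α : Type} (le : α → α → Timed Bool) (r : α → α → Prop)
    (hle : ∀ a b, (le a b).val = true ↔ r a b) (htot : ∀ a b, r a b ∨ r b a)
    (htrans : ∀ a b c, r a b → r b c → r a c) (l m : List α) (hl : l.Pairwise r)
    (hm : m.Pairwise r) : (merge le l m).val.Pairwise r := by
  induction l, m using merge.induct with
  | case1 m => simpa [merge] using hm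
  | case2 a l => simpa [merge] using hl
  | case3 a l b m ih₁ ih₂ =>
    rw [merge]
    rw [List.pairwise_cons] at hl hm
    by_cases h : (le a b).val
    · simp only [bind_val, h, if_true, op_val, List.pairwise_cons]
      refine ⟨fun x hx => ?_, ih₁ hl.2 (List.pairwise_cons.2 hm)⟩
      have hx' := (merge_val_perm le _ _).mem_iff.1 hx
      have hab := (hle a b).1 h
      rcases List.mem_append.1 hx' with hx' | hx'
      · exact hl.1 x hx'
      · rcases List.mem_cons.1 hx' with rfl | hx'
        · exact hab
        · exact htrans _ _ _ hab (hm.1 x hx')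
    · simp only [bind_val, h, Bool.false_eq_true, if_false, op_val, List.pairwise_cons]
      refine ⟨fun x hx => ?_, ih₂ (List.pairwise_cons.2 hl) hm.2⟩
      have hx' := (merge_val_perm le _ _).mem_iff.1 hx
      have hba := (htot a b).resolve_left fun h' => h ((hle a b).2 h')
      rcases List.mem_append.1 hx' with hx' | hx'
      · rcases List.mem_cons.1 hx' with rfl | hx'
        · exact hba
        · exact htrans _ _ _ hba (hl.1 x hx')
      · exact hm.1 x hx'

theorem merge_steps_le {α : Type} (le : α → α → Timed Bool) (c : ℕ)
    (hc : ∀ a b, (le a b).steps ≤ c) (l m : List α) :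
    (merge le l m).steps ≤ (c + 2) * (l.length + m.length) + 1 := by
  induction l, m using merge.induct with
  | case1 m => simp [merge]
  | case2 a l => simp [merge]
  | case3 a l b m ih₁ ih₂ =>
    rw [merge]
    have := hc a b
    simp only [List.length_cons] at *
    by_cases h : (le a b).val
    · simp only [bind_steps, tick_steps, h, if_true, op_steps]
      nlinarith
    · simp only [bind_steps, tick_steps, h, Bool.false_eq_true, if_false, op_steps]
      nlinarith

theorem mergeSort_val_perm {α : Type} (le : α → α → Timed Bool) (m : ℕ) (l : List α) :
    (mergeSort le m l).val.Perm l := by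
  induction m using Nat.strong_induction_on generalizing l with
  | _ m ih =>
    rw [mergeSort]
    split_ifs with h
    · simp
    · simp only [bind_val, op_val, split_val]
      refine (merge_val_perm le _ _).trans ?_
      refine ((ih _ (by omega) _).append (ih _ (by omega) _)).trans ?_
      rw [List.take_append_drop]

theorem mergeSort_val_pairwise {α : Type} (le : α → α → Timed Bool) (r : α → α → Prop)
    (hle : ∀ a b, (le a b).val = true ↔ r a b) (htot : ∀ a b, r a b ∨ r b a)
    (htrans : ∀ a b c, r a b → r b c → r a c) (m : ℕ) (l : List α) (hl : l.length = m) :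
    (mergeSort le m l).val.Pairwise r := by
  induction m using Nat.strong_induction_on generalizing l with
  | _ m ih =>
    rw [mergeSort]
    split_ifs with h
    · have : l.length ≤ 1 := hl ▸ h
      match l, this with
      | [], _ => simp
      | [a], _ => simp
    · simp only [bind_val, op_val, split_val]
      exact merge_val_pairwise le r hle htot htrans _ _
        (ih _ (by omega) _ (by simp; omega)) (ih _ (by omega) _ (by simp; omega))

/-- The larger half has size ⌈m/2⌉, and the ceiling logarithm drops by exactly one under this
halving, so each level contributes a term linear in m. -/
theorem mergeSort_steps_le {α : Type} (le : α → α → Timed Bool) (c : ℕ)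
    (hc : ∀ a b, (le a b).steps ≤ c) (m : ℕ) (l : List α) (hl : l.length = m) :
    (mergeSort le m l).steps ≤ (c + 8) * (m * Nat.clog 2 m) + 1 := by
  induction m using Nat.strong_induction_on generalizing l with
  | _ m ih =>
    rw [mergeSort]
    split_ifs with h
    · simp
    · have hm : 2 ≤ m := by omega
      simp only [bind_steps, tick_steps, op_steps, op_val, split_val]
      have e1 := split_steps_le (m / 2) l
      have e2 := ih (m / 2) (by omega) (l.take (m / 2)) (by simp; omega)
      have e3 := ih (m - m / 2) (by omega) (l.drop (m / 2)) (by simp; omega)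
      have e4 := merge_steps_le le c hc (mergeSort le (m / 2) (l.take (m / 2))).val
        (mergeSort le (m - m / 2) (l.drop (m / 2))).val
      rw [(mergeSort_val_perm le _ _).length_eq, (mergeSort_val_perm le _ _).length_eq,
        List.length_take, List.length_drop, hl, min_eq_left (by omega : m / 2 ≤ m),
        Nat.add_sub_cancel' (by omega : m / 2 ≤ m)] at e4
      have hk : Nat.clog 2 m = Nat.clog 2 ((m + 2 - 1) / 2) + 1 :=
        Nat.clog_of_two_le (by norm_num) hm
      have e5 : Nat.clog 2 (m / 2) ≤ Nat.clog 2 ((m + 2 - 1) / 2) :=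
        Nat.clog_mono_right _ (by omega)
      have e6 : m - m / 2 = (m + 2 - 1) / 2 := by omega
      rw [e6] at e3 e4 ⊢
      rw [hk]
      set q := Nat.clog 2 ((m + 2 - 1) / 2)
      have e7 : (m / 2) * Nat.clog 2 (m / 2) ≤ (m / 2) * q := Nat.mul_le_mul_left _ e5
      have e8 : (m / 2) * q + ((m + 2 - 1) / 2) * q = m * q := by
        rw [← add_mul]
        congr 1
        omega
      have e9 : (c + 8) * ((m / 2) * Nat.clog 2 (m / 2)) ≤ (c + 8) * ((m / 2) * q) :=
        Nat.mul_le_mul_left _ e7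
      have e10 : (c + 8) * (m * (q + 1)) = (c + 8) * ((m / 2) * q)
          + (c + 8) * (((m + 2 - 1) / 2) * q) + (c + 8) * m := by
        rw [← mul_add, e8]
        ring
      -- The part (c + 2) m pays for merging; 6 m covers the splitting and the constant overhead
      -- because m ≥ 2.
      have e11 : (c + 8) * m = (c + 2) * m + 6 * m := by ring
      omega

/-! ### Permutations -/

theorem mapCons_val {α : Type} (y : α) (ls : List (List α)) :
    (mapCons y ls).val = ls.map (y :: ·) := by
  induction ls with
  | nil => simp [mapCons]
  | cons l ls ih => simp [mapCons, ih]

theorem mapCons_steps {α : Type} (y : α) (ls : List (List α)) :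
    (mapCons y ls).steps = 3 * ls.length + 1 := by
  induction ls with
  | nil => simp [mapCons]
  | cons l ls ih => simp [mapCons, ih]; ring

theorem mem_insertions_val {α : Type} (x : α) (l m : List α) :
    m ∈ (insertions x l).val ↔ ∃ l₁ l₂, l = l₁ ++ l₂ ∧ m = l₁ ++ x :: l₂ := by
  induction l generalizing m with
  | nil => simp [insertions]
  | cons y l ih =>
    simp only [insertions, bind_val, op_val, mapCons_val, List.mem_cons, List.mem_map, ih]
    constructor
    · rintro (rfl | ⟨m', ⟨l₁, l₂, rfl, rfl⟩, rfl⟩)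
      · exact ⟨[], y :: l, rfl, rfl⟩
      · exact ⟨y :: l₁, l₂, rfl, rfl⟩
    · rintro ⟨l₁, l₂, h1, rfl⟩
      cases l₁ with
      | nil => exact Or.inl (by simp at h1; simp [h1])
      | cons z l₁ =>
        simp only [List.cons_append, List.cons.injEq] at h1
        exact Or.inr ⟨_, ⟨l₁, l₂, h1.2, rfl⟩, by simp [h1.1]⟩

theorem length_insertions_val {α : Type} (x : α) (l : List α) :
    (insertions x l).val.length = l.length + 1 := by
  induction l with
  | nil => simp [insertions]
  | cons y l ih => simp [insertions, mapCons_val, ih]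

theorem insertions_steps_le {α : Type} (x : α) (l : List α) :
    (insertions x l).steps ≤ 4 * (l.length + 1) ^ 2 := by
  induction l with
  | nil => simp [insertions]
  | cons y l ih =>
    simp only [insertions, bind_steps, tick_steps, op_steps, mapCons_steps, op_val,
      length_insertions_val, List.length_cons]
    nlinarith

theorem mem_insertionsAll_val {α : Type} (x : α) (ls : List (List α)) (m : List α) :
    m ∈ (insertionsAll x ls).val ↔ ∃ l ∈ ls, m ∈ (insertions x l).val := by
  induction ls with
  | nil => simp [insertionsAll]
  | cons l ls ih => simp [insertionsAll, ih]

theorem length_insertionsAll_val {α : Type} (x : α) (k : ℕ) (ls : List (List α))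
    (h : ∀ l ∈ ls, l.length = k) : (insertionsAll x ls).val.length = ls.length * (k + 1) := by
  induction ls with
  | nil => simp [insertionsAll]
  | cons l ls ih =>
    rw [List.forall_mem_cons] at h
    simp only [insertionsAll, bind_val, append_val, List.length_append, length_insertions_val,
      ih h.2, h.1, List.length_cons]
    ring

theorem insertionsAll_steps_le {α : Type} (x : α) (k : ℕ) (ls : List (List α))
    (h : ∀ l ∈ ls, l.length = k) :
    (insertionsAll x ls).steps ≤ ls.length * (8 * (k + 1) ^ 2) + 1 := by
  induction ls with
  | nil => simp [insertionsAll]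
  | cons l ls ih =>
    rw [List.forall_mem_cons] at h
    have e1 := ih h.2
    have e2 := insertions_steps_le x l
    rw [h.1] at e2
    simp only [insertionsAll, bind_steps, tick_steps, append_steps, length_insertions_val,
      h.1, List.length_cons]
    nlinarith

theorem mem_permutations_val {α : Type} (l m : List α) :
    m ∈ (permutations l).val ↔ m.Perm l := by
  induction l generalizing m with
  | nil => simp [permutations]
  | cons x l ih =>
    simp only [permutations, bind_val, mem_insertionsAll_val, ih, mem_insertions_val]
    constructor
    · rintro ⟨l', hl', l₁, l₂, rfl, rfl⟩
      exact List.perm_middle.trans (hl'.cons x)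
    · intro h
      obtain ⟨l₁, l₂, rfl⟩ := List.append_of_mem (h.mem_iff.2 List.mem_cons_self)
      exact ⟨l₁ ++ l₂, (List.perm_middle.symm.trans h).cons_inv, l₁, l₂, rfl, rfl⟩

theorem length_permutations_val {α : Type} (l : List α) :
    (permutations l).val.length = l.length.factorial := by
  induction l with
  | nil => simp [permutations]
  | cons x l ih =>
    simp only [permutations, bind_val]
    rw [length_insertionsAll_val x l.length _ fun m hm =>
      ((mem_permutations_val l m).1 hm).length_eq, ih, List.length_cons, Nat.factorial_succ]
    ring

/-- Inserting into the k! permutations of the tail costs about 8 (k + 1)² k! = 8 (k + 1) (k + 1)!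
steps, and this last level dominates the recursion. -/
theorem permutations_steps_le {α : Type} (l : List α) :
    (permutations l).steps ≤ 10 * ((l.length + 1) * l.length.factorial) := by
  induction l with
  | nil => simp [permutations]
  | cons x l ih =>
    simp only [permutations, bind_steps, tick_steps]
    have e1 := insertionsAll_steps_le x l.length _ fun m hm =>
      ((mem_permutations_val l m).1 hm).length_eq
    rw [length_permutations_val] at e1
    rw [List.length_cons, Nat.factorial_succ]
    have := Nat.factorial_pos l.length
    set F := l.length.factorial
    nlinarith [mul_pos this (Nat.succ_pos l.length)]

end Timed

namespace GluedInstance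

variable {K n : ℕ}

/-! ## Correctness of the local search program -/

theorem ratioT_val (G : GluedInstance K n) (j : Fin n) : (G.ratioT j).val = G.ratio j := by
  unfold ratioT ratio
  by_cases h : G.w j = 0 <;> simp [h]

theorem ratioT_steps_le (G : GluedInstance K n) (j : Fin n) : (G.ratioT j).steps ≤ 4 := by
  unfold ratioT
  by_cases h : G.w j = 0 <;> simp [h]

theorem wsptLET_val (G : GluedInstance K n) (i k : Fin n) :
    (G.wsptLET i k).val = true ↔ G.wsptLE i k := by
  unfold wsptLET wsptLE
  simp only [bind_val, op_val, ratioT_val]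
  by_cases h1 : G.ratio i < G.ratio k
  · simp [h1]
  · by_cases h2 : G.ratio i = G.ratio k <;> simp [h1, h2]

theorem wsptLET_steps_le (G : GluedInstance K n) (i k : Fin n) : (G.wsptLET i k).steps ≤ 11 := by
  unfold wsptLET
  have h1 := G.ratioT_steps_le i
  have h2 := G.ratioT_steps_le k
  by_cases h3 : (G.ratioT i).val < (G.ratioT k).val
  · simp [h3]
    omega
  · by_cases h4 : (G.ratioT i).val = (G.ratioT k).val
    · simp [h4]
      omega
    · simp [h3, h4]
      omega

/-- Weighted SPT order is total and antisymmetric, so the sorted list is unique and the two sorting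
methods agree. -/
theorem mergeSort_wsptLET_val (G : GluedInstance K n) :
    (mergeSort G.wsptLET n (List.finRange n)).val = G.wsptJobs :=
  ((mergeSort_val_perm _ _ _).trans G.wsptJobs_perm.symm).eq_of_pairwise
    (fun _ _ _ _ => G.wsptLE_antisymm)
    (mergeSort_val_pairwise _ _ G.wsptLET_val G.wsptLE_total (fun _ _ _ => G.wsptLE_trans) _ _
      (List.length_finRange))
    G.pairwise_wsptJobs

/-- The list `f (m - 1), …, f 0`. -/
def downTo {α : Type} (f : Fin K → α) : (m : ℕ) → m ≤ K → List α
  | 0, _ => []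
  | m + 1, h => f ⟨m, h⟩ :: downTo f m (Nat.le_of_succ_le h)

theorem downTo_succ {α : Type} (f : Fin K → α) (m : ℕ) (h : m + 1 ≤ K) :
    downTo f (m + 1) h = f ⟨m, h⟩ :: downTo f m (Nat.le_of_succ_le h) := rfl

theorem downTo_eq {α : Type} (f : Fin K → α) (m : ℕ) (h : m ≤ K) :
    downTo f m h = (List.ofFn fun i : Fin m => f (Fin.castLE h i)).reverse := by
  induction m with
  | zero => simp [downTo]
  | succ m ih =>
    rw [downTo, ih, List.ofFn_succ', List.concat_eq_append, List.reverse_append]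
    rfl

theorem downTo_self {α : Type} (f : Fin K → α) :
    downTo f K le_rfl = ((List.finRange K).map f).reverse := by
  rw [downTo_eq, List.ofFn_eq_map]
  rfl

theorem openBlocks_val (G : GluedInstance K n) (τ : List (Fin K)) (acc : List (Block K n)) :
    (G.openBlocks τ acc).val = (τ.map fun f => ⟨f, [], G.setup f, 0⟩).reverse ++ acc := by
  induction τ generalizing acc with
  | nil => simp [openBlocks]
  | cons f τ ih => simp [openBlocks, ih]

theorem emitJobs_val (l : List (Fin n)) (acc : List (Fin K ⊕ Fin n)) :
    (emitJobs l acc).val = l.reverse.map Sum.inr ++ acc := by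
  induction l generalizing acc with
  | nil => simp [emitJobs]
  | cons f τ ih => simp [emitJobs, ih]

theorem emitBlocks_val (R : List (Block K n)) (acc : List (Fin K ⊕ Fin n)) :
    (emitBlocks R acc).val
      = (R.reverse.flatMap fun B => Sum.inl B.fam :: B.jobs.reverse.map Sum.inr) ++ acc := by
  induction R generalizing acc with
  | nil => simp [emitBlocks]
  | cons f τ ih => simp [emitBlocks, ih, emitJobs_val]

/-- The program keeps the blocks last to first, so block b out of m is at distance m - 1 - b from
the head. -/
theorem insertJob_val (G : GluedInstance K n) (j : Fin n) (f : Fin K → Block K n) (m : ℕ)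
    (h : m ≤ K) (b : ℕ) (hb : b < m) :
    (G.insertJob j (m - 1 - b) (downTo f m h)).val
      = downTo (fun c => if (c : ℕ) = b then
          ⟨(f c).fam, j :: (f c).jobs, (f c).time + G.p j, (f c).weight + G.w j⟩ else f c) m h := by
  have hsame : ∀ (f g : Fin K → Block K n) (m : ℕ) (h : m ≤ K),
      (∀ c : Fin K, (c : ℕ) < m → f c = g c) → downTo f m h = downTo g m h := by
    intro f g m h hfg
    rw [downTo_eq, downTo_eq]
    congr 2
    funext i
    exact hfg _ i.2
  induction m with
  | zero => omega
  | succ m ih =>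
    rcases Nat.lt_succ_iff_lt_or_eq.1 hb with hb' | rfl
    · obtain ⟨q, hq⟩ : ∃ q, m + 1 - 1 - b = q + 1 := ⟨m - 1 - b, by omega⟩
      have hq' : q = m - 1 - b := by omega
      rw [hq, downTo_succ, downTo_succ, insertJob]
      simp only [bind_val, op_val, hq', ih _ hb']
      rw [if_neg (show ¬ m = b by omega)]
    · have : b + 1 - 1 - b = 0 := by omega
      rw [this, downTo_succ, downTo_succ, insertJob]
      simp only [bind_val, op_val, if_true]
      congr 1
      refine hsame _ _ _ _ fun c hc => ?_
      rw [if_neg (by omega)]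

/-- The block that the program stores in position `b` once the jobs in `l` have been moved. -/
noncomputable def storedBlock (G : GluedInstance K n) (τ : Equiv.Perm (Fin K)) (β : Fin n → ℕ)
    (l : List (Fin n)) (b : Fin K) : Block K n where
  fam := τ b
  jobs := (l.filter fun j => β j = (b : ℕ)).reverse
  time := G.setup (τ b) + ((l.filter fun j => β j = (b : ℕ)).map G.p).sum
  weight := ((l.filter fun j => β j = (b : ℕ)).map G.w).sum

/-- A job not yet moved occurs in no stored block, so only the block that receives it changes, by
the very update that the program performs. -/
theorem storedBlock_append (G : GluedInstance K n) (τ : Equiv.Perm (Fin K)) (β : Fin n → ℕ)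
    {l : List (Fin n)} {j : Fin n} (hj : j ∉ l) (b : ℕ) (c : Fin K) :
    G.storedBlock τ (Function.update β j b) (l ++ [j]) c
      = if (c : ℕ) = b then
          ⟨(G.storedBlock τ β l c).fam, j :: (G.storedBlock τ β l c).jobs,
            (G.storedBlock τ β l c).time + G.p j, (G.storedBlock τ β l c).weight + G.w j⟩
        else G.storedBlock τ β l c := by
  have hf : (l.filter fun i => Function.update β j b i = (c : ℕ))
      = l.filter fun i => β i = (c : ℕ) := by
    refine List.filter_congr fun i hi => ?_
    have : i ≠ j := fun h => hj (h ▸ hi)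
    simp [this]
  unfold storedBlock
  by_cases h : (c : ℕ) = b
  · subst h
    simp [List.filter_append, hf, add_assoc]
  · simp [List.filter_append, hf, h, Ne.symm h]

/-! ### Time and weight accumulated by the scan -/

theorem sum_filter_eq (G : GluedInstance K n) {pre suf : List (Fin n)} {j : Fin n}
    (hl : G.wsptJobs = pre ++ j :: suf) (β : Fin n → ℕ) (c : ℕ) (g : Fin n → ℝ) :
    ((pre.filter fun i => β i = c).map g).sum
      = ∑ i, if G.rank i < G.rank j ∧ β i = c then g i else 0 := by
  have hn : pre.Nodup := by
    have := G.nodup_wsptJobs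
    rw [hl] at this
    exact (List.nodup_append.1 this).1
  rw [← List.sum_toFinset g (hn.filter _), ← Finset.sum_filter]
  refine Finset.sum_congr ?_ fun _ _ => rfl
  ext i
  simp [rank_lt_iff hl]

/-- Total length of the setups and moved jobs from block `m` on. -/
noncomputable def tailTime (G : GluedInstance K n) (τ : Equiv.Perm (Fin K)) (β : Fin n → ℕ)
    (j : Fin n) (m : ℕ) : ℝ :=
  (∑ f, if m ≤ (τ.symm f : ℕ) then G.setup f else 0)
    + ∑ i, if G.rank i < G.rank j ∧ m ≤ β i then G.p i else 0

/-- When the scan is about to inspect block m - 1, `tailTime` and `tailWeight` at m are its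
accumulated values P and W. -/
noncomputable def tailWeight (G : GluedInstance K n) (β : Fin n → ℕ) (j : Fin n) (m : ℕ) : ℝ :=
  ∑ i, if G.rank i < G.rank j ∧ m ≤ β i then G.w i else 0

theorem sum_tail_succ {ι : Type*} [Fintype ι] (S : ι → Prop) [DecidablePred S] (β : ι → ℕ)
    (m : ℕ) (g : ι → ℝ) : (∑ i, if S i ∧ m ≤ β i then g i else 0)
      = (∑ i, if S i ∧ m + 1 ≤ β i then g i else 0) + ∑ i, if S i ∧ β i = m then g i else 0 := by
  rw [← Finset.sum_add_distrib]
  refine Finset.sum_congr rfl fun i _ => ?_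
  by_cases hS : S i
  · rcases lt_trichotomy (β i) m with h | h | h
    · simp [hS, h.not_ge, h.ne, h.not_gt]
    · simp [hS, h]
    · simp [hS, h.le, h.ne', (by omega : m + 1 ≤ β i)]
  · simp [hS]

theorem tailTime_succ (G : GluedInstance K n) (τ : Equiv.Perm (Fin K)) (β : Fin n → ℕ)
    {pre suf : List (Fin n)} {j : Fin n} (hl : G.wsptJobs = pre ++ j :: suf) (m : Fin K) :
    G.tailTime τ β j m = G.tailTime τ β j (m + 1) + (G.storedBlock τ β pre m).time := by
  unfold tailTime storedBlock
  have h1 := sum_tail_succ (fun _ => True) (fun f => (τ.symm f : ℕ)) m G.setup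
  have h2 : (∑ f, if (τ.symm f : ℕ) = m then G.setup f else 0) = G.setup (τ m) := by
    rw [Finset.sum_eq_single (τ m)]
    · simp
    · intro f _ hf
      rw [if_neg]
      intro h
      exact hf (by rw [← Fin.ext h, Equiv.apply_symm_apply])
    · simp
  simp only [true_and] at h1
  rw [h1, h2, sum_tail_succ (fun i => G.rank i < G.rank j) β m G.p, G.sum_filter_eq hl]
  ring

theorem tailWeight_succ (G : GluedInstance K n) (τ : Equiv.Perm (Fin K)) (β : Fin n → ℕ)
    {pre suf : List (Fin n)} {j : Fin n} (hl : G.wsptJobs = pre ++ j :: suf) (m : Fin K) :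
    G.tailWeight β j m = G.tailWeight β j (m + 1) + (G.storedBlock τ β pre m).weight := by
  unfold tailWeight
  rw [sum_tail_succ (fun i => G.rank i < G.rank j) β m G.w]
  exact congrArg _ (G.sum_filter_eq hl β m G.w).symm

/-- The quantity computed by the scan at block c is the change of cost when j goes from the last
block to c, because P and W collect what lies strictly behind block c. -/
theorem tail_sub_eq (G : GluedInstance K n) (τ : Equiv.Perm (Fin K)) {β : Fin n → ℕ}
    (hβ : ∀ k, β k < K) (j : Fin n) {c : ℕ} (hc : c < K) :
    G.p j * G.tailWeight β j (c + 1) - G.w j * G.tailTime τ β j (c + 1)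
      = G.relCost τ β (fun i => G.rank i < G.rank j) j c
        - G.relCost τ β (fun i => G.rank i < G.rank j) j (K - 1) := by
  have h := G.relCost_sub τ β (fun i => G.rank i < G.rank j) j (by omega : c ≤ K - 1)
  have h1 : G.setupTime τ (K - 1) - G.setupTime τ c
      = ∑ f, if c + 1 ≤ (τ.symm f : ℕ) then G.setup f else 0 := by
    unfold setupTime
    rw [← Finset.sum_sub_distrib]
    refine Finset.sum_congr rfl fun f _ => ?_
    have := (τ.symm f).2
    rw [if_pos (by omega)]
    by_cases hf : (τ.symm f : ℕ) ≤ c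
    · rw [if_pos hf, if_neg (by omega), sub_self]
    · rw [if_neg hf, if_pos (by omega), sub_zero]
  have h2 : ∀ g : Fin n → ℝ, (∑ i, if G.rank i < G.rank j ∧ c < β i ∧ β i ≤ K - 1 then g i else 0)
      = ∑ i, if G.rank i < G.rank j ∧ c + 1 ≤ β i then g i else 0 := by
    intro g
    refine Finset.sum_congr rfl fun i _ => ?_
    have := hβ i
    congr 1
    rw [eq_iff_iff]
    omega
  rw [h1, h2, h2] at h
  unfold tailWeight tailTime
  linarith

theorem tailTime_last (G : GluedInstance K n) (τ : Equiv.Perm (Fin K)) {β : Fin n → ℕ}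
    (hβ : ∀ k, β k < K) (j : Fin n) : G.tailTime τ β j K = 0 := by
  unfold tailTime
  rw [Finset.sum_eq_zero, Finset.sum_eq_zero, add_zero]
  · intro i _
    have := hβ i
    rw [if_neg (by omega)]
  · intro f _
    have := (τ.symm f).2
    rw [if_neg (by omega)]

theorem tailWeight_last (G : GluedInstance K n) {β : Fin n → ℕ}
    (hβ : ∀ k, β k < K) (j : Fin n) : G.tailWeight β j K = 0 := by
  unfold tailWeight
  refine Finset.sum_eq_zero fun i _ => ?_
  have := hβ i
  rw [if_neg (by omega)]

/-- `b` is the leftmost best block among the blocks from `m` on. -/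
def BestFrom (K : ℕ) (D : ℕ → ℝ) (m b : ℕ) : Prop :=
  b < K ∧ (∀ c, m ≤ c → c < K → D b ≤ D c) ∧
    (b = K - 1 ∨ D b < 0 ∧ ∀ c, m ≤ c → c < b → D b < D c) ∧ D b ≤ 0 ∧ (b = K - 1 ∨ m ≤ b)

/-- Accepting ties makes the leftmost of equally good blocks win, while the condition D m < 0 keeps
the last block when nothing strictly improves on it. The invariant D b ≤ 0 is what makes a
nonnegative D m no better than D b. -/
theorem BestFrom.step {D : ℕ → ℝ} {m b : ℕ} (h : BestFrom K D (m + 1) b) (hm : m < K) :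
    BestFrom K D m (if D m < 0 ∧ D m ≤ D b then m else b) := by
  obtain ⟨h1, h2, h3, h4, h5⟩ := h
  split_ifs with hc
  · refine ⟨hm, fun c hc1 hc2 => ?_, Or.inr ⟨hc.1, fun c _ _ => by omega⟩, hc.1.le,
      Or.inr le_rfl⟩
    rcases hc1.eq_or_lt with rfl | hc1
    · exact le_rfl
    · exact hc.2.trans (h2 c hc1 hc2)
  · have hlt : D b < 0 → D b < D m := fun hb => by
      by_contra hh
      exact hc ⟨(not_lt.1 hh).trans_lt hb, not_lt.1 hh⟩
    have hle : D b ≤ D m := by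
      rcases h4.lt_or_eq with hb | hb
      · exact (hlt hb).le
      · rw [hb]
        by_contra hh
        exact hc ⟨not_le.1 hh, by rw [hb]; exact (not_le.1 hh).le⟩
    refine ⟨h1, fun c hc1 hc2 => ?_, ?_, h4, h5.imp id (by omega)⟩
    · rcases hc1.eq_or_lt with rfl | hc1
      · exact hle
      · exact h2 c hc1 hc2
    · rcases h3 with h3 | ⟨h3, h3'⟩
      · exact Or.inl h3
      · refine Or.inr ⟨h3, fun c hc1 hc2 => ?_⟩
        rcases hc1.eq_or_lt with rfl | hc1
        · exact hlt h3
        · exact h3' c hc1 hc2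

theorem scan_cons_val (G : GluedInstance K n) (j : Fin n) (B : Block K n) (R : List (Block K n))
    (P W delta : ℝ) (pos best : ℕ) :
    (G.scan j (B :: R) P W delta pos best).val =
      if G.need j B.fam = true then
        (if G.p j * W - G.w j * P < 0 ∧ G.p j * W - G.w j * P ≤ delta then pos else best)
      else (G.scan j R (P + B.time) (W + B.weight)
        (if G.p j * W - G.w j * P < 0 ∧ G.p j * W - G.w j * P ≤ delta then
          G.p j * W - G.w j * P else delta) (pos + 1)
        (if G.p j * W - G.w j * P < 0 ∧ G.p j * W - G.w j * P ≤ delta then pos else best)).val := by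
  rw [scan]
  simp only [bind_val, op_val]
  generalize G.p j * W - G.w j * P = d
  by_cases h : G.need j B.fam = true <;> by_cases h1 : d < 0 <;> by_cases h2 : d ≤ delta <;>
    simp [h, h1, h2]

/-- Loop invariant: with the blocks from m on already inspected, the remembered position encodes the
leftmost best of them and the remembered change is its D. The scan stops at the first block opened
by a needed setup, before which no block is admissible. -/
theorem scan_val (G : GluedInstance K n) (τ : Equiv.Perm (Fin K)) {β : Fin n → ℕ}
    (hβ : ∀ k, β k < K) {pre suf : List (Fin n)} {j : Fin n} (hl : G.wsptJobs = pre ++ j :: suf)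
    (D : ℕ → ℝ) (hD : ∀ c, D c = G.relCost τ β (fun i => G.rank i < G.rank j) j c
        - G.relCost τ β (fun i => G.rank i < G.rank j) j (K - 1))
    (m : ℕ) : ∀ (h : m ≤ K) (b : ℕ), BestFrom K D m b →
      (∀ c : Fin K, m ≤ c → G.need j (τ c) = false) →
      ∃ b', G.IsBestBlock τ β j b' ∧
        (G.scan j (downTo (G.storedBlock τ β pre) m h) (G.tailTime τ β j m) (G.tailWeight β j m)
          (D b) (K - m) (K - 1 - b)).val = K - 1 - b' := by
  have hK : D (K - 1) = 0 := by rw [hD, sub_self]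
  -- At the stopping point the admissible blocks are exactly those from m on, so best among the
  -- inspected blocks means best.
  have hbest : ∀ (m : ℕ), m < K → ∀ b, BestFrom K D m b →
      (∀ c : Fin K, m + 1 ≤ c → G.need j (τ c) = false) →
      (∀ c, G.IsMove τ j c → m ≤ c) → G.IsBestBlock τ β j b := by
    intro m hm b hb hneed hmove
    have hmv : ∀ c, m ≤ c → c < K → G.IsMove τ j c := by
      intro c hc hcK
      refine ⟨hcK, fun f hf => ?_⟩
      by_contra hh
      have := hneed (τ.symm f) (by omega)
      simp [hf] at this
    obtain ⟨h1, h2, h3, h4, h5⟩ := hb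
    simp only [hD, sub_le_sub_iff_right, sub_neg, sub_lt_sub_iff_right] at h2 h3
    refine ⟨hmv b (by omega) h1, fun c hc => h2 c (hmove c hc) hc.1, ?_⟩
    exact h3.imp id fun h3 => ⟨h3.1, fun c hc hcb => h3.2 c (hmove c hc) hcb⟩
  induction m with
  | zero =>
    intro h b hb hneed
    have hK0 := hb.1
    refine ⟨b, hbest 0 (by omega) b hb (fun c _ => hneed c (Nat.zero_le _))
      (fun c _ => Nat.zero_le c), ?_⟩
    simp [downTo, scan]
  | succ m ih =>
    intro h b hb hneed
    have hm : m < K := h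
    have hd : G.p j * G.tailWeight β j (m + 1) - G.w j * G.tailTime τ β j (m + 1) = D m := by
      rw [G.tail_sub_eq τ hβ j hm, hD]
    have hstep := hb.step hm
    set b₁ := if D m < 0 ∧ D m ≤ D b then m else b with hb₁
    have e1 : (if D m < 0 ∧ D m ≤ D b then D m else D b) = D b₁ := by
      rw [hb₁, apply_ite D]
    have e2 : (if D m < 0 ∧ D m ≤ D b then K - (m + 1) else K - 1 - b)
        = K - 1 - b₁ := by
      rw [hb₁]
      by_cases hc : D m < 0 ∧ D m ≤ D b
      · rw [if_pos hc, if_pos hc]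
        omega
      · rw [if_neg hc, if_neg hc]
    rw [downTo_succ, scan_cons_val, hd, e1, e2]
    have hfam : (G.storedBlock τ β pre ⟨m, h⟩).fam = τ ⟨m, h⟩ := rfl
    by_cases hn : G.need j (τ ⟨m, h⟩) = true
    -- The setup opening block m is needed, so no admissible block lies before m.
    · refine ⟨b₁, hbest m hm b₁ hstep hneed (fun c hc => ?_), ?_⟩
      · simpa using hc.2 _ hn
      · rw [hfam, if_pos hn]
    · obtain ⟨b', hb', hval⟩ := ih hm.le b₁ hstep fun c hc => by
        rcases hc.eq_or_lt with hc | hc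
        · have : c = ⟨m, h⟩ := Fin.ext hc.symm
          simpa [this] using hn
        · exact hneed c hc
      refine ⟨b', hb', ?_⟩
      rw [hfam, if_neg hn]
      rw [← hval]
      have t1 := G.tailTime_succ τ β hl ⟨m, h⟩
      have t2 := G.tailWeight_succ τ β hl ⟨m, h⟩
      simp only at t1 t2
      rw [t1, t2, (by omega : K - m = K - (m + 1) + 1)]

theorem moveJobs_val {G : GluedInstance K n} (hG : G.Valid) (τ : Equiv.Perm (Fin K))
    (suf : List (Fin n)) : ∀ (pre : List (Fin n)) (β : Fin n → ℕ), G.wsptJobs = pre ++ suf →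
      G.SearchState τ suf β →
      (G.moveJobs suf (downTo (G.storedBlock τ β pre) K le_rfl)).val
        = downTo (G.storedBlock τ (suf.foldl (G.greedyStep τ) β) G.wsptJobs) K le_rfl := by
  induction suf with
  | nil =>
    intro pre β hl _
    simp [moveJobs, hl]
  | cons j suf ih =>
    intro pre β hl hβ
    have hβK := fun k => (hβ.isMove k).1
    have hK : K - 1 < K := (isMove_last hG τ j).1
    have hj : j ∉ pre := fun h => lt_irrefl _ ((rank_lt_iff hl j).2 h)
    -- Nothing is inspected yet at m = K: the incumbent is the last block, with change 0 and
    -- position 0 from the end, and P = W = 0.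
    obtain ⟨b, hb, hscan⟩ := G.scan_val τ hβK hl _ (fun _ => rfl) K le_rfl (K - 1)
      ⟨hK, fun c _ _ => by omega, Or.inl rfl, (sub_self _).le, Or.inl rfl⟩
      (fun c hc => by have := c.2; omega)
    rw [G.tailTime_last τ hβK, G.tailWeight_last hβK, sub_self, Nat.sub_self, Nat.sub_self] at hscan
    rw [moveJobs]
    simp only [bind_val, hscan, G.insertJob_val j _ K le_rfl b hb.1.1]
    rw [← funext fun c => G.storedBlock_append τ β hj b c, ih _ _ (by simp [hl])
      (hβ.update hl hb.1), List.foldl_cons,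
      greedyStep_eq hG hβK (hβ.last_of_rank_le hl) hb]

theorem localSearchT_val {G : GluedInstance K n} (hG : G.Valid) (τ : Equiv.Perm (Fin K)) :
    (G.localSearchT G.wsptJobs (List.ofFn τ)).val = G.blockSchedule τ (G.localSearch τ) := by
  have hopen : (G.openBlocks (List.ofFn τ) []).val
      = downTo (G.storedBlock τ (initialBlocks K n) []) K le_rfl := by
    rw [openBlocks_val, downTo_self, List.ofFn_eq_map, List.map_map, List.append_nil]
    congr 2
    funext b
    simp [storedBlock]
  unfold localSearchT
  simp only [bind_val, hopen]
  rw [moveJobs_val hG τ G.wsptJobs [] _ rfl (searchState_initial hG τ), emitBlocks_val,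
    downTo_self, List.reverse_reverse, List.append_nil, List.flatMap_map]
  unfold blockSchedule localSearch
  simp [storedBlock]

/-! ### Evaluating schedules and choosing the best setup order -/

theorem costT_val (G : GluedInstance K n) (σ : List (Fin K ⊕ Fin n)) (hn : σ.Nodup)
    (t c : ℝ) : (G.costT σ t c).val
      = c + ∑ j, if Sum.inr j ∈ σ then G.w j * (t + G.completion σ j) else 0 := by
  induction σ generalizing t c with
  | nil => simp [costT]
  | cons x σ ih =>
    obtain ⟨hx, hn'⟩ := List.nodup_cons.1 hn
    have hcomp : ∀ j, x ≠ Sum.inr j → G.completion (x :: σ) j = G.length x + G.completion σ j := by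
      intro j hj
      have : (x == Sum.inr j) = false := by simpa using hj
      simp [completion, List.idxOf_cons, this]
    rcases x with f | i
    · rw [costT]
      simp only [bind_val, op_val, ih hn']
      congr 1
      refine Finset.sum_congr rfl fun j _ => ?_
      rw [hcomp j (by simp)]
      simp [length, add_assoc]
    · have hi : G.completion (Sum.inr i :: σ) i = G.p i := by
        simp [completion, length]
      rw [costT]
      simp only [bind_val, op_val, ih hn']
      rw [add_assoc]
      congr 1
      have : G.w i * (t + G.p i) = ∑ j, if j = i then G.w j * (t + G.p j) else 0 := by simp
      rw [this, ← Finset.sum_add_distrib]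
      refine Finset.sum_congr rfl fun j _ => ?_
      by_cases hj : j = i
      · subst hj
        simp [hx, hi]
      · rw [hcomp j (by simpa using Ne.symm hj)]
        simp [hj, length, add_assoc]

theorem costT_val_eq_cost (G : GluedInstance K n) {σ : List (Fin K ⊕ Fin n)} (hn : σ.Nodup)
    (hc : ∀ x, x ∈ σ) : (G.costT σ 0 0).val = G.cost σ := by
  rw [G.costT_val σ hn]
  simp [hc, cost]

/-- The search invariant, for an arbitrary incumbent: the outcome is the incumbent or one of the
candidates, and it is no more expensive than any of them. -/
theorem searchOrders_val (G : GluedInstance K n) (order : List (Fin n)) (l : List (List (Fin K)))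
    (best : Option (ℝ × List (Fin K ⊕ Fin n))) :
    (∀ c σ, (G.searchOrders order l best).val = some (c, σ) →
      (best = some (c, σ) ∨ ∃ τ ∈ l, σ = (G.localSearchT order τ).val ∧ c = (G.costT σ 0 0).val) ∧
      (∀ c' σ', best = some (c', σ') → c ≤ c') ∧
      ∀ τ ∈ l, c ≤ (G.costT (G.localSearchT order τ).val 0 0).val) ∧
    ((G.searchOrders order l best).val = none → best = none ∧ l = []) := by
  induction l generalizing best with
  | nil =>
    constructor
    · intro c σ h
      have h' : best = some (c, σ) := h
      subst h'
      refine ⟨Or.inl rfl, ?_, by simp⟩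
      rintro c' σ' h
      simp only [Option.some.injEq, Prod.mk.injEq] at h
      exact h.1.le
    · intro h
      exact ⟨h, rfl⟩
  | cons τ l ih =>
    -- In every case the search continues with some incumbent b; this isolates what b must satisfy
    -- for the invariant to pass on.
    have key : ∀ b : ℝ × List (Fin K ⊕ Fin n),
        (G.searchOrders order (τ :: l) best).val = (G.searchOrders order l (some b)).val →
        (best = some b ∨ b.2 = (G.localSearchT order τ).val ∧ b.1 = (G.costT b.2 0 0).val) →
        (∀ c' σ', best = some (c', σ') → b.1 ≤ c') →
        b.1 ≤ (G.costT (G.localSearchT order τ).val 0 0).val →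
        (∀ c σ, (G.searchOrders order (τ :: l) best).val = some (c, σ) →
          (best = some (c, σ) ∨
            ∃ τ' ∈ τ :: l, σ = (G.localSearchT order τ').val ∧ c = (G.costT σ 0 0).val) ∧
          (∀ c' σ', best = some (c', σ') → c ≤ c') ∧
          ∀ τ' ∈ τ :: l, c ≤ (G.costT (G.localSearchT order τ').val 0 0).val) ∧
        ((G.searchOrders order (τ :: l) best).val = none → best = none ∧ τ :: l = []) := by
      intro b hb h1 h2 h3
      obtain ⟨ih1, ih2⟩ := ih (some b)
      rw [hb]
      refine ⟨fun c σ h => ?_, fun h => absurd (ih2 h).1 (by simp)⟩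
      obtain ⟨i1, i2, i3⟩ := ih1 c σ h
      have hcb : c ≤ b.1 := i2 b.1 b.2 rfl
      refine ⟨?_, fun c' σ' h' => hcb.trans (h2 c' σ' h'), ?_⟩
      · rcases i1 with i1 | ⟨τ', hτ', i1⟩
        · have i1' : b = (c, σ) := Option.some.inj i1
          rcases h1 with h1 | h1
          · exact Or.inl (by rw [h1, i1'])
          · rw [i1'] at h1
            exact Or.inr ⟨τ, List.mem_cons_self, h1⟩
        · exact Or.inr ⟨τ', List.mem_cons_of_mem _ hτ', i1⟩
      · intro τ' hτ'
        rcases List.mem_cons.1 hτ' with rfl | hτ'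
        · exact hcb.trans h3
        · exact i3 τ' hτ'
    rcases best with _ | ⟨c', σ'⟩
    · exact key ⟨_, _⟩ rfl (Or.inr ⟨rfl, rfl⟩) (by simp) le_rfl
    · by_cases h : (G.costT (G.localSearchT order τ).val 0 0).val < c'
      · refine key ⟨(G.costT (G.localSearchT order τ).val 0 0).val,
          (G.localSearchT order τ).val⟩ ?_ (Or.inr ⟨rfl, rfl⟩) ?_ le_rfl
        · simp [searchOrders, h]
        · rintro c₂ σ₂ h₂
          simp only [Option.some.injEq, Prod.mk.injEq] at h₂
          exact h₂.1 ▸ h.le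
      · refine key (c', σ') ?_ (Or.inl rfl) ?_ (not_lt.1 h)
        · simp [searchOrders, h]
        · rintro c₂ σ₂ h₂
          simp only [Option.some.injEq, Prod.mk.injEq] at h₂
          exact h₂.1.le

theorem exists_perm_of_perm_finRange {l : List (Fin K)} (h : l.Perm (List.finRange K)) :
    ∃ τ : Equiv.Perm (Fin K), l = List.ofFn τ := by
  have hlen : l.length = K := by simpa using h.length_eq
  have hn : l.Nodup := h.nodup_iff.2 (List.nodup_finRange K)
  let g : Fin K → Fin K := fun i => l[(i : ℕ)]'(by rw [hlen]; exact i.2)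
  have hg : Function.Injective g := fun i j hij => by
    have := (hn.getElem_inj_iff).1 hij
    exact Fin.ext this
  refine ⟨Equiv.ofBijective g (Finite.injective_iff_bijective.1 hg), ?_⟩
  refine List.ext_getElem (by simp [hlen]) fun i h1 h2 => ?_
  simp [g]

theorem solve_val {G : GluedInstance K n} (hG : G.Valid) :
    ∃ τ : Equiv.Perm (Fin K), G.solve.val = G.blockSchedule τ (G.localSearch τ) ∧
      ∀ τ' : Equiv.Perm (Fin K), G.cost (G.blockSchedule τ (G.localSearch τ))
        ≤ G.cost (G.blockSchedule τ' (G.localSearch τ')) := by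
  have hcost : ∀ τ : Equiv.Perm (Fin K),
      (G.costT (G.localSearchT G.wsptJobs (List.ofFn τ)).val 0 0).val
        = G.cost (G.blockSchedule τ (G.localSearch τ)) := by
    intro τ
    rw [localSearchT_val hG]
    exact G.costT_val_eq_cost (G.nodup_blockSchedule τ _)
      (G.mem_blockSchedule τ fun j => (localSearch_isMove hG τ j).1)
  obtain ⟨h1, h2⟩ := G.searchOrders_val G.wsptJobs (permutations (List.finRange K)).val none
  have hval : G.solve.val =
      ((G.searchOrders G.wsptJobs (permutations (List.finRange K)).val none).val.elim []
        fun b => b.2) := by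
    unfold solve
    simp only [bind_val, indices_val, mergeSort_wsptLET_val]
    rcases (G.searchOrders G.wsptJobs (permutations (List.finRange K)).val none).val with
      _ | ⟨c, σ⟩ <;> rfl
  rcases hbest : (G.searchOrders G.wsptJobs (permutations (List.finRange K)).val none).val with
    _ | ⟨c, σ⟩
  -- The search cannot come back empty, since the identity order is always enumerated, also for K =
  -- 0.
  · have := (h2 hbest).2
    have hmem : List.finRange K ∈ (permutations (List.finRange K)).val :=
      (mem_permutations_val _ _).2 (List.Perm.refl _)
    simp [this] at hmem
  · obtain ⟨i1, _, i3⟩ := h1 c σ hbest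
    rcases i1 with i1 | ⟨l, hl, rfl, hc⟩
    · simp at i1
    · obtain ⟨τ, rfl⟩ := exists_perm_of_perm_finRange ((mem_permutations_val _ _).1 hl)
      refine ⟨τ, by rw [hval, hbest]; exact localSearchT_val hG τ, fun τ' => ?_⟩
      rw [← hcost, ← hcost, ← hc]
      refine i3 _ ((mem_permutations_val _ _).2 ?_)
      refine (List.perm_ext_iff_of_nodup (List.nodup_ofFn.2 τ'.injective)
        (List.nodup_finRange K)).2 fun f => ?_
      simpa [List.mem_ofFn] using τ'.surjective f

theorem exists_setupOrder_eq {G : GluedInstance K n} {L : List (Fin K ⊕ Fin n)}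
    (hL : G.IsSchedule L) : ∃ τ : Equiv.Perm (Fin K), setupOrder L = List.ofFn τ := by
  refine exists_perm_of_perm_finRange ((List.perm_ext_iff_of_nodup ?_
    (List.nodup_finRange K)).2 fun f => ?_)
  · unfold setupOrder
    refine List.Nodup.filterMap ?_ hL.1
    rintro (f | i) (g | k) h <;> simp_all
  · simp only [setupOrder, List.mem_filterMap, List.mem_finRange, iff_true]
    exact ⟨Sum.inl f, hL.2.1 _, rfl⟩

theorem solve_isSchedule {G : GluedInstance K n} (hG : G.Valid) : G.IsSchedule G.solve.val := by
  obtain ⟨τ, h, _⟩ := solve_val hG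
  rw [h]
  exact isSchedule_blockSchedule fun j => localSearch_isMove hG τ j

theorem solve_optimal {G : GluedInstance K n} (hG : G.Valid) {L : List (Fin K ⊕ Fin n)}
    (hL : G.IsSchedule L) : G.cost G.solve.val ≤ G.cost L := by
  obtain ⟨τ, h, h'⟩ := solve_val hG
  obtain ⟨τ', hτ'⟩ := exists_setupOrder_eq hL
  rw [h]
  exact (h' τ').trans (localSearch_optimal hG τ' hL hτ')

end GluedInstance

namespace GluedInstance

variable {K n : ℕ}

/-! ## Running time of the local search algorithm -/

/-- The number of jobs stored in a list of blocks. -/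
def numJobs (R : List (Block K n)) : ℕ := (R.map fun B => B.jobs.length).sum

theorem openBlocks_steps (G : GluedInstance K n) (τ : List (Fin K)) (acc : List (Block K n)) :
    (G.openBlocks τ acc).steps = 4 * τ.length + 1 := by
  induction τ generalizing acc with
  | nil => simp [openBlocks]
  | cons f τ ih => simp [openBlocks, ih]; ring

theorem scan_steps_le (G : GluedInstance K n) (j : Fin n) (R : List (Block K n))
    (P W delta : ℝ) (pos best : ℕ) :
    (G.scan j R P W delta pos best).steps ≤ 15 * R.length + 1 := by
  induction R generalizing P W delta pos best with
  | nil => simp [scan]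
  | cons B R ih =>
    by_cases h : G.need j B.fam = true
    · simp [scan, h]
      omega
    · obtain ⟨P', W', d', p', b', e⟩ : ∃ P' W' d' p' b', (G.scan j (B :: R) P W delta pos best).steps
          = (G.scan j R P' W' d' p' b').steps + 15 := by
        simp only [scan, bind_steps, tick_steps, op_steps, op_val, h, Bool.false_eq_true, if_false]
        exact ⟨_, _, _, _, _, by ring⟩
      have := ih P' W' d' p' b'
      rw [e, List.length_cons]
      omega

theorem insertJob_steps_le (G : GluedInstance K n) (j : Fin n) (b : ℕ) (R : List (Block K n)) :
    (G.insertJob j b R).steps ≤ 2 * R.length + 8 := by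
  induction R generalizing b with
  | nil => cases b <;> simp [insertJob]
  | cons B R ih =>
    cases b with
    | zero => simp [insertJob]
    | succ b =>
      have := ih b
      simp [insertJob]
      omega

theorem length_insertJob_val (G : GluedInstance K n) (j : Fin n) (b : ℕ) (R : List (Block K n)) :
    (G.insertJob j b R).val.length = R.length := by
  induction R generalizing b with
  | nil => cases b <;> simp [insertJob]
  | cons B R ih => cases b <;> simp [insertJob, ih]

theorem numJobs_insertJob_val_le (G : GluedInstance K n) (j : Fin n) (b : ℕ)
    (R : List (Block K n)) : numJobs (G.insertJob j b R).val ≤ numJobs R + 1 := by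
  induction R generalizing b with
  | nil => cases b <;> simp [insertJob]
  | cons B R ih =>
    cases b with
    | zero =>
      simp [insertJob, numJobs]
      omega
    | succ b =>
      have := ih b
      simp only [numJobs, insertJob, bind_val, op_val, List.map_cons, List.sum_cons] at this ⊢
      omega

theorem length_moveJobs_val (G : GluedInstance K n) (l : List (Fin n)) (R : List (Block K n)) :
    (G.moveJobs l R).val.length = R.length := by
  induction l generalizing R with
  | nil => simp [moveJobs]
  | cons j l ih => simp [moveJobs, ih, length_insertJob_val]

theorem numJobs_moveJobs_val_le (G : GluedInstance K n) (l : List (Fin n))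
    (R : List (Block K n)) : numJobs (G.moveJobs l R).val ≤ numJobs R + l.length := by
  induction l generalizing R with
  | nil => simp [moveJobs]
  | cons j l ih =>
    simp only [moveJobs, bind_val, List.length_cons]
    refine (ih _).trans ?_
    have := G.numJobs_insertJob_val_le j (G.scan j R 0 0 0 0 0).val R
    omega

theorem moveJobs_steps_le (G : GluedInstance K n) (l : List (Fin n)) (R : List (Block K n)) :
    (G.moveJobs l R).steps ≤ l.length * (17 * R.length + 10) + 1 := by
  induction l generalizing R with
  | nil => simp [moveJobs]
  | cons j l ih =>
    simp only [moveJobs, bind_steps, tick_steps, List.length_cons]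
    have e1 := G.scan_steps_le j R 0 0 0 0 0
    have e2 := G.insertJob_steps_le j (G.scan j R 0 0 0 0 0).val R
    have e3 := ih (G.insertJob j (G.scan j R 0 0 0 0 0).val R).val
    rw [length_insertJob_val] at e3
    rw [add_mul]
    omega

theorem emitJobs_steps (l : List (Fin n)) (acc : List (Fin K ⊕ Fin n)) :
    (emitJobs l acc).steps = 2 * l.length + 1 := by
  induction l generalizing acc with
  | nil => simp [emitJobs]
  | cons j l ih => simp [emitJobs, ih]; ring

theorem emitBlocks_steps (R : List (Block K n)) (acc : List (Fin K ⊕ Fin n)) :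
    (emitBlocks R acc).steps = 3 * R.length + 2 * numJobs R + 1 := by
  induction R generalizing acc with
  | nil => simp [emitBlocks, numJobs]
  | cons B R ih =>
    simp only [emitBlocks, bind_steps, tick_steps, emitJobs_steps, op_steps, ih, numJobs,
      List.length_cons, List.map_cons, List.sum_cons]
    ring

theorem length_emitBlocks_val (R : List (Block K n)) (acc : List (Fin K ⊕ Fin n)) :
    (emitBlocks R acc).val.length = R.length + numJobs R + acc.length := by
  induction R generalizing acc with
  | nil => simp [emitBlocks, numJobs]
  | cons B R ih =>
    simp only [emitBlocks, bind_val, op_val, ih, emitJobs_val, numJobs, List.length_cons,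
      List.length_append, List.length_map, List.length_reverse, List.map_cons, List.sum_cons]
    ring

theorem costT_steps_le (G : GluedInstance K n) (σ : List (Fin K ⊕ Fin n)) (t c : ℝ) :
    (G.costT σ t c).steps ≤ 6 * σ.length + 1 := by
  induction σ generalizing t c with
  | nil => simp [costT]
  | cons x σ ih =>
    rcases x with f | j
    · have := ih (t + G.setup f) c
      simp [costT]
      omega
    · have := ih (t + G.p j) (c + G.w j * (t + G.p j))
      simp [costT]
      omega

theorem length_openBlocks_val (G : GluedInstance K n) (τ : List (Fin K)) :
    (G.openBlocks τ []).val.length = τ.length := by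
  simp [openBlocks_val]

theorem numJobs_openBlocks_val (G : GluedInstance K n) (τ : List (Fin K)) :
    numJobs (G.openBlocks τ []).val = 0 := by
  simp [openBlocks_val, numJobs, Function.comp_def]

theorem numJobs_moveJobs_openBlocks_le (G : GluedInstance K n) (order : List (Fin n))
    (τ : List (Fin K)) :
    numJobs (G.moveJobs order (G.openBlocks τ []).val).val ≤ order.length := by
  refine (G.numJobs_moveJobs_val_le _ _).trans ?_
  rw [numJobs_openBlocks_val, zero_add]

theorem localSearchT_steps_le (G : GluedInstance K n) (order : List (Fin n))
    (τ : List (Fin K)) : (G.localSearchT order τ).steps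
      ≤ order.length * (17 * τ.length + 12) + 7 * τ.length + 3 := by
  simp only [localSearchT, bind_steps, openBlocks_steps, emitBlocks_steps, length_moveJobs_val,
    length_openBlocks_val]
  have e1 := G.moveJobs_steps_le order (G.openBlocks τ []).val
  have e2 := G.numJobs_moveJobs_openBlocks_le order τ
  rw [length_openBlocks_val] at e1
  have e3 : order.length * (17 * τ.length + 12)
    = order.length * (17 * τ.length + 10) + 2 * order.length := by ring
  omega

theorem length_localSearchT_val_le (G : GluedInstance K n) (order : List (Fin n))
    (τ : List (Fin K)) : (G.localSearchT order τ).val.length ≤ τ.length + order.length := by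
  simp only [localSearchT, bind_val, length_emitBlocks_val, length_moveJobs_val,
    length_openBlocks_val, List.length_nil]
  have := G.numJobs_moveJobs_openBlocks_le order τ
  omega

theorem searchOrders_steps_le (G : GluedInstance K n) (order : List (Fin n)) (k : ℕ)
    (l : List (List (Fin K))) (hl : ∀ τ ∈ l, τ.length = k)
    (best : Option (ℝ × List (Fin K ⊕ Fin n))) :
    (G.searchOrders order l best).steps
      ≤ l.length * (order.length * (17 * k + 18) + 13 * k + 7) + 1 := by
  induction l generalizing best with
  | nil => simp [searchOrders]
  | cons τ l ih =>
    rw [List.forall_mem_cons] at hl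
    have e1 := G.localSearchT_steps_le order τ
    have e2 := G.costT_steps_le (G.localSearchT order τ).val 0 0
    have e3 := G.length_localSearchT_val_le order τ
    rw [hl.1] at e1 e3
    have e4 : order.length * (17 * k + 18) = order.length * (17 * k + 12) + 6 * order.length := by
      ring
    rw [List.length_cons, Nat.add_mul, one_mul]
    rcases best with _ | ⟨c', σ'⟩
    · have := ih hl.2 (some ((G.costT (G.localSearchT order τ).val 0 0).val,
        (G.localSearchT order τ).val))
      simp only [searchOrders, bind_steps, tick_steps, op_steps, op_val]
      omega
    · by_cases h : (G.costT (G.localSearchT order τ).val 0 0).val < c'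
      · have := ih hl.2 (some ((G.costT (G.localSearchT order τ).val 0 0).val,
          (G.localSearchT order τ).val))
        simp only [searchOrders, bind_steps, tick_steps, op_steps, op_val, h, decide_true, if_true]
        omega
      · have := ih hl.2 (some (c', σ'))
        simp only [searchOrders, bind_steps, tick_steps, op_steps, op_val, h, decide_false,
          Bool.false_eq_true, if_false]
        omega

theorem solve_steps_le (G : GluedInstance K n) :
    G.solve.steps ≤ 19 * (n * Nat.clog 2 n)
      + K.factorial * (17 * (n * K) + 24 * K + 19 * n + 24) := by
  -- A comparison takes at most 11 steps, whence the constant 19 = 11 + 8.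
  have e1 := mergeSort_steps_le G.wsptLET 11 G.wsptLET_steps_le n (List.finRange n)
    (List.length_finRange)
  have e2 := permutations_steps_le (List.finRange K)
  have e3 := G.searchOrders_steps_le G.wsptJobs K (permutations (List.finRange K)).val
    (fun τ hτ => by simpa using ((mem_permutations_val _ _).1 hτ).length_eq) none
  rw [length_permutations_val] at e3
  rw [G.wsptJobs_perm.length_eq] at e3
  rw [List.length_finRange] at e2 e3
  rw [List.length_finRange] at e3
  have e4 : G.solve.steps ≤ n + 1 + ((mergeSort G.wsptLET n (List.finRange n)).steps + (K + 1
      + ((permutations (List.finRange K)).steps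
      + ((G.searchOrders G.wsptJobs (permutations (List.finRange K)).val none).steps + 1)))) := by
    unfold solve
    simp only [bind_steps, indices_steps, indices_val, mergeSort_wsptLET_val]
    gcongr
    split <;> simp
  have hF := Nat.factorial_pos K
  set F := K.factorial
  -- The terms in n and K that are paid only once are absorbed into the multiples of K! ≥ 1.
  nlinarith [Nat.zero_le (n * K), Nat.mul_le_mul_left n hF, Nat.mul_le_mul_left K hF]

/-! ### Time bounds with natural logarithms -/

theorem clog_two_le (n : ℕ) (hn : 1 ≤ n) : (Nat.clog 2 n : ℝ) ≤ 2 * Real.log n + 1 := by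
  have h1 : Nat.clog 2 n ≤ Nat.log 2 n + 1 :=
    Nat.clog_le_of_le_pow (Nat.lt_pow_succ_log_self (by norm_num) n).le
  have h2 : (2 : ℝ) ^ Nat.log 2 n ≤ n := by
    exact_mod_cast Nat.pow_log_le_self 2 (by omega)
  have h3 := Real.log_le_log (by positivity) h2
  rw [Real.log_pow] at h3
  -- Only log 2 > 1/2 is needed; this is the origin of the factor 2.
  have h4 := Real.log_two_gt_d9
  have h5 : (Nat.clog 2 n : ℝ) ≤ Nat.log 2 n + 1 := by exact_mod_cast h1
  nlinarith [Nat.cast_nonneg (α := ℝ) (Nat.log 2 n)]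

theorem pos_of_valid {G : GluedInstance K n} (hG : G.Valid) (hn : 1 ≤ n) : 1 ≤ K := by
  obtain ⟨f, _⟩ := hG.need_nonempty ⟨0, hn⟩
  have := f.2
  omega

theorem solve_steps_le_log {G : GluedInstance K n} (hG : G.Valid) (hn : 1 ≤ n) :
    (G.solve.steps : ℝ) ≤ 150 * (n * (Real.log n + K) * K.factorial) := by
  have hK := pos_of_valid hG hn
  have h1 : (G.solve.steps : ℝ) ≤ 19 * (n * Nat.clog 2 n)
      + K.factorial * (17 * (n * K) + 24 * K + 19 * n + 24) := by
    exact_mod_cast G.solve_steps_le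
  have h2 := clog_two_le n hn
  have hn' : (1 : ℝ) ≤ n := by exact_mod_cast hn
  have hK' : (1 : ℝ) ≤ K := by exact_mod_cast hK
  have hF : (1 : ℝ) ≤ K.factorial := by exact_mod_cast Nat.factorial_pos K
  have hlog : 0 ≤ Real.log n := Real.log_nonneg hn'
  set F : ℝ := (K.factorial : ℝ)
  have hnK : (n : ℝ) ≤ n * K := le_mul_of_one_le_right (by linarith) hK'
  have hKn : (K : ℝ) ≤ n * K := le_mul_of_one_le_left (by linarith) hn'
  -- As n, K ≥ 1, each of n, K and 1 is at most n K, and 17 + 24 + 19 + 24 = 84.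
  have h3 : 17 * (n * K : ℝ) + 24 * K + 19 * n + 24 ≤ 84 * (n * K) := by linarith
  have h4 : F * (17 * (n * K : ℝ) + 24 * K + 19 * n + 24) ≤ F * (84 * (n * K)) :=
    mul_le_mul_of_nonneg_left h3 (by linarith)
  have h5 : (n : ℝ) * Nat.clog 2 n ≤ n * (2 * Real.log n + 1) :=
    mul_le_mul_of_nonneg_left h2 (by linarith)
  have h6 : (n : ℝ) * (2 * Real.log n + 1) ≤ n * (2 * Real.log n + K) :=
    mul_le_mul_of_nonneg_left (by linarith) (by linarith)
  have h7 : (n : ℝ) * (2 * Real.log n + K) ≤ n * (2 * Real.log n + K) * F :=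
    le_mul_of_one_le_right (by positivity) hF
  have h8 : 0 ≤ (n : ℝ) * Real.log n * F := by positivity
  have h9 : 0 ≤ (n : ℝ) * K * F := by positivity
  linarith

/-- For n ≥ 2^K one has K ≤ 2 log n, so log n + K ≤ 3 log n and the constant triples. -/
theorem solve_steps_le_log_of_two_pow_le {G : GluedInstance K n} (hG : G.Valid)
    (hn : 2 ^ K ≤ n) : (G.solve.steps : ℝ) ≤ 450 * (n * Real.log n * K.factorial) := by
  have h0 : 1 ≤ n := Nat.one_le_two_pow.trans hn
  have h1 := solve_steps_le_log hG h0
  have h2 : (2 : ℝ) ^ K ≤ n := by exact_mod_cast hn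
  have h3 := Real.log_le_log (by positivity) h2
  rw [Real.log_pow] at h3
  have h4 := Real.log_two_gt_d9
  have h5 : (K : ℝ) ≤ 2 * Real.log n := by nlinarith [Nat.cast_nonneg (α := ℝ) K]
  have h6 : (n : ℝ) * (Real.log n + K) * K.factorial ≤ n * (3 * Real.log n) * K.factorial := by
    gcongr
    linarith
  linarith

end GluedInstance

/-! ## Relations between schedules of an instance and of the glued instance -/

namespace GluedInstance

variable {K n : ℕ}

/-- Completion times of the sorted schedule are expressed by the keys alone, so the comparisons
below never look at the list. -/
theorem exists_schedule_of_key (G : GluedInstance K n) (κ : Fin K ⊕ Fin n → ℕ)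
    (hκ : Function.Injective κ)
    (hneed : ∀ j f, G.need j f = true → κ (Sum.inl f) < κ (Sum.inr j)) :
    ∃ L, G.IsSchedule L ∧ ∀ j, G.completion L j
      = (∑ f, if κ (Sum.inl f) < κ (Sum.inr j) then G.setup f else 0)
        + ∑ i, if κ (Sum.inr i) ≤ κ (Sum.inr j) then G.p i else 0 := by
  obtain ⟨L, hn, hc, hL⟩ := List.exists_idxOf_lt_iff_key κ hκ
  refine ⟨L, ⟨hn, hc, fun j f h => (hL _ _).2 (hneed j f h)⟩, fun j => ?_⟩
  rw [completion_eq hn hc]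
  simp_rw [← not_lt, hL]

end GluedInstance

namespace OrderInstance

variable {K n : ℕ}

theorem glue_valid {I : OrderInstance K n} (hI : I.Valid) : I.glue.Valid where
  p_nonneg j := Finset.sum_nonneg (s := Finset.univ) fun i _ => hI.time_nonneg j i
  w_nonneg := hI.weight_nonneg
  setup_nonneg := hI.setup_nonneg
  need_nonempty j := ⟨I.fam j ⟨0, hI.numOps_pos j⟩, by simp [glue]⟩

theorem need_glue_iff (I : OrderInstance K n) (j : Fin n) (f : Fin K) :
    I.glue.need j f = true ↔ ∃ i, I.fam j i = f := by
  simp [glue]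

/-- Every job has an operation that is last with respect to a given numbering. -/
theorem exists_last_op {I : OrderInstance K n} (hI : I.Valid) (pos : I.Op → ℕ) (j : Fin n) :
    ∃ i : Fin (I.numOps j), ∀ i', pos ⟨j, i'⟩ ≤ pos ⟨j, i⟩ := by
  obtain ⟨i, _, hi⟩ := Finset.exists_max_image Finset.univ (fun i => pos ⟨j, i⟩)
    ⟨⟨0, hI.numOps_pos j⟩, Finset.mem_univ _⟩
  exact ⟨i, fun i' => hi i' (Finset.mem_univ _)⟩

/-- Once the last operation of a job is done, all of its operations are. -/
theorem sum_glue_p_le {I : OrderInstance K n} (hI : I.Valid) (pos : I.Op → ℕ)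
    (last : ∀ j, Fin (I.numOps j)) (hlast : ∀ j i, pos ⟨j, i⟩ ≤ pos ⟨j, last j⟩) (m : ℕ) :
    (∑ i, if pos ⟨i, last i⟩ ≤ m then I.glue.p i else 0)
      ≤ ∑ o : I.Op, if pos o ≤ m then I.time o.1 o.2 else 0 := by
  rw [Fintype.sum_sigma]
  refine Finset.sum_le_sum fun j _ => ?_
  split_ifs with h
  · change ∑ i, I.time j i ≤ _
    refine Finset.sum_le_sum fun i _ => ?_
    rw [if_pos ((hlast j i).trans h)]
  · refine Finset.sum_nonneg fun i _ => ?_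
    split_ifs
    · exact hI.time_nonneg j i
    · exact le_rfl

/-- Each job is postponed as a whole to the position of its last operation, and the setups stay. No
job finishes later, since jobs whose last operation comes afterwards no longer contribute. -/
theorem glue_cost_le_oneTimeCost {I : OrderInstance K n} (hI : I.Valid)
    {L : List (Fin K ⊕ I.Op)} (hL : I.IsOneTimeSchedule L) :
    ∃ L', I.glue.IsSchedule L' ∧ I.glue.cost L' ≤ I.oneTimeCost L := by
  obtain ⟨hn, hc, hneed⟩ := hL
  choose last hlast using exists_last_op hI fun o => L.idxOf (Sum.inr o)
  let κ : Fin K ⊕ Fin n → ℕ :=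
    Sum.elim (fun f => L.idxOf (Sum.inl f)) fun j => L.idxOf (Sum.inr ⟨j, last j⟩)
  have hκ : Function.Injective κ := by
    rintro (f | i) (g | k) h
    · simpa using (List.idxOf_inj (hc _)).1 h
    · simpa using (List.idxOf_inj (hc _)).1 h
    · simpa using (List.idxOf_inj (hc _)).1 h
    · have := Sum.inr_injective ((List.idxOf_inj (hc _)).1 h)
      exact congrArg (fun o : I.Op => (Sum.inr o.1 : Fin K ⊕ Fin n)) this
  obtain ⟨L', hL', hcomp⟩ := I.glue.exists_schedule_of_key κ hκ (by
    intro j f h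
    obtain ⟨i, rfl⟩ := (I.need_glue_iff j f).1 h
    exact (hneed ⟨j, i⟩).trans_le (hlast j i))
  refine ⟨L', hL', Finset.sum_le_sum fun j _ =>
    mul_le_mul_of_nonneg_left ?_ (hI.weight_nonneg j)⟩
  refine le_trans ?_ (le_ciSup (Set.finite_range _).bddAbove (last j))
  rw [hcomp, oneTimeCompletion, List.sum_map_take_idxOf hn hc, Fintype.sum_sum_type]
  refine add_le_add (Finset.sum_le_sum fun f _ => ?_)
    (sum_glue_p_le hI (fun o => L.idxOf (Sum.inr o)) last hlast _)
  change (if L.idxOf (Sum.inl f) < L.idxOf (Sum.inr ⟨j, last j⟩) then I.setup f else 0) ≤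
    if L.idxOf (Sum.inl f) ≤ L.idxOf (Sum.inr ⟨j, last j⟩) then I.setup f else 0
  split_ifs with h1 h2
  · exact le_rfl
  · exact absurd h1.le h2
  · exact hI.setup_nonneg f
  · exact le_rfl

/-! ### Splitting the jobs of a glued schedule -/

/-- The setup or job to which an element of a one-time setup schedule belongs. -/
def toGlued (I : OrderInstance K n) : Fin K ⊕ I.Op → Fin K ⊕ Fin n :=
  Sum.map id Sigma.fst

/-- The order in which the elements of `unglue σ` appear. -/
def UnglueLT (I : OrderInstance K n) (σ : List (Fin K ⊕ Fin n)) (x y : Fin K ⊕ I.Op) : Prop :=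
  σ.idxOf (I.toGlued x) < σ.idxOf (I.toGlued y) ∨
    ∃ j, ∃ i i' : Fin (I.numOps j), x = Sum.inr ⟨j, i⟩ ∧ y = Sum.inr ⟨j, i'⟩ ∧ i < i'

theorem UnglueLT.le {I : OrderInstance K n} {σ : List (Fin K ⊕ Fin n)} {x y : Fin K ⊕ I.Op}
    (h : I.UnglueLT σ x y) : σ.idxOf (I.toGlued x) ≤ σ.idxOf (I.toGlued y) := by
  rcases h with h | ⟨j, i, i', rfl, rfl, _⟩
  · exact h.le
  · exact le_rfl

theorem UnglueLT.asymm {I : OrderInstance K n} {σ : List (Fin K ⊕ Fin n)} (x y : Fin K ⊕ I.Op)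
    (h : I.UnglueLT σ x y) : ¬ I.UnglueLT σ y x := by
  intro h'
  rcases h with h | ⟨j, i, i', rfl, rfl, h⟩
  · exact absurd h'.le (not_le.2 h)
  · rcases h' with h' | ⟨k, a, b, h1, h2, h'⟩
    · exact lt_irrefl _ h'
    · simp only [Sum.inr.injEq, Sigma.mk.injEq] at h1 h2
      obtain ⟨rfl, h1⟩ := h1
      obtain rfl := eq_of_heq h1
      obtain rfl := eq_of_heq h2.2
      exact lt_asymm h h'

theorem pairwise_unglue (I : OrderInstance K n) {σ : List (Fin K ⊕ Fin n)} (hn : σ.Nodup) :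
    (I.unglue σ).Pairwise (I.UnglueLT σ) := by
  have hσ : σ.Pairwise fun x y => σ.idxOf x < σ.idxOf y := by
    rw [List.pairwise_iff_getElem]
    intro i k hi hk h
    rwa [hn.idxOf_getElem, hn.idxOf_getElem]
  have key : ∀ (x : Fin K ⊕ Fin n) (y : Fin K ⊕ I.Op),
      (y ∈ (match x with
        | Sum.inl f => [Sum.inl f]
        | Sum.inr j => (List.finRange (I.numOps j)).map fun i => Sum.inr ⟨j, i⟩ :
          List (Fin K ⊕ I.Op))) → I.toGlued y = x := by
    rintro (f | j) y hy
    · rw [List.mem_singleton.1 hy]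
      rfl
    · obtain ⟨i, _, rfl⟩ := List.mem_map.1 hy
      rfl
  unfold unglue
  rw [List.pairwise_flatMap]
  constructor
  · rintro (f | j) _
    · exact List.pairwise_singleton _ _
    · simp only [List.pairwise_map]
      exact (List.pairwise_lt_finRange _).imp fun h => Or.inr ⟨j, _, _, rfl, rfl, h⟩
  · refine hσ.imp fun {x y} h a ha b hb => Or.inl ?_
    rw [key x a ha, key y b hb]
    exact h

theorem mem_unglue (I : OrderInstance K n) {σ : List (Fin K ⊕ Fin n)} (hc : ∀ x, x ∈ σ)
    (x : Fin K ⊕ I.Op) : x ∈ I.unglue σ := by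
  unfold unglue
  rw [List.mem_flatMap]
  refine ⟨I.toGlued x, hc _, ?_⟩
  rcases x with f | ⟨j, i⟩ <;> simp [toGlued]

theorem idxOf_unglue_lt_iff (I : OrderInstance K n) {σ : List (Fin K ⊕ Fin n)} (hn : σ.Nodup)
    (hc : ∀ x, x ∈ σ) (x y : Fin K ⊕ I.Op) :
    (I.unglue σ).idxOf x < (I.unglue σ).idxOf y ↔ I.UnglueLT σ x y :=
  List.idxOf_lt_iff_rel (I.pairwise_unglue hn) UnglueLT.asymm (I.mem_unglue hc x)
    (I.mem_unglue hc y)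

theorem nodup_unglue (I : OrderInstance K n) {σ : List (Fin K ⊕ Fin n)} (hn : σ.Nodup) :
    (I.unglue σ).Nodup :=
  (I.pairwise_unglue hn).imp fun {x y} h he => by
    subst he
    exact UnglueLT.asymm _ _ h h

theorem isOneTimeSchedule_unglue {I : OrderInstance K n} {σ : List (Fin K ⊕ Fin n)}
    (hσ : I.glue.IsSchedule σ) : I.IsOneTimeSchedule (I.unglue σ) := by
  refine ⟨I.nodup_unglue hσ.1, I.mem_unglue hσ.2.1, fun o => ?_⟩
  rw [I.idxOf_unglue_lt_iff hσ.1 hσ.2.1]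
  exact Or.inl (hσ.2.2 o.1 _ ((I.need_glue_iff _ _).2 ⟨o.2, rfl⟩))

/-- Up to an operation of j, the split schedule contains only setups and operations whose setup or
job is not behind j in the glued schedule. -/
theorem oneTimeCost_unglue_le {I : OrderInstance K n} (hI : I.Valid)
    {σ : List (Fin K ⊕ Fin n)} (hσ : I.glue.IsSchedule σ) :
    I.oneTimeCost (I.unglue σ) ≤ I.glue.cost σ := by
  obtain ⟨hn, hc, _⟩ := hσ
  refine Finset.sum_le_sum fun j _ => mul_le_mul_of_nonneg_left ?_ (hI.weight_nonneg j)
  have : Nonempty (Fin (I.numOps j)) := ⟨⟨0, hI.numOps_pos j⟩⟩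
  refine ciSup_le fun i => ?_
  have hle : ∀ x : Fin K ⊕ I.Op,
      (I.unglue σ).idxOf x ≤ (I.unglue σ).idxOf (Sum.inr ⟨j, i⟩) →
        σ.idxOf (I.toGlued x) ≤ σ.idxOf (Sum.inr j) := by
    intro x hx
    rcases hx.lt_or_eq with h | h
    · exact ((I.idxOf_unglue_lt_iff hn hc _ _).1 h).le
    · rw [(List.idxOf_inj (I.mem_unglue hc x)).1 h]
      rfl
  rw [oneTimeCompletion, List.sum_map_take_idxOf (I.nodup_unglue hn) (I.mem_unglue hc),
    GluedInstance.completion_eq hn hc, Fintype.sum_sum_type, Fintype.sum_sigma]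
  refine add_le_add (Finset.sum_le_sum fun f _ => ?_) (Finset.sum_le_sum fun k _ => ?_)
  · by_cases h : (I.unglue σ).idxOf (Sum.inl f) ≤ (I.unglue σ).idxOf (Sum.inr ⟨j, i⟩)
    · have h1 : σ.idxOf (Sum.inl f) ≤ σ.idxOf (Sum.inr j) := hle _ h
      have h2 : σ.idxOf (Sum.inl f) ≠ σ.idxOf (Sum.inr j) := fun e => by
        simpa using (List.idxOf_inj (hc _)).1 e
      rw [if_pos h, if_pos (lt_of_le_of_ne h1 h2)]
      rfl
    · rw [if_neg h]
      split_ifs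
      · exact hI.setup_nonneg f
      · exact le_rfl
  · by_cases h : σ.idxOf (Sum.inr k) ≤ σ.idxOf (Sum.inr j)
    · rw [if_pos h]
      refine Finset.sum_le_sum fun a _ => ?_
      split_ifs
      · exact le_rfl
      · exact hI.time_nonneg k a
    · rw [if_neg h]
      refine Finset.sum_nonpos fun a _ => ?_
      rw [if_neg fun h' => h (hle (Sum.inr ⟨k, a⟩) h')]

/-! ### A lower bound on the cost -/

/-- Every family that occurs is set up at least once, unless it is the one for which the machine is
already prepared. -/
theorem le_duration {I : OrderInstance K n} (hI : I.Valid) (prev : Option (Fin K))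
    (L : List I.Op) :
    (∑ f, if f ∈ L.map (fun o => I.fam o.1 o.2) ∧ prev ≠ some f then I.setup f else 0)
      + (L.map fun o => I.time o.1 o.2).sum ≤ I.duration prev L := by
  induction L generalizing prev with
  | nil => simp [duration]
  | cons o L ih =>
    have h := ih (some (I.fam o.1 o.2))
    rw [duration, List.map_cons, List.map_cons, List.sum_cons]
    have h1 : (if prev = some (I.fam o.1 o.2) then 0 else I.setup (I.fam o.1 o.2))
        = ∑ f, if I.fam o.1 o.2 = f then (if prev = some f then 0 else I.setup f) else 0 := by
      simp
    have h2 : (∑ f, if f ∈ I.fam o.1 o.2 :: L.map (fun o => I.fam o.1 o.2) ∧ prev ≠ some f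
          then I.setup f else 0)
        ≤ (if prev = some (I.fam o.1 o.2) then 0 else I.setup (I.fam o.1 o.2))
          + ∑ f, if f ∈ L.map (fun o => I.fam o.1 o.2) ∧ some (I.fam o.1 o.2) ≠ some f
            then I.setup f else 0 := by
      rw [h1, ← Finset.sum_add_distrib]
      refine Finset.sum_le_sum fun f _ => ?_
      have hs := hI.setup_nonneg f
      by_cases hf : I.fam o.1 o.2 = f
      · subst hf
        by_cases hp : prev = some (I.fam o.1 o.2) <;> simp [hp]
      · by_cases hm : f ∈ L.map (fun o => I.fam o.1 o.2)
        · by_cases hp : prev = some f <;> simp only [hp, hf, hm, ne_eq, Option.some.injEq,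
            not_true_eq_false, and_false, if_false, not_false_eq_true, and_self, if_true,
            zero_add, List.mem_cons, or_true] <;> first | exact hs | exact le_rfl
        · simp only [List.mem_cons, Ne.symm hf, hm, or_self, false_and, if_false, hf, add_zero,
            le_refl]
    linarith

/-- The setup of a family goes in front of its first operation and each job to the place of its last
operation. With only one setup charged for each family, nothing finishes later. -/
theorem glue_cost_le_cost {I : OrderInstance K n} (hI : I.Valid) {L : List I.Op}
    (hL : I.IsSchedule L) : ∃ L', I.glue.IsSchedule L' ∧ I.glue.cost L' ≤ I.cost L := by
  classical
  obtain ⟨hn, hc⟩ := hL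
  choose last hlast using exists_last_op hI fun o => L.idxOf o
  let F : List (Fin K) := L.map fun o => I.fam o.1 o.2
  -- Families without operations are set up at the very end, where they delay nobody; adding f keeps
  -- the keys distinct.
  let first : Fin K → ℕ := fun f => if f ∈ F then F.idxOf f else L.length + f
  have hF : F.length = L.length := List.length_map _
  have hfirst : Function.Injective first := by
    intro f g h
    by_cases hf : f ∈ F
    · have h1 := List.idxOf_lt_length_of_mem hf
      by_cases hg : g ∈ F
      · simp only [first, if_pos hf, if_pos hg] at h
        exact (List.idxOf_inj hf).1 h
      · simp only [first, if_pos hf, if_neg hg] at h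
        omega
    · by_cases hg : g ∈ F
      · have h1 := List.idxOf_lt_length_of_mem hg
        simp only [first, if_neg hf, if_pos hg] at h
        omega
      · simp only [first, if_neg hf, if_neg hg] at h
        exact Fin.ext (by omega)
  have hfirst_le : ∀ o : I.Op, first (I.fam o.1 o.2) ≤ L.idxOf o := by
    intro o
    have hm : I.fam o.1 o.2 ∈ F := List.mem_map.2 ⟨o, hc o, rfl⟩
    have h2 : I.fam o.1 o.2 ∈ F.take (L.idxOf o + 1) := by
      rw [← List.map_take]
      exact List.mem_map.2 ⟨o, (List.mem_take_iff_idxOf_lt' (hc o) _).2 (Nat.lt_succ_self _), rfl⟩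
    have := (List.mem_take_iff_idxOf_lt' hm _).1 h2
    simp only [first, if_pos hm]
    omega
  -- Even keys for setups and odd keys for jobs: a setup precedes the operation at the same
  -- position.
  let κ : Fin K ⊕ Fin n → ℕ :=
    Sum.elim (fun f => 2 * first f) fun j => 2 * L.idxOf ⟨j, last j⟩ + 1
  have hκ : Function.Injective κ := by
    rintro (f | i) (g | k) h
    · have h' : 2 * first f = 2 * first g := h
      exact congrArg _ (hfirst (by omega))
    · have h' : 2 * first f = 2 * L.idxOf ⟨k, last k⟩ + 1 := h
      omega
    · have h' : 2 * L.idxOf ⟨i, last i⟩ + 1 = 2 * first g := h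
      omega
    · have h' : 2 * L.idxOf ⟨i, last i⟩ + 1 = 2 * L.idxOf ⟨k, last k⟩ + 1 := h
      have := (List.idxOf_inj (hc ⟨i, last i⟩)).1
        (by omega : L.idxOf ⟨i, last i⟩ = L.idxOf ⟨k, last k⟩)
      exact congrArg (fun o : I.Op => (Sum.inr o.1 : Fin K ⊕ Fin n)) this
  obtain ⟨L', hL', hcomp⟩ := I.glue.exists_schedule_of_key κ hκ (by
    intro j f h
    obtain ⟨i, rfl⟩ := (I.need_glue_iff j f).1 h
    have h1 := (hfirst_le ⟨j, i⟩).trans (hlast j i)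
    change 2 * first (I.fam j i) < 2 * L.idxOf ⟨j, last j⟩ + 1
    simp only at h1
    omega)
  refine ⟨L', hL', Finset.sum_le_sum fun j _ =>
    mul_le_mul_of_nonneg_left ?_ (hI.weight_nonneg j)⟩
  refine le_trans ?_ (le_ciSup (Set.finite_range _).bddAbove (last j))
  refine le_trans ?_ (le_duration hI none (L.take (L.idxOf ⟨j, last j⟩ + 1)))
  rw [hcomp, List.sum_map_take_idxOf hn hc]
  refine add_le_add (Finset.sum_le_sum fun f _ => ?_) ?_
  · change (if 2 * first f < 2 * L.idxOf ⟨j, last j⟩ + 1 then I.setup f else 0) ≤ _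
    by_cases h : 2 * first f < 2 * L.idxOf ⟨j, last j⟩ + 1
    · have hlen := List.idxOf_lt_length_of_mem (hc ⟨j, last j⟩)
      have hf : f ∈ F := by
        by_contra hf
        simp only [first, if_neg hf] at h
        omega
      simp only [first, if_pos hf] at h ⊢
      rw [if_pos h, if_pos]
      refine ⟨?_, by simp⟩
      rw [List.map_take]
      exact (List.mem_take_iff_idxOf_lt' hf _).2 (by omega)
    · rw [if_neg h]
      split_ifs
      · exact hI.setup_nonneg f
      · exact le_rfl
  · have := sum_glue_p_le hI (fun o => L.idxOf o) last hlast (L.idxOf ⟨j, last j⟩)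
    refine le_trans (le_of_eq (Finset.sum_congr rfl fun i _ => ?_)) this
    change (if 2 * L.idxOf ⟨i, last i⟩ + 1 ≤ 2 * L.idxOf ⟨j, last j⟩ + 1 then _ else _) = _
    congr 1
    rw [eq_iff_iff]
    omega

end OrderInstance

/-! ## Analysis of Transform -/

namespace List

/-- The initial segment of a list up to and including `x`. -/
def upTo {α : Type*} [BEq α] (x : α) (L : List α) : List α := L.take (L.idxOf x + 1)

theorem upTo_cons_self {α : Type*} [BEq α] [LawfulBEq α] (x : α) (L : List α) :
    (x :: L).upTo x = [x] := by
  simp [upTo]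

theorem upTo_cons_of_ne {α : Type*} [BEq α] [LawfulBEq α] {x y : α} (h : y ≠ x) (L : List α) :
    (y :: L).upTo x = y :: L.upTo x := by
  have : (y == x) = false := by simpa using h
  simp [upTo, idxOf_cons, this]

theorem upTo_append_of_mem {α : Type*} [BEq α] [LawfulBEq α] {x : α} {A : List α} (h : x ∈ A)
    (L : List α) : (A ++ L).upTo x = A.upTo x := by
  have := idxOf_lt_length_of_mem h
  rw [upTo, upTo, idxOf_append_of_mem h, take_append_of_le_length (by omega)]

theorem upTo_append_of_notMem {α : Type*} [BEq α] [LawfulBEq α] {x : α} {A : List α} (h : x ∉ A)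
    (L : List α) : (A ++ L).upTo x = A ++ L.upTo x := by
  rw [upTo, upTo, idxOf_append_of_notMem h, add_assoc, take_length_add_append]

end List

namespace OrderInstance

variable {K n : ℕ} {I : OrderInstance K n}

/-- Total processing time of a list of operations. -/
def opsTime (I : OrderInstance K n) (L : List I.Op) : ℝ := (L.map fun o => I.time o.1 o.2).sum

@[simp] theorem opsTime_nil : I.opsTime [] = 0 := rfl

@[simp] theorem opsTime_cons (o : I.Op) (L : List I.Op) :
    I.opsTime (o :: L) = I.time o.1 o.2 + I.opsTime L := by
  simp [opsTime]

@[simp] theorem opsTime_append (L M : List I.Op) :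
    I.opsTime (L ++ M) = I.opsTime L + I.opsTime M := by
  simp [opsTime]

theorem opsTime_nonneg (hI : I.Valid) (L : List I.Op) : 0 ≤ I.opsTime L := by
  induction L with
  | nil => simp
  | cons o L ih =>
    rw [opsTime_cons]
    exact add_nonneg (hI.time_nonneg _ _) ih

/-- The operations of family `f` in a list. -/
def famOps (I : OrderInstance K n) (f : Fin K) (L : List I.Op) : List I.Op :=
  L.filter fun o => I.fam o.1 o.2 = f

theorem famOps_append (f : Fin K) (L M : List I.Op) :
    I.famOps f (L ++ M) = I.famOps f L ++ I.famOps f M := List.filter_append _ _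

theorem famOps_cons_of_eq {f : Fin K} {o : I.Op} (h : I.fam o.1 o.2 = f) (L : List I.Op) :
    I.famOps f (o :: L) = o :: I.famOps f L := by simp [famOps, h]

theorem famOps_cons_of_ne {f : Fin K} {o : I.Op} (h : I.fam o.1 o.2 ≠ f) (L : List I.Op) :
    I.famOps f (o :: L) = I.famOps f L := by simp [famOps, h]

theorem famOps_of_forall {f : Fin K} {L : List I.Op} (h : ∀ o ∈ L, I.fam o.1 o.2 = f) :
    I.famOps f L = L := by simpa [famOps] using h

theorem famOps_of_forall_ne {f : Fin K} {L : List I.Op} (h : ∀ o ∈ L, I.fam o.1 o.2 ≠ f) :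
    I.famOps f L = [] := by simpa [famOps] using h

theorem sum_opsTime_famOps (L : List I.Op) : ∑ f, I.opsTime (I.famOps f L) = I.opsTime L := by
  induction L with
  | nil => simp [famOps]
  | cons o L ih =>
    have : ∀ f, I.opsTime (I.famOps f (o :: L))
        = (if I.fam o.1 o.2 = f then I.time o.1 o.2 else 0) + I.opsTime (I.famOps f L) := by
      intro f
      by_cases h : I.fam o.1 o.2 = f
      · simp [famOps_cons_of_eq h, h]
      · simp [famOps_cons_of_ne h, h]
    simp_rw [this, Finset.sum_add_distrib, ih]
    simp

/-! ### Pulling operations of one family to the front -/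

/-- `L'` arises from `L` by removing its first operations `T` of family `f`. -/
inductive Pull (I : OrderInstance K n) (f : Fin K) : List I.Op → List I.Op → List I.Op → Prop
  | nil (L : List I.Op) : Pull I f [] L L
  | skip {o : I.Op} {T L L' : List I.Op} : I.fam o.1 o.2 ≠ f → Pull I f T L L' →
      Pull I f T (o :: L) (o :: L')
  | take {o : I.Op} {T L L' : List I.Op} : I.fam o.1 o.2 = f → Pull I f T L L' →
      Pull I f (o :: T) (o :: L) L'

namespace Pull

theorem append_take {f : Fin K} {A T L L' : List I.Op} (hA : ∀ o ∈ A, I.fam o.1 o.2 = f)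
    (h : I.Pull f T L L') : I.Pull f (A ++ T) (A ++ L) L' := by
  induction A with
  | nil => exact h
  | cons o A ih =>
    rw [List.forall_mem_cons] at hA
    exact take hA.1 (ih hA.2)

theorem append_skip {f : Fin K} {A T L L' : List I.Op} (hA : ∀ o ∈ A, I.fam o.1 o.2 ≠ f)
    (h : I.Pull f T L L') : I.Pull f T (A ++ L) (A ++ L') := by
  induction A with
  | nil => exact h
  | cons o A ih =>
    rw [List.forall_mem_cons] at hA
    exact skip hA.1 (ih hA.2)

theorem perm {f : Fin K} {T L L' : List I.Op} (h : I.Pull f T L L') : (T ++ L').Perm L := by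
  induction h with
  | nil L => exact List.Perm.refl _
  | skip _ _ ih => exact List.perm_middle.trans (ih.cons _)
  | take _ _ ih => exact ih.cons _

theorem fam_eq {f : Fin K} {T L L' : List I.Op} (h : I.Pull f T L L') :
    ∀ o ∈ T, I.fam o.1 o.2 = f := by
  induction h with
  | nil L => simp
  | skip _ _ ih => exact ih
  | take ho _ ih => exact List.forall_mem_cons.2 ⟨ho, ih⟩

theorem opsTime_eq {f : Fin K} {T L L' : List I.Op} (h : I.Pull f T L L') :
    I.opsTime L = I.opsTime T + I.opsTime L' := by
  induction h with
  | nil L => simp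
  | skip _ _ ih => rw [opsTime_cons, opsTime_cons, ih]; ring
  | take _ _ ih => rw [opsTime_cons, opsTime_cons, ih]; ring

theorem famOps_self {f : Fin K} {T L L' : List I.Op} (h : I.Pull f T L L') :
    I.famOps f L = T ++ I.famOps f L' := by
  induction h with
  | nil L => rfl
  | skip ho _ ih => rw [famOps_cons_of_ne ho, famOps_cons_of_ne ho, ih]
  | take ho _ ih => rw [famOps_cons_of_eq ho, ih, List.cons_append]

theorem famOps_of_ne {f g : Fin K} (hg : g ≠ f) {T L L' : List I.Op} (h : I.Pull f T L L') :
    I.famOps g L = I.famOps g L' := by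
  induction h with
  | nil L => rfl
  | @skip o _ _ _ _ _ ih =>
    by_cases h : I.fam o.1 o.2 = g
    · rw [famOps_cons_of_eq h, famOps_cons_of_eq h, ih]
    · rw [famOps_cons_of_ne h, famOps_cons_of_ne h, ih]
  | take ho _ ih => rw [famOps_cons_of_ne (by rw [ho]; exact hg.symm), ih]

/-- Let T₁ be the pulled operations from before o and T₂ those from behind it. Operations are pulled
in order, so if some come from behind o, then all of the family before o are pulled too. -/
theorem upTo {f : Fin K} {T L L' : List I.Op} (h : I.Pull f T L L') {o : I.Op} (ho : o ∉ T) :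
    ∃ T₁ T₂, T = T₁ ++ T₂ ∧ I.Pull f T₁ (L.upTo o) (L'.upTo o) ∧
      (T₂ = [] ∨ I.famOps f (L'.upTo o) = []) := by
  induction h with
  | nil L => exact ⟨[], [], rfl, nil _, Or.inl rfl⟩
  | @skip x T L L' hx _ ih =>
    by_cases hxo : x = o
    · subst hxo
      refine ⟨[], T, rfl, ?_, Or.inr ?_⟩
      · rw [List.upTo_cons_self, List.upTo_cons_self]
        exact nil _
      · rw [List.upTo_cons_self]
        exact famOps_of_forall_ne (by simpa using hx)
    · obtain ⟨T₁, T₂, h1, h2, h3⟩ := ih ho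
      rw [List.upTo_cons_of_ne hxo, List.upTo_cons_of_ne hxo]
      exact ⟨T₁, T₂, h1, skip hx h2, h3.imp id fun h => by rw [famOps_cons_of_ne hx, h]⟩
  | @take x T L L' hx _ ih =>
    rw [List.mem_cons, not_or] at ho
    obtain ⟨T₁, T₂, h1, h2, h3⟩ := ih ho.2
    rw [List.upTo_cons_of_ne (Ne.symm ho.1)]
    exact ⟨x :: T₁, T₂, by rw [h1, List.cons_append], take hx h2, h3⟩

/-- What precedes a pulled operation in T preceded it in L already, so a pulled operation does not
get more processing time in front of it. -/
theorem opsTime_upTo_le (hI : I.Valid) {f : Fin K} {T L L' : List I.Op} (h : I.Pull f T L L')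
    {o : I.Op} (ho : o ∈ T) : I.opsTime (T.upTo o) ≤ I.opsTime (L.upTo o) := by
  induction h with
  | nil L => simp at ho
  | @skip x T L L' hx hp ih =>
    have hxo : x ≠ o := fun e => hx (e ▸ hp.fam_eq o ho)
    rw [List.upTo_cons_of_ne hxo, opsTime_cons]
    have := hI.time_nonneg x.1 x.2
    linarith [ih ho]
  | @take x T L L' hx _ ih =>
    by_cases hxo : x = o
    · subst hxo
      rw [List.upTo_cons_self, List.upTo_cons_self]
    · rw [List.upTo_cons_of_ne hxo, List.upTo_cons_of_ne hxo, opsTime_cons, opsTime_cons]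
      linarith [ih (by simpa [Ne.symm hxo] using ho)]

end Pull

/-! ### Batches -/

/-- All batches are nonempty and contain operations of their own family only. -/
def BatchesValid (R : List I.Batch) : Prop :=
  ∀ B ∈ R, B.ops ≠ [] ∧ ∀ o ∈ B.ops, I.fam o.1 o.2 = B.fam

/-- The sequence of operations in a list of batches. -/
def flattenBatches (R : List I.Batch) : List I.Op := R.flatMap Batch.ops

theorem flattenBatches_cons (B : I.Batch) (R : List I.Batch) :
    flattenBatches (B :: R) = B.ops ++ flattenBatches R := List.flatMap_cons

theorem batchesValid_cons {B : I.Batch} {R : List I.Batch} :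
    BatchesValid (B :: R)
      ↔ (B.ops ≠ [] ∧ ∀ o ∈ B.ops, I.fam o.1 o.2 = B.fam) ∧ BatchesValid R :=
  List.forall_mem_cons

/-- Maximality of the batches plays no role for the guarantee: the analysis charges one setup to
each batch, needed or not. -/
theorem toBatches_val (L : List I.Op) :
    flattenBatches (I.toBatches L).val = L ∧ BatchesValid (I.toBatches L).val := by
  induction L with
  | nil => exact ⟨rfl, fun B hB => by simp [toBatches] at hB⟩
  | cons o L ih =>
    simp only [toBatches, bind_val, op_val]
    rcases h : (I.toBatches L).val with _ | ⟨B, R⟩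
    · rw [h] at ih
      refine ⟨?_, ?_⟩
      · rw [← ih.1]
        rfl
      · intro B hB
        simp only [bind_val, op_val, List.mem_singleton] at hB
        subst hB
        simp
    · rw [h, flattenBatches_cons, batchesValid_cons] at ih
      by_cases hf : B.fam = I.fam o.1 o.2
      · simp only [bind_val, op_val, hf, decide_true, if_true, flattenBatches_cons,
          batchesValid_cons, List.cons_append, ih.1, ne_eq, reduceCtorEq, not_false_eq_true,
          true_and, List.forall_mem_cons]
        exact ⟨fun x hx => (ih.2.1.2 x hx).trans hf, ih.2.2⟩
      · simp only [bind_val, op_val, hf, decide_false, Bool.false_eq_true, if_false,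
          flattenBatches_cons, batchesValid_cons, ih.1]
        exact ⟨rfl, ⟨by simp, by simp⟩, ih.2⟩

theorem totalTime_val (L : List I.Op) : (I.totalTime L).val = I.opsTime L := by
  induction L with
  | nil => simp [totalTime]
  | cons o L ih => simp [totalTime, ih]

theorem pullOps_val (limit : ℝ) (L : List I.Op) (total : ℝ) :
    ∃ T rest, (I.pullOps limit L total).val = (T, total + I.opsTime T, rest) ∧ L = T ++ rest ∧
      (T = [] ∨ total + I.opsTime T < limit) ∧
      ∀ x t, rest = x :: t → limit ≤ total + I.opsTime T + I.time x.1 x.2 := by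
  induction L generalizing total with
  | nil => exact ⟨[], [], by simp [pullOps], rfl, Or.inl rfl, by simp⟩
  | cons o L ih =>
    by_cases h : total + I.time o.1 o.2 < limit
    · obtain ⟨T, rest, h1, h2, h3, h4⟩ := ih (total + I.time o.1 o.2)
      refine ⟨o :: T, rest, ?_, by rw [h2, List.cons_append], Or.inr ?_, fun x t hx => ?_⟩
      · simp [pullOps, h, h1, add_assoc]
      · rcases h3 with rfl | h3
        · simpa using h
        · rwa [opsTime_cons, ← add_assoc]
      · rw [opsTime_cons, ← add_assoc]
        exact h4 x t hx
    · refine ⟨[], o :: L, by simp [pullOps, h], rfl, Or.inl rfl, fun x t hx => ?_⟩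
      rw [List.cons.injEq] at hx
      rw [← hx.1]
      simpa using h

/-- The last two clauses are the two halves of the charging argument: a batch that pulled something
stays below the limit, and the next operation of its family would have reached it. -/
theorem pullBatches_val (f : Fin K) (limit : ℝ) (R : List I.Batch) (total : ℝ)
    (hR : BatchesValid R) :
    ∃ T R', (I.pullBatches f limit R total).val = (T, R') ∧ BatchesValid R' ∧
      R'.length ≤ R.length ∧ I.Pull f T (flattenBatches R) (flattenBatches R') ∧
      (T = [] ∨ total + I.opsTime T < limit) ∧
      ∀ x t, I.famOps f (flattenBatches R') = x :: t →
        limit ≤ total + I.opsTime T + I.time x.1 x.2 := by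
  induction R generalizing total with
  | nil => exact ⟨[], [], by simp [pullBatches], hR, le_rfl, Pull.nil _, Or.inl rfl,
      by simp [flattenBatches, famOps]⟩
  | cons B R ih =>
    rw [batchesValid_cons] at hR
    by_cases hf : B.fam = f
    · obtain ⟨A, rest, q1, q2, q3, q4⟩ := I.pullOps_val limit B.ops total
      have hops : ∀ o ∈ A ++ rest, I.fam o.1 o.2 = f := q2 ▸ fun o ho => (hR.1.2 o ho).trans hf
      have hA : ∀ o ∈ A, I.fam o.1 o.2 = f := fun o ho => hops o (List.mem_append_left _ ho)
      rcases rest with _ | ⟨y, rest⟩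
      · rw [List.append_nil] at q2
        obtain ⟨T, R', h1, h2, h3, h4, h5, h6⟩ := ih (total + I.opsTime A) hR.2
        refine ⟨A ++ T, R', ?_, h2, h3.trans (Nat.le_succ _), ?_, ?_, fun x t hx => ?_⟩
        · simp [pullBatches, hf, q1, h1]
        · rw [flattenBatches_cons, q2]
          exact h4.append_take hA
        · rw [opsTime_append, ← add_assoc]
          rcases h5 with rfl | h5
          · rcases q3 with rfl | q3
            · exact Or.inl rfl
            · exact Or.inr (by simpa using q3)
          · exact Or.inr h5
        · rw [opsTime_append, ← add_assoc]
          exact h6 x t hx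
      · refine ⟨A, ⟨f, y :: rest⟩ :: R, ?_, ?_, le_rfl, ?_, q3, fun x t hx => ?_⟩
        · simp [pullBatches, hf, q1]
        · rw [batchesValid_cons]
          exact ⟨⟨by simp, fun o ho => hops o (List.mem_append_right _ ho)⟩, hR.2⟩
        · rw [flattenBatches_cons, flattenBatches_cons, q2, List.append_assoc]
          simpa using (Pull.nil ((y :: rest) ++ flattenBatches R)).append_take hA
        · rw [flattenBatches_cons, List.cons_append,
            famOps_cons_of_eq (hops y (List.mem_append_right _ List.mem_cons_self)),
            List.cons.injEq] at hx
          rw [← hx.1]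
          exact q4 _ _ rfl
    · obtain ⟨T, R', h1, h2, h3, h4, h5, h6⟩ := ih total hR.2
      have hB : ∀ o ∈ B.ops, I.fam o.1 o.2 ≠ f := fun o ho => by rwa [hR.1.2 o ho]
      refine ⟨T, B :: R', ?_, ?_, Nat.succ_le_succ h3, ?_, h5, fun x t hx => ?_⟩
      · simp [pullBatches, hf, h1]
      · rw [batchesValid_cons]
        exact ⟨hR.1, h2⟩
      · rw [flattenBatches_cons, flattenBatches_cons]
        exact h4.append_skip hB
      · rw [flattenBatches_cons, famOps_append, famOps_of_forall_ne hB, List.nil_append] at hx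
        exact h6 x t hx

/-! ### Completion times after Transform -/

theorem duration_append_of_fam_eq {f : Fin K} {A : List I.Op} (hA : ∀ o ∈ A, I.fam o.1 o.2 = f)
    (X : List I.Op) : I.duration (some f) (A ++ X) = I.opsTime A + I.duration (some f) X := by
  induction A with
  | nil => simp
  | cons o A ih =>
    rw [List.forall_mem_cons] at hA
    rw [List.cons_append, duration, hA.1, ih hA.2, opsTime_cons]
    simp
    ring

theorem duration_append_le (hI : I.Valid) {f : Fin K} {A : List I.Op} (hne : A ≠ [])
    (hA : ∀ o ∈ A, I.fam o.1 o.2 = f) (prev : Option (Fin K)) (X : List I.Op) :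
    I.duration prev (A ++ X) ≤ I.setup f + I.opsTime A + I.duration (some f) X := by
  rcases A with _ | ⟨o, A⟩
  · exact absurd rfl hne
  rw [List.forall_mem_cons] at hA
  rw [List.cons_append, duration, hA.1, duration_append_of_fam_eq hA.2, opsTime_cons]
  have := hI.setup_nonneg f
  split_ifs <;> linarith

/-- The contribution of family `f` to the bound on the completion time of an operation, where `l`
are the operations of family `f` up to that operation. -/
noncomputable def famBound (I : OrderInstance K n) (α : ℝ) (f : Fin K) : List I.Op → ℝ
  | [] => 0
  | x :: t => (1 + α) * I.setup f + (I.time x.1 x.2 + 2 * I.opsTime t) / α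

theorem famBound_nonneg (hI : I.Valid) {α : ℝ} (hα : 0 < α) (f : Fin K) (l : List I.Op) :
    0 ≤ I.famBound α f l := by
  rcases l with _ | ⟨x, t⟩
  · exact le_rfl
  · have h1 := hI.setup_nonneg f
    have h2 := hI.time_nonneg x.1 x.2
    have h3 := opsTime_nonneg hI t
    unfold famBound
    positivity

theorem setup_le_famBound (hI : I.Valid) {α : ℝ} (hα : 0 < α) (f : Fin K) {l : List I.Op}
    (hl : l ≠ []) : I.setup f ≤ I.famBound α f l := by
  rcases l with _ | ⟨x, t⟩
  · exact absurd rfl hl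
  · have h1 := hI.setup_nonneg f
    have h2 := hI.time_nonneg x.1 x.2
    have h3 := opsTime_nonneg hI t
    have h4 : 0 ≤ (I.time x.1 x.2 + 2 * I.opsTime t) / α := by positivity
    unfold famBound
    nlinarith [mul_nonneg hα.le h1]

/-- Here O is the batch, F consists of the operations of its family that remain before o, and M of
those behind o. If F is empty, this is the last batch of the family before o, and (1 + α) s covers
its setup and T₂. Otherwise T₂ is empty, and the first operation of F did not fit, so the batch and
that operation pay for the setup. -/
theorem famBound_step (hI : I.Valid) {α : ℝ} (hα : 0 < α) {f : Fin K}
    {O T₁ T₂ F M : List I.Op} (hO : O ≠ []) (hF : T₂ = [] ∨ F = [])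
    (h1 : T₁ ++ T₂ = [] ∨ I.opsTime O + I.opsTime (T₁ ++ T₂) < α * I.setup f)
    (h2 : ∀ x t, F ++ M = x :: t →
      α * I.setup f ≤ I.opsTime O + I.opsTime (T₁ ++ T₂) + I.time x.1 x.2) :
    I.setup f + I.opsTime T₂ + I.famBound α f F ≤ I.famBound α f (O ++ (T₁ ++ F)) := by
  rcases O with _ | ⟨x, O⟩
  · exact absurd rfl hO
  have hs := hI.setup_nonneg f
  have hx := hI.time_nonneg x.1 x.2
  have hO' := opsTime_nonneg hI O
  have hT₁ := opsTime_nonneg hI T₁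
  have hT₂ := opsTime_nonneg hI T₂
  rcases F with _ | ⟨y, F⟩
  · have hT : I.opsTime T₂ ≤ α * I.setup f := by
      rcases h1 with h1 | h1
      · rw [(List.append_eq_nil_iff.1 h1).2, opsTime_nil]
        positivity
      · rw [opsTime_cons, opsTime_append] at h1
        linarith
    have h3 : 0 ≤ (I.time x.1 x.2 + 2 * I.opsTime (O ++ (T₁ ++ []))) / α := by
      have := opsTime_nonneg hI (O ++ (T₁ ++ []))
      positivity
    simp only [List.cons_append, famBound]
    linarith
  · have hT₂' : T₂ = [] := by simpa using hF
    subst hT₂'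
    have h3 := h2 y (F ++ M) rfl
    simp only [List.cons_append, famBound, opsTime_append, opsTime_cons, opsTime_nil] at h3 ⊢
    -- The time of y is spent once here and once more as the leading term of the bound for the
    -- remaining operations; hence the factor 2 on all operations but the first.
    have h4 : I.setup f ≤ (I.time x.1 x.2 + 2 * I.opsTime O + 2 * I.opsTime T₁
        + I.time y.1 y.2) / α := by
      rw [le_div_iff₀ hα]
      linarith
    have h5 : (I.time x.1 x.2 + 2 * (I.opsTime O + (I.opsTime T₁ + (I.time y.1 y.2
        + I.opsTime F)))) / α = (I.time x.1 x.2 + 2 * I.opsTime O + 2 * I.opsTime T₁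
        + I.time y.1 y.2) / α + (I.time y.1 y.2 + 2 * I.opsTime F) / α := by
      rw [← add_div]
      congr 1
      ring
    rw [h5]
    linarith

theorem fillBatches_val_perm (α : ℝ) (m : ℕ) (R : List I.Batch) (hR : BatchesValid R)
    (hm : R.length ≤ m) : (I.fillBatches α m R).val.Perm (flattenBatches R) := by
  induction m generalizing R with
  | zero =>
    rw [List.length_eq_zero_iff.1 (Nat.le_zero.1 hm)]
    simp [fillBatches, flattenBatches]
  | succ m ih =>
    rcases R with _ | ⟨B, R⟩
    · simp [fillBatches, flattenBatches]
    · rw [batchesValid_cons] at hR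
      obtain ⟨T, R', h1, h2, h3, h4, -, -⟩ := I.pullBatches_val B.fam (α * I.setup B.fam) R
        (I.opsTime B.ops) hR.2
      simp only [fillBatches, bind_val, op_val, append_val, totalTime_val, h1, flattenBatches_cons]
      rw [List.length_cons] at hm
      exact (((ih R' h2 (by omega)).append_left T).trans h4.perm).append_left _

/-- Induction over the batches, for an arbitrary state of the machine. Filling up one batch affects
only the contribution of its own family, which `famBound_step` controls. -/
theorem duration_fillBatches_le (hI : I.Valid) {α : ℝ} (hα : 0 < α) (m : ℕ) (R : List I.Batch)
    (hR : BatchesValid R) (hm : R.length ≤ m) (prev : Option (Fin K)) (o : I.Op)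
    (ho : o ∈ flattenBatches R) :
    I.duration prev ((I.fillBatches α m R).val.upTo o)
      ≤ I.opsTime ((flattenBatches R).upTo o)
        + ∑ f, I.famBound α f (I.famOps f ((flattenBatches R).upTo o)) := by
  induction m generalizing R prev with
  | zero =>
    rw [List.length_eq_zero_iff.1 (Nat.le_zero.1 hm)] at ho
    simp [flattenBatches] at ho
  | succ m ih =>
    rcases R with _ | ⟨B, R⟩
    · simp [flattenBatches] at ho
    rw [batchesValid_cons] at hR
    obtain ⟨⟨hne, hfam⟩, hR⟩ := hR
    obtain ⟨T, R', h1, h2, h3, h4, h5, h6⟩ := I.pullBatches_val B.fam (α * I.setup B.fam) R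
      (I.opsTime B.ops) hR
    rw [List.length_cons] at hm
    have hval : (I.fillBatches α (m + 1) (B :: R)).val
        = (B.ops ++ T) ++ (I.fillBatches α m R').val := by
      simp only [fillBatches, bind_val, op_val, append_val, totalTime_val, h1, List.append_assoc]
    have hfamBT : ∀ x ∈ B.ops ++ T, I.fam x.1 x.2 = B.fam := by
      intro x hx
      rcases List.mem_append.1 hx with hx | hx
      · exact hfam x hx
      · exact h4.fam_eq x hx
    rw [hval, flattenBatches_cons]
    rw [flattenBatches_cons] at ho
    -- If o lands in the current batch, at most one setup is paid, and the family of the batch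
    -- already occurs in the prefix up to o.
    by_cases hoBT : o ∈ B.ops ++ T
    · rw [List.upTo_append_of_mem hoBT]
      have hne' : (B.ops ++ T).upTo o ≠ [] := by
        simp [List.upTo, hne]
      have hfam' : ∀ x ∈ (B.ops ++ T).upTo o, I.fam x.1 x.2 = B.fam := fun x hx =>
        hfamBT x (List.mem_of_mem_take hx)
      have hd := duration_append_le hI hne' hfam' prev []
      rw [List.append_nil] at hd
      have hle : I.opsTime ((B.ops ++ T).upTo o)
          ≤ I.opsTime ((B.ops ++ flattenBatches R).upTo o) := by
        by_cases hoB : o ∈ B.ops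
        · rw [List.upTo_append_of_mem hoB, List.upTo_append_of_mem hoB]
        · have hoT : o ∈ T := (List.mem_append.1 hoBT).resolve_left hoB
          rw [List.upTo_append_of_notMem hoB, List.upTo_append_of_notMem hoB, opsTime_append,
            opsTime_append]
          linarith [h4.opsTime_upTo_le hI hoT]
      have hfne : I.famOps B.fam ((B.ops ++ flattenBatches R).upTo o) ≠ [] := by
        rcases hB : B.ops with _ | ⟨x, O⟩
        · exact absurd hB hne
        · have hx : I.fam x.1 x.2 = B.fam := hfam x (hB ▸ List.mem_cons_self)
          rw [List.cons_append, List.upTo, List.take_succ_cons, famOps_cons_of_eq hx]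
          simp
      have hsum : I.setup B.fam
          ≤ ∑ f, I.famBound α f (I.famOps f ((B.ops ++ flattenBatches R).upTo o)) :=
        (setup_le_famBound hI hα _ hfne).trans (Finset.single_le_sum
          (f := fun f => I.famBound α f (I.famOps f ((B.ops ++ flattenBatches R).upTo o)))
          (fun f _ => famBound_nonneg hI hα f _) (Finset.mem_univ _))
      simp only [duration] at hd
      linarith
    · have hoB : o ∉ B.ops := fun h => hoBT (List.mem_append_left _ h)
      have hoT : o ∉ T := fun h => hoBT (List.mem_append_right _ h)
      have hoR : o ∈ flattenBatches R' := by
        have := h4.perm.mem_iff.2 ((List.mem_append.1 ho).resolve_left hoB)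
        exact (List.mem_append.1 this).resolve_left hoT
      rw [List.upTo_append_of_notMem hoBT, List.upTo_append_of_notMem hoB]
      have hd := duration_append_le hI (by simp [hne]) hfamBT prev
        ((I.fillBatches α m R').val.upTo o)
      have hrec := ih R' h2 (by omega) (some B.fam) hoR
      -- T₁ was in front of o anyway and only changes place; T₂ is the additional delay of o caused
      -- by pulling.
      obtain ⟨T₁, T₂, hT, hp, hF⟩ := h4.upTo hoT
      have htime := hp.opsTime_eq
      have hM : ∃ M, I.famOps B.fam (flattenBatches R')
          = I.famOps B.fam ((flattenBatches R').upTo o) ++ M := by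
        refine ⟨I.famOps B.fam ((flattenBatches R').drop ((flattenBatches R').idxOf o + 1)), ?_⟩
        rw [← famOps_append, List.upTo, List.take_append_drop]
      obtain ⟨M, hM⟩ := hM
      rw [hM] at h6
      rw [hT] at h5 h6 hd ⊢
      have hstep := famBound_step hI hα hne hF h5 h6
      have hsum : I.setup B.fam + I.opsTime T₂
          + ∑ f, I.famBound α f (I.famOps f ((flattenBatches R').upTo o))
          ≤ ∑ f, I.famBound α f (I.famOps f (B.ops ++ (flattenBatches R).upTo o)) := by
        have hB : I.setup B.fam + I.opsTime T₂
            = ∑ f, if f = B.fam then I.setup B.fam + I.opsTime T₂ else 0 := by simp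
        rw [hB, ← Finset.sum_add_distrib]
        refine Finset.sum_le_sum fun f _ => ?_
        rw [famOps_append]
        by_cases hf : f = B.fam
        · subst hf
          rw [if_pos rfl, famOps_of_forall hfam, hp.famOps_self]
          exact hstep
        · rw [if_neg hf, zero_add, hp.famOps_of_ne hf,
            famOps_of_forall_ne (L := B.ops) fun x hx => by rw [hfam x hx]; exact Ne.symm hf,
            List.nil_append]
      rw [opsTime_append] at hd ⊢
      rw [opsTime_append] at hd
      linarith

/-- Counting the first operation twice as well makes the bound linear in the processing time, so
that it can be summed over the families. -/
theorem famBound_le (hI : I.Valid) {α : ℝ} (hα : 0 < α) (f : Fin K) (l : List I.Op) :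
    I.famBound α f l ≤ (1 + α) * (if l ≠ [] then I.setup f else 0) + 2 / α * I.opsTime l := by
  rcases l with _ | ⟨x, t⟩
  · simp [famBound]
  · have h2 := hI.time_nonneg x.1 x.2
    have h : 2 / α * I.opsTime (x :: t)
        = (I.time x.1 x.2 + 2 * I.opsTime t) / α + I.time x.1 x.2 / α := by
      rw [opsTime_cons]
      ring
    rw [h]
    have : 0 ≤ I.time x.1 x.2 / α := by positivity
    simp only [famBound, ne_eq, reduceCtorEq, not_false_eq_true, if_true]
    linarith

end OrderInstance

namespace OrderInstance

variable {K n : ℕ}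

/-! ## The approximation guarantee -/

theorem tagOps_val (I : OrderInstance K n) (j : Fin n) (is : List (Fin (I.numOps j))) :
    (I.tagOps j is).val = is.map fun i => ⟨j, i⟩ := by
  induction is with
  | nil => simp [tagOps]
  | cons i is ih => simp [tagOps, ih]

theorem splitJobs_val (I : OrderInstance K n) (σ : List (Fin K ⊕ Fin n)) :
    (I.splitJobs σ).val = (I.unglue σ).filterMap Sum.getRight? := by
  have h : ∀ (j : Fin n) (l : List (Fin (I.numOps j))),
      (l.map fun i => (Sum.inr ⟨j, i⟩ : Fin K ⊕ I.Op)).filterMap Sum.getRight?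
        = l.map fun i => ⟨j, i⟩ := by
    intro j l
    induction l with
    | nil => rfl
    | cons i l ih => simp [ih]
  induction σ with
  | nil => rfl
  | cons x σ ih =>
    unfold unglue at ih ⊢
    rcases x with f | j
    · rw [List.flatMap_cons, List.filterMap_append, ← ih]
      rfl
    · rw [List.flatMap_cons, List.filterMap_append, ← ih, h]
      simp [splitJobs, tagOps_val]

theorem mem_splitJobs_val (I : OrderInstance K n) {σ : List (Fin K ⊕ Fin n)}
    (hc : ∀ x, x ∈ σ) (o : I.Op) : o ∈ (I.splitJobs σ).val := by
  rw [splitJobs_val, List.mem_filterMap]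
  exact ⟨Sum.inr o, I.mem_unglue hc _, rfl⟩

theorem nodup_splitJobs_val (I : OrderInstance K n) {σ : List (Fin K ⊕ Fin n)}
    (hn : σ.Nodup) : (I.splitJobs σ).val.Nodup := by
  rw [splitJobs_val]
  refine List.Nodup.filterMap ?_ (I.nodup_unglue hn)
  rintro (f | i) (g | k) h <;> simp_all

theorem idxOf_le_of_idxOf_splitJobs_le (I : OrderInstance K n) {σ : List (Fin K ⊕ Fin n)}
    (hn : σ.Nodup) (hc : ∀ x, x ∈ σ) {o o' : I.Op}
    (h : (I.splitJobs σ).val.idxOf o' ≤ (I.splitJobs σ).val.idxOf o) :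
    σ.idxOf (Sum.inr o'.1) ≤ σ.idxOf (Sum.inr o.1) := by
  rcases h.lt_or_eq with h | h
  · have hp : (I.splitJobs σ).val.Pairwise fun x y => I.UnglueLT σ (Sum.inr x) (Sum.inr y) := by
      rw [splitJobs_val, List.pairwise_filterMap]
      refine (I.pairwise_unglue hn).imp ?_
      rintro (f | i) (g | k) h <;> simp_all
    exact (List.rel_of_idxOf_lt hp (I.mem_splitJobs_val hc o) h).le
  · rw [(List.idxOf_inj (I.mem_splitJobs_val hc o')).1 h]

theorem length_flattenBatches_le {I : OrderInstance K n} {R : List I.Batch}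
    (hR : BatchesValid R) : R.length ≤ (flattenBatches R).length := by
  induction R with
  | nil => simp
  | cons B R ih =>
    rw [batchesValid_cons] at hR
    rw [flattenBatches_cons, List.length_cons, List.length_append]
    have := List.length_pos_iff.2 hR.1.1
    have := ih hR.2
    omega

theorem transform_val (I : OrderInstance K n) (α : ℝ) (σ : List (Fin K ⊕ Fin n)) :
    (I.transform α σ).val = (I.fillBatches α (I.toBatches (I.splitJobs σ).val).val.length
      (I.toBatches (I.splitJobs σ).val).val).val := by
  simp [transform]

theorem transform_perm (I : OrderInstance K n) (α : ℝ) (σ : List (Fin K ⊕ Fin n)) :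
    (I.transform α σ).val.Perm (I.splitJobs σ).val := by
  obtain ⟨h1, h2⟩ := I.toBatches_val (I.splitJobs σ).val
  have := I.fillBatches_val_perm α _ _ h2 le_rfl
  rwa [h1, ← transform_val] at this

theorem isSchedule_transform {I : OrderInstance K n} (α : ℝ) {σ : List (Fin K ⊕ Fin n)}
    (hn : σ.Nodup) (hc : ∀ x, x ∈ σ) : I.IsSchedule (I.transform α σ).val :=
  ⟨(I.transform_perm α σ).nodup_iff.2 (I.nodup_splitJobs_val hn), fun o =>
    (I.transform_perm α σ).mem_iff.2 (I.mem_splitJobs_val hc o)⟩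

theorem opsTime_upTo_splitJobs_le {I : OrderInstance K n} (hI : I.Valid)
    {σ : List (Fin K ⊕ Fin n)} (hn : σ.Nodup) (hc : ∀ x, x ∈ σ) (o : I.Op) :
    I.opsTime ((I.splitJobs σ).val.upTo o)
      ≤ ∑ k, if σ.idxOf (Sum.inr k) ≤ σ.idxOf (Sum.inr o.1) then I.glue.p k else 0 := by
  unfold opsTime List.upTo
  rw [List.sum_map_take_idxOf (I.nodup_splitJobs_val hn) (I.mem_splitJobs_val hc),
    Fintype.sum_sigma]
  refine Finset.sum_le_sum fun k _ => ?_
  by_cases h : σ.idxOf (Sum.inr k) ≤ σ.idxOf (Sum.inr o.1)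
  · rw [if_pos h]
    refine Finset.sum_le_sum fun a _ => ?_
    split_ifs
    · exact le_rfl
    · exact hI.time_nonneg k a
  · rw [if_neg h]
    refine Finset.sum_nonpos fun a _ => ?_
    rw [if_neg fun h' => h (I.idxOf_le_of_idxOf_splitJobs_le hn hc h')]

/-- Families occurring up to o have their setups before the job of o in σ, and the processing time
up to o is at most that of the jobs up to it. Both parts of the glued completion time are thus
inflated by 1 + √2. -/
theorem completion_transform_le {I : OrderInstance K n} (hI : I.Valid)
    {σ : List (Fin K ⊕ Fin n)} (hσ : I.glue.IsSchedule σ) (o : I.Op) :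
    I.completion (I.transform (Real.sqrt 2) σ).val o
      ≤ (1 + Real.sqrt 2) * I.glue.completion σ o.1 := by
  obtain ⟨hn, hc, hneed⟩ := hσ
  have hα : 0 < Real.sqrt 2 := by positivity
  set α := Real.sqrt 2 with hαdef
  -- √2 balances the factors 1 + α on setups and 1 + 2/α on processing time.
  have hα2 : 2 / α = α := by
    rw [div_eq_iff hα.ne', hαdef, Real.mul_self_sqrt (by norm_num)]
  obtain ⟨h1, h2⟩ := I.toBatches_val (I.splitJobs σ).val
  have hmain := I.duration_fillBatches_le hI hα _ _ h2 le_rfl none o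
    (by rw [h1]; exact I.mem_splitJobs_val hc o)
  rw [h1, ← transform_val] at hmain
  have hsum : ∑ f, I.famBound α f (I.famOps f ((I.splitJobs σ).val.upTo o))
      ≤ (1 + α) * (∑ f, if σ.idxOf (Sum.inl f) < σ.idxOf (Sum.inr o.1) then I.setup f else 0)
        + α * I.opsTime ((I.splitJobs σ).val.upTo o) := by
    rw [← sum_opsTime_famOps ((I.splitJobs σ).val.upTo o), Finset.mul_sum, Finset.mul_sum,
      ← Finset.sum_add_distrib]
    refine Finset.sum_le_sum fun f _ => (famBound_le hI hα f _).trans ?_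
    rw [hα2]
    refine add_le_add_left (mul_le_mul_of_nonneg_left ?_ (by positivity)) _
    by_cases hf : I.famOps f ((I.splitJobs σ).val.upTo o) ≠ []
    · obtain ⟨x, hx⟩ := List.exists_mem_of_ne_nil _ hf
      obtain ⟨hx, hxf⟩ := List.mem_filter.1 hx
      have hxf' : I.fam x.1 x.2 = f := by simpa using hxf
      have hx' := Nat.lt_succ_iff.1
        ((List.mem_take_iff_idxOf_lt' (I.mem_splitJobs_val hc x) _).1 hx)
      have h3 := I.idxOf_le_of_idxOf_splitJobs_le hn hc hx'
      have h4 := hneed x.1 f ((I.need_glue_iff _ _).2 ⟨x.2, hxf'⟩)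
      rw [if_pos hf, if_pos (h4.trans_le h3)]
    · rw [if_neg hf]
      split_ifs
      · exact hI.setup_nonneg f
      · exact le_rfl
  have htime := opsTime_upTo_splitJobs_le hI hn hc o
  rw [GluedInstance.completion_eq hn hc]
  change I.duration none ((I.transform α σ).val.upTo o) ≤ (1 + α) *
    ((∑ f, if σ.idxOf (Sum.inl f) < σ.idxOf (Sum.inr o.1) then I.setup f else 0) + _)
  have : (1 + α) * I.opsTime ((I.splitJobs σ).val.upTo o) ≤ (1 + α) *
      ∑ k, if σ.idxOf (Sum.inr k) ≤ σ.idxOf (Sum.inr o.1) then I.glue.p k else 0 :=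
    mul_le_mul_of_nonneg_left htime (by positivity)
  linarith

theorem cost_transform_le {I : OrderInstance K n} (hI : I.Valid)
    {σ : List (Fin K ⊕ Fin n)} (hσ : I.glue.IsSchedule σ) :
    I.cost (I.transform (Real.sqrt 2) σ).val ≤ (1 + Real.sqrt 2) * I.glue.cost σ := by
  unfold cost GluedInstance.cost
  rw [Finset.mul_sum]
  refine Finset.sum_le_sum fun j _ => ?_
  have : Nonempty (Fin (I.numOps j)) := ⟨⟨0, hI.numOps_pos j⟩⟩
  calc I.weight j * I.jobCompletion (I.transform (Real.sqrt 2) σ).val j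
      ≤ I.weight j * ((1 + Real.sqrt 2) * I.glue.completion σ j) :=
        mul_le_mul_of_nonneg_left
          (ciSup_le fun i => completion_transform_le hI hσ ⟨j, i⟩) (hI.weight_nonneg j)
    _ = (1 + Real.sqrt 2) * (I.glue.w j * I.glue.completion σ j) := by
        change _ = (1 + Real.sqrt 2) * (I.weight j * _)
        ring

/-! ### The program that glues the jobs -/

theorem glueJobT_val (I : OrderInstance K n) (j : Fin n) (is : List (Fin (I.numOps j))) (t : ℝ)
    (row : Fin K → Bool) :
    (I.glueJobT j is t row).val
      = (t + (is.map (I.time j)).sum, fun f => row f || decide (∃ i ∈ is, I.fam j i = f)) := by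
  induction is generalizing t row with
  | nil => simp [glueJobT]
  | cons i is ih =>
    simp only [glueJobT, bind_val, op_val, ih, List.map_cons, List.sum_cons, add_assoc]
    congr 1
    funext f
    by_cases h : f = I.fam j i
    · subst h
      simp
    · simp [h, Ne.symm h]

theorem glueJobsT_val (I : OrderInstance K n) (js : List (Fin n)) (p : Fin n → ℝ)
    (need : Fin n → Fin K → Bool) :
    (I.glueJobsT js p need).val
      = ⟨fun j => if j ∈ js then I.glue.p j else p j, I.weight,
          fun j => if j ∈ js then I.glue.need j else need j, I.setup⟩ := by
  induction js generalizing p need with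
  | nil => simp [glueJobsT]
  | cons j js ih =>
    have h1 : ((List.finRange (I.numOps j)).map (I.time j)).sum = I.glue.p j := by
      simp [glue, Fin.sum_univ_def]
    have h2 : (fun f => decide (∃ i, I.fam j i = f)) = I.glue.need j := rfl
    simp only [glueJobsT, bind_val, op_val, ih, indices_val, newTable_val, glueJobT_val, zero_add,
      h1, Bool.false_or, List.mem_finRange, true_and, h2]
    congr 1 <;> funext k <;> by_cases hk : k = j
    · subst hk
      simp
    · simp [hk]
    · subst hk
      simp
    · simp [hk]

theorem glueT_val (I : OrderInstance K n) : I.glueT.val = I.glue := by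
  simp [glueT, glueJobsT_val, glue]

theorem approximate_val (I : OrderInstance K n) :
    I.approximate.val = (I.transform (Real.sqrt 2) I.glue.solve.val).val := by
  simp [approximate, glueT_val]

theorem isSchedule_approximate {I : OrderInstance K n} (hI : I.Valid) :
    I.IsSchedule I.approximate.val := by
  have h := GluedInstance.solve_isSchedule (glue_valid hI)
  rw [approximate_val]
  exact isSchedule_transform _ h.1 h.2.1

/-- Transform loses a factor 1 + √2 against the optimum of the glued relaxation, which is at most
the cost of any schedule. -/
theorem cost_approximate_le {I : OrderInstance K n} (hI : I.Valid) {L : List I.Op}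
    (hL : I.IsSchedule L) : I.cost I.approximate.val ≤ (1 + Real.sqrt 2) * I.cost L := by
  obtain ⟨L', hL', hcost⟩ := glue_cost_le_cost hI hL
  rw [approximate_val]
  refine (cost_transform_le hI (GluedInstance.solve_isSchedule (glue_valid hI))).trans ?_
  exact mul_le_mul_of_nonneg_left
    ((GluedInstance.solve_optimal (glue_valid hI) hL').trans hcost) (by positivity)

/-! ### Running time of the approximation algorithm -/

theorem glueJobT_steps (I : OrderInstance K n) (j : Fin n) (is : List (Fin (I.numOps j))) (t : ℝ)
    (row : Fin K → Bool) : (I.glueJobT j is t row).steps = 5 * is.length + 1 := by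
  induction is generalizing t row with
  | nil => simp [glueJobT]
  | cons i is ih => simp [glueJobT, ih]; ring

theorem glueJobsT_steps (I : OrderInstance K n) (js : List (Fin n)) (p : Fin n → ℝ)
    (need : Fin n → Fin K → Bool) :
    (I.glueJobsT js p need).steps = 6 * (js.map I.numOps).sum + js.length * (K + 6) + 2 := by
  induction js generalizing p need with
  | nil => simp [glueJobsT]
  | cons j js ih =>
    simp only [glueJobsT, bind_steps, tick_steps, indices_steps, indices_val, newTable_steps,
      glueJobT_steps, List.length_finRange, op_steps, ih, List.map_cons, List.sum_cons,
      List.length_cons]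
    ring

theorem glueT_steps (I : OrderInstance K n) :
    I.glueT.steps = 6 * I.totalOps + n * (K + 9) + K + 6 := by
  simp only [glueT, bind_steps, indices_steps, newTable_steps, glueJobsT_steps, indices_val,
    List.length_finRange]
  rw [← Fin.sum_univ_def]
  unfold totalOps
  ring

theorem tagOps_steps (I : OrderInstance K n) (j : Fin n) (is : List (Fin (I.numOps j))) :
    (I.tagOps j is).steps = 3 * is.length + 1 := by
  induction is with
  | nil => simp [tagOps]
  | cons i is ih => simp [tagOps, ih]; ring

theorem splitJobs_steps_le (I : OrderInstance K n) (σ : List (Fin K ⊕ Fin n)) :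
    (I.splitJobs σ).steps ≤ 4 * σ.length + 6 * (I.splitJobs σ).val.length + 1 := by
  induction σ with
  | nil => simp [splitJobs]
  | cons x σ ih =>
    rcases x with f | j
    · simp only [splitJobs, bind_steps, bind_val, tick_steps, List.length_cons]
      omega
    · simp only [splitJobs, bind_steps, bind_val, tick_steps, List.length_cons, indices_steps,
        indices_val, tagOps_steps, tagOps_val, append_steps, append_val, List.length_append,
        List.length_map, List.length_finRange]
      omega

theorem toBatches_steps_le (I : OrderInstance K n) (L : List I.Op) :
    (I.toBatches L).steps ≤ 6 * L.length + 1 := by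
  induction L with
  | nil => simp [toBatches]
  | cons o L ih =>
    simp only [toBatches, bind_steps, tick_steps, op_steps, op_val, List.length_cons]
    rcases (I.toBatches L).val with _ | ⟨B, R⟩
    · simp only [bind_steps, op_steps]
      omega
    · by_cases hf : B.fam = I.fam o.1 o.2
      · simp only [bind_steps, op_steps, op_val, hf, decide_true, if_true]
        omega
      · simp only [bind_steps, op_steps, op_val, hf, decide_false, Bool.false_eq_true, if_false]
        omega

theorem totalTime_steps (I : OrderInstance K n) (L : List I.Op) :
    (I.totalTime L).steps = 3 * L.length + 1 := by
  induction L with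
  | nil => simp [totalTime]
  | cons o L ih => simp [totalTime, ih]; ring

theorem pullOps_steps_le (I : OrderInstance K n) (limit : ℝ) (L : List I.Op) (total : ℝ) :
    (I.pullOps limit L total).steps ≤ 5 * L.length + 1 := by
  induction L generalizing total with
  | nil => simp [pullOps]
  | cons o L ih =>
    have := ih (total + I.time o.1 o.2)
    by_cases h : total + I.time o.1 o.2 < limit
    · simp only [pullOps, bind_steps, tick_steps, op_steps, op_val, h, decide_true, if_true,
        pure_steps, List.length_cons]
      omega
    · simp only [pullOps, bind_steps, tick_steps, op_steps, op_val, h, decide_false,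
        Bool.false_eq_true, if_false, pure_steps, List.length_cons]
      omega

theorem pullBatches_steps_le (I : OrderInstance K n) (f : Fin K) (limit : ℝ) (R : List I.Batch)
    (total : ℝ) : (I.pullBatches f limit R total).steps
      ≤ 7 * (flattenBatches R).length + 5 * R.length + 1 := by
  induction R generalizing total with
  | nil => simp [pullBatches]
  | cons B R ih =>
    rw [flattenBatches_cons, List.length_append, List.length_cons]
    by_cases hf : B.fam = f
    · obtain ⟨A, rest, q1, q2, -, -⟩ := I.pullOps_val limit B.ops total
      have hp := I.pullOps_steps_le limit B.ops total
      have hlen : A.length ≤ B.ops.length := by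
        rw [q2, List.length_append]
        omega
      rcases rest with _ | ⟨y, rest⟩
      · have := ih (total + I.opsTime A)
        simp only [pullBatches, bind_steps, tick_steps, op_steps, op_val, hf, decide_true, if_true,
          q1, append_steps, pure_steps]
        omega
      · simp only [pullBatches, bind_steps, tick_steps, op_steps, op_val, hf, decide_true, if_true,
          q1, pure_steps]
        omega
    · have := ih total
      simp only [pullBatches, bind_steps, tick_steps, op_steps, op_val, hf, decide_false,
        Bool.false_eq_true, if_false, pure_steps]
      omega

/-- One round is linear in the number of remaining operations, and pulling never increases that
number; hence a quadratic bound overall. -/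
theorem fillBatches_steps_le (I : OrderInstance K n) (α : ℝ) (M m : ℕ) (R : List I.Batch)
    (hR : BatchesValid R) (hM : (flattenBatches R).length ≤ M) :
    (I.fillBatches α m R).steps ≤ m * (19 * M + 7) + 1 := by
  induction m generalizing R with
  | zero => simp [fillBatches]
  | succ m ih =>
    rcases R with _ | ⟨B, R⟩
    · simp [fillBatches]
    · rw [batchesValid_cons] at hR
      obtain ⟨T, R', h1, h2, -, h4, -, -⟩ := I.pullBatches_val B.fam (α * I.setup B.fam) R
        (I.opsTime B.ops) hR.2
      have e1 := I.pullBatches_steps_le B.fam (α * I.setup B.fam) R (I.opsTime B.ops)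
      have e2 := h4.perm.length_eq
      have e3 := length_flattenBatches_le hR.2
      rw [flattenBatches_cons, List.length_append] at hM
      rw [List.length_append] at e2
      have e4 := ih R' h2 (by omega)
      simp only [fillBatches, bind_steps, tick_steps, op_steps, op_val, totalTime_val, h1,
        totalTime_steps, append_steps]
      rw [Nat.add_mul, one_mul]
      omega

theorem length_splitJobs_val {I : OrderInstance K n} {σ : List (Fin K ⊕ Fin n)}
    (hn : σ.Nodup) (hc : ∀ x, x ∈ σ) : (I.splitJobs σ).val.length = I.totalOps := by
  have h : (I.splitJobs σ).val.toFinset = Finset.univ := by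
    ext o
    simpa using I.mem_splitJobs_val hc o
  rw [← List.toFinset_card_of_nodup (I.nodup_splitJobs_val hn), h, Finset.card_univ]
  simp [totalOps]

theorem transform_steps_le {I : OrderInstance K n} (α : ℝ) {σ : List (Fin K ⊕ Fin n)}
    (hn : σ.Nodup) (hc : ∀ x, x ∈ σ) :
    (I.transform α σ).steps ≤ 4 * (K + n) + I.totalOps * (19 * I.totalOps + 21) + 4 := by
  have hσ : σ.length = K + n := by
    have h : σ.toFinset = Finset.univ := by
      ext x
      simpa using hc x
    rw [← List.toFinset_card_of_nodup hn, h, Finset.card_univ]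
    simp
  obtain ⟨h1, h2⟩ := I.toBatches_val (I.splitJobs σ).val
  have hlen := length_splitJobs_val (I := I) hn hc
  have e0 := length_flattenBatches_le h2
  rw [h1, hlen] at e0
  have e1 := I.splitJobs_steps_le σ
  have e2 := I.toBatches_steps_le (I.splitJobs σ).val
  have e3 := I.fillBatches_steps_le α I.totalOps (I.toBatches (I.splitJobs σ).val).val.length
    (I.toBatches (I.splitJobs σ).val).val h2 (by rw [h1, hlen])
  rw [hlen] at e1 e2
  have e4 := Nat.mul_le_mul_right (19 * I.totalOps + 7) e0
  simp only [transform, bind_steps, length_steps, length_val]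
  rw [hσ] at e1
  have e5 : I.totalOps * (19 * I.totalOps + 21)
    = I.totalOps * (19 * I.totalOps + 7) + 14 * I.totalOps := by ring
  omega

theorem approximate_steps_le {I : OrderInstance K n} (hI : I.Valid) :
    I.approximate.steps ≤ 200 * ((I.totalOps + K + 1) ^ 2 * K.factorial) := by
  have h := GluedInstance.solve_isSchedule (glue_valid hI)
  have e1 := I.glue.solve_steps_le
  have e2 := transform_steps_le (I := I) (Real.sqrt 2) h.1 h.2.1
  have e3 := I.glueT_steps
  have e4 : I.approximate.steps = I.glueT.steps + (I.glue.solve.steps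
      + (I.transform (Real.sqrt 2) I.glue.solve.val).steps) := by
    simp [approximate, glueT_val]
  -- Every job has an operation, so bounds in n turn into bounds in the total number of operations.
  have hN : n ≤ I.totalOps := by
    have : ∑ _j : Fin n, 1 ≤ I.totalOps := Finset.sum_le_sum fun j _ => hI.numOps_pos j
    simpa using this
  -- The crude bound suffices, since Transform is quadratic anyway.
  have hclog : Nat.clog 2 n ≤ n := Nat.clog_le_of_le_pow Nat.lt_two_pow_self.le
  have hF := Nat.factorial_pos K
  rw [e4]
  set N := I.totalOps
  set F := K.factorial
  have e5 : n * Nat.clog 2 n ≤ N * N := Nat.mul_le_mul hN (hclog.trans hN)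
  have e6 : n * K ≤ N * K := Nat.mul_le_mul_right K hN
  have e7 : I.glue.solve.steps ≤ 19 * (N * N) + F * (17 * (N * K) + 24 * K + 19 * N + 24) := by
    refine e1.trans (add_le_add (Nat.mul_le_mul_left _ e5) (Nat.mul_le_mul_left _ ?_))
    omega
  have e8 : I.glueT.steps + (I.transform (Real.sqrt 2) I.glue.solve.val).steps
      ≤ 40 * (N + K + 1) ^ 2 := by
    nlinarith [Nat.zero_le (N * K), Nat.zero_le (N * N), Nat.zero_le (K * K)]
  have e9 : 40 * (N + K + 1) ^ 2 + 19 * (N * N) ≤ F * (59 * (N + K + 1) ^ 2) := by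
    refine le_trans ?_ (Nat.le_mul_of_pos_left _ hF)
    nlinarith [Nat.zero_le (N * K), Nat.zero_le (K * K)]
  have e10 : F * (17 * (N * K) + 24 * K + 19 * N + 24) ≤ F * (141 * (N + K + 1) ^ 2) := by
    refine Nat.mul_le_mul_left _ ?_
    nlinarith [Nat.zero_le (N * K), Nat.zero_le (N * N), Nat.zero_le (K * K)]
  have e11 : F * (59 * (N + K + 1) ^ 2) + F * (141 * (N + K + 1) ^ 2)
      = 200 * ((N + K + 1) ^ 2 * F) := by ring
  omega

end OrderInstance

/-! ### The theorem -/

theorem mainTheorem2 :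
    -- fixed setup order: one leftmost greedy move per job gives an optimal schedule
    (∀ (K n : ℕ) (G : GluedInstance K n), G.Valid → ∀ τ : Equiv.Perm (Fin K),
      G.IsSchedule (G.blockSchedule τ (G.localSearch τ)) ∧
      GluedInstance.setupOrder (G.blockSchedule τ (G.localSearch τ)) = List.ofFn τ ∧
      ∀ L, G.IsSchedule L → GluedInstance.setupOrder L = List.ofFn τ →
        G.cost (G.blockSchedule τ (G.localSearch τ)) ≤ G.cost L) ∧
    -- the local search algorithm solves the one-time setup problem optimally, within the time bound
    (∃ C : ℝ, ∀ (K n : ℕ) (G : GluedInstance K n), G.Valid →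
      G.IsSchedule G.solve.val ∧
      (∀ L, G.IsSchedule L → G.cost G.solve.val ≤ G.cost L) ∧
      (∃ τ : Equiv.Perm (Fin K), G.solve.val = G.blockSchedule τ (G.localSearch τ)) ∧
      (1 ≤ n → (G.solve.steps : ℝ) ≤ C * (n * (Real.log n + K) * K.factorial)) ∧
      (2 ^ K ≤ n → (G.solve.steps : ℝ) ≤ C * (n * Real.log n * K.factorial))) ∧
    -- the same optimality for jobs that consist of several operations
    (∀ (K n : ℕ) (I : OrderInstance K n), I.Valid →
      I.IsOneTimeSchedule (I.unglue I.glue.solve.val) ∧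
      ∀ L, I.IsOneTimeSchedule L →
        I.oneTimeCost (I.unglue I.glue.solve.val) ≤ I.oneTimeCost L) ∧
    -- together with Transform: a (1 + √2)-approximation, in polynomial time for constant K
    (∃ (C : ℝ) (d : ℕ), ∀ (K n : ℕ) (I : OrderInstance K n), I.Valid →
      I.IsSchedule I.approximate.val ∧
      (∀ L, I.IsSchedule L → I.cost I.approximate.val ≤ (1 + Real.sqrt 2) * I.cost L) ∧
      (I.approximate.steps : ℝ) ≤ C * ((I.totalOps + K + 1) ^ d * K.factorial)) := by
  refine ⟨fun K n G hG τ => ⟨?_, G.setupOrder_blockSchedule τ _, fun L hL hτ =>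
      GluedInstance.localSearch_optimal hG τ hL hτ⟩, ⟨450, fun K n G hG => ?_⟩,
    fun K n I hI => ?_, ⟨200, 2, fun K n I hI => ?_⟩⟩
  · exact GluedInstance.isSchedule_blockSchedule fun j => GluedInstance.localSearch_isMove hG τ j
  · obtain ⟨τ, hτ, _⟩ := GluedInstance.solve_val hG
    refine ⟨GluedInstance.solve_isSchedule hG, fun L hL => GluedInstance.solve_optimal hG hL,
      ⟨τ, hτ⟩, fun hn => ?_, GluedInstance.solve_steps_le_log_of_two_pow_le hG⟩
    -- This bound holds with 150; the constant 450 is dictated by the bound for n ≥ 2^K.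
    refine (GluedInstance.solve_steps_le_log hG hn).trans ?_
    have : 0 ≤ (n : ℝ) * (Real.log n + K) * K.factorial := by
      have := Real.log_natCast_nonneg n
      positivity
    linarith
  · have h := GluedInstance.solve_isSchedule (OrderInstance.glue_valid hI)
    refine ⟨OrderInstance.isOneTimeSchedule_unglue h, fun L hL => ?_⟩
    obtain ⟨L', hL', hcost⟩ := OrderInstance.glue_cost_le_oneTimeCost hI hL
    exact (OrderInstance.oneTimeCost_unglue_le hI h).trans
      ((GluedInstance.solve_optimal (OrderInstance.glue_valid hI) hL').trans hcost)
  · refine ⟨OrderInstance.isSchedule_approximate hI,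
      fun L hL => OrderInstance.cost_approximate_le hI hL, ?_⟩
    exact_mod_cast OrderInstance.approximate_steps_le hI
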